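/- **Setting.** Let $d\ge 1$, let $\xi$ have law $P$ on a measurable space, let $f(\cdot;\xi):\mathbb R^d\to\mathbb R$ be twice continuously differentiable for every $\xi$, and $F(x)=\mathbb E_\xi f(x;\xi)$. Assume that, for all $x,y,\xi$, $$\|\nabla f(x;\xi)-\nabla f(y;\xi)\|\le L\|x-y\|,\qquad \|\nabla^2 f(x;\xi)-\nabla^2 f(y;\xi)\|\le\rho\|x-y\|,\qquad \|\nabla f(x;\xi)-\nabla F(x)\|^2\le\sigma^2,$$ and that $F$ is bounded below with $F(x_1)-\inf F\le\Delta$ at the initial point $x_1$; here $L,\rho,\sigma,\Delta>0$. A point $x$ is an $(\epsilon,\epsilon_H)$-approximate local minimum if $\|\nabla F(x)\|\le\epsilon$ and $\lambda_{\min}(\nabla^2F(x))\ge-\epsilon_H$. **Algorithm (LENA with SARAH/SPIDER).** Inputs: $B,b,q,\eta,\eta_H,r,T,\bar D$ and a threshold $\theta$. The gradient estimate is $d_{t+1}=\frac1B\sum_{i\le B}\nabla f(x_{t+1};\xi^i_{t+1})$ if $q\mid t$, and $d_{t+1}=d_t+\frac1b\sum_{i\le b}[\nabla f(x_{t+1};\xi^i_{t+1})-\nabla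 f(x_t;\xi^i_{t+1})]$ otherwise, with fresh independent samples, starting from $d_1$ (the case $t=0$). It costs $B$, respectively $2b$, stochastic gradient evaluations. Descent phase: while $\|d_t\|>\theta$, set $x_{t+1}=x_t-\eta\, d_t/\|d_t\|$. Once $\|d_t\|\le\theta$, put $m=t$ and $x_{m+1}=x_m+\zeta$ with $\zeta$ uniform on the ball of radius $r$ about $0$, and begin an escape phase of at most $T$ iterations $x_{t+1}=x_t-\eta_t d_t$ with $\eta_t=\eta_H$. If in one of them $\sum_{m<i\le t}\eta_i^2\|d_i\|^2>(t-m+1)\bar D$ with $\eta_t=\eta_H$, then $\eta_t$ is instead chosen so that equality holds, the step is made, and the algorithm returns to the descent phase. If all $T$ iterations are made without this happening, it stops and outputs $x_m$. **Theorem.** There are absolute constants $C>0$ and $p\in\mathbb N$ with the following property. Let $\epsilon,\epsilon_H>0$, $\delta\in(0,1)$, $\nu\in(0,1]$ and $$\Lambda=1+\log\Big(\frac{d}{\delta\nu}\Big(1+\frac{L}{\epsilon_H}\Big)\Big(1+\frac{\rho\epsilon}{\epsilon_H^2}\Big)\Big(1+\frac{L\Delta}{\epsilon^2}\Big)\Big).$$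 Suppose that $\epsilon,\epsilon_H$ are small enough that $\epsilon_H\le L$, $\sigma\epsilon\le L\Delta$, $\sigma\epsilon_H^2\le\rho L\Delta$ and $L^2\le\Lambda\sigma\rho$ (for fixed $L,\rho,\sigma,\Delta$ this holds for all sufficiently small $\epsilon,\epsilon_H$). Then there are $b,T\in\mathbb N$ and $\eta_H$, depending only on $d,L,\rho,\sigma,\Delta,\epsilon,\epsilon_H,\delta,\nu$, such that with $B=b^2$ $$\frac{\sigma^2}{\epsilon^2}+\frac{\sigma^2\rho^2}{\epsilon_H^4}\le B\le C\Lambda^p\Big(\frac{\sigma^2}{\epsilon^2}+\frac{\sigma^2\rho^2}{\epsilon_H^4}\Big),\qquad \frac1{C\Lambda^pL}\le\eta_H\le\frac1L,\qquad \frac1{\eta_H\epsilon_H}\le T\le\frac{C\Lambda^p}{\eta_H\epsilon_H},$$ and the following holds for every $f,P,x_1$ as above. Run the algorithm with these $B,b,\eta_H,T$, with $q=b=\sqrt B$, $\eta=\sigma/(2\sqrt BL)$, $\bar D=\sigma^2/(4BL^2)$, any threshold $\theta\in[\epsilon/2,\epsilon]$, and any $r\in[\nu r_{\max},r_{\max}]$,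 where $$r_{\max}=\min\Big\{\frac{\sigma}{2\sqrt BL},\ \frac{\log(4/\delta)\eta_H\sigma^2}{2B\epsilon},\ \sqrt{\frac{2\log(4/\delta)\eta_H\sigma^2}{BL}}\Big\}.$$ Then with probability at least $1-\delta$ it stops and outputs a $(\theta+\epsilon/2,\epsilon_H)$-approximate local minimum (hence an $(\epsilon,\epsilon_H)$-approximate local minimum if $\theta=\epsilon/2$) after at most $$C\Lambda^p\Big(\frac{\sigma L\Delta}{\epsilon^3}+\frac{\sigma\rho^3L\Delta}{\epsilon_H^6}\Big)$$ stochastic gradient evaluations. For $\epsilon_H=\sqrt\epsilon$ and all other quantities fixed, this bound is $O(\epsilon^{-3}\log^p(1/\epsilon))$ as $\epsilon\to0$. -/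

import Mathlib

open MeasureTheory ProbabilityTheory Filter Topology

noncomputable section

namespace Lena

/-- The Euclidean space `ℝ^d`. -/
abbrev Vec (d : ℕ) : Type := EuclideanSpace ℝ (Fin d)

/-! ### The optimization problem -/

/-- The Hessian of `g` at `x`, as a linear operator: the derivative of the gradient. -/
def hess {d : ℕ} (g : Vec d → ℝ) (x : Vec d) : Vec d →L[ℝ] Vec d :=
  fderiv ℝ (gradient g) x

/-- The minimum eigenvalue of a (symmetric) operator. -/
def lambdaMin {d : ℕ} (A : Vec d →L[ℝ] Vec d) : ℝ :=
  sInf {c : ℝ | Module.End.HasEigenvalue (A : Vec d →ₗ[ℝ] Vec d) c}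

/-- `x` is an `(ε, εH)`-approximate local minimum of `F`. -/
def IsApproxLocalMin {d : ℕ} (F : Vec d → ℝ) (ε εH : ℝ) (x : Vec d) : Prop :=
  ‖gradient F x‖ ≤ ε ∧ -εH ≤ lambdaMin (hess F x)

/-- The stochastic gradient `∇f(x; ξ)`. -/
def sgrad {d : ℕ} {Ξ : Type*} (f : Vec d → Ξ → ℝ) (x : Vec d) (ξ : Ξ) : Vec d :=
  gradient (fun z => f z ξ) x

/-- The expected objective `F(x) = E[f(x; ξ)]`. -/
def objective {d : ℕ} {Ξ : Type*} [MeasurableSpace Ξ] (P : Measure Ξ) (f : Vec d → Ξ → ℝ)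
    (x : Vec d) : ℝ :=
  ∫ ξ, f x ξ ∂P

/-- The standing assumptions: every `f(·; ξ)` is `L`-smooth with `ρ`-Lipschitz Hessian, the
stochastic gradient is within `σ` of the full gradient, and the initial gap is at most `Δ`. -/
structure Assumptions {d : ℕ} {Ξ : Type*} [MeasurableSpace Ξ] (P : Measure Ξ)
    (f : Vec d → Ξ → ℝ) (x₁ : Vec d) (L ρ σ Δ : ℝ) : Prop where
  measurable : ∀ x, Measurable (f x)
  integrable : ∀ x, Integrable (f x) P
  contDiff : ∀ ξ, ContDiff ℝ 2 (fun x => f x ξ)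
  smooth : ∀ ξ x y, ‖sgrad f x ξ - sgrad f y ξ‖ ≤ L * ‖x - y‖
  hessLipschitz : ∀ ξ x y,
    ‖hess (fun z => f z ξ) x - hess (fun z => f z ξ) y‖ ≤ ρ * ‖x - y‖
  noise : ∀ x ξ, ‖sgrad f x ξ - gradient (objective P f) x‖ ^ 2 ≤ σ ^ 2
  bddBelow : BddBelow (Set.range (objective P f))
  gap : objective P f x₁ - ⨅ x, objective P f x ≤ Δ

/-! ### The algorithm -/

/-- The inputs of the algorithm: batch size `B`, mini-batch size `b`, loop length `q`, step sizes
`η` (descent phase) and `ηH` (escape phase), perturbation radius `r`, number `T` of escape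
iterations, average movement `Dbar`, and threshold `θ` on the norm of the gradient estimate. -/
structure Params where
  B : ℕ
  b : ℕ
  q : ℕ
  η : ℝ
  ηH : ℝ
  r : ℝ
  T : ℕ
  Dbar : ℝ
  θ : ℝ

/-- The SARAH/SPIDER estimate at `x'`, from the estimate `g` at the previous iterate `x` and the
samples `s 0, s 1, …` drawn at this step. -/
def spider {d : ℕ} {Ξ : Type*} (f : Vec d → Ξ → ℝ) (a : Params) (t : ℕ) (g x x' : Vec d)
    (s : ℕ → Ξ) : Vec d :=
  if t % a.q = 0 then
    (a.B : ℝ)⁻¹ • ∑ i ∈ Finset.range a.B, sgrad f x' (s i)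
  else
    g + (a.b : ℝ)⁻¹ • ∑ i ∈ Finset.range a.b, (sgrad f x' (s i) - sgrad f x (s i))

/-- The number of stochastic gradients which that estimate evaluates. -/
def spiderCost (a : Params) (t : ℕ) : ℕ :=
  if t % a.q = 0 then a.B else 2 * a.b

/-- What the algorithm does next: a descent iteration (with its loop test), an escape iteration,
or nothing any more. -/
inductive Phase
  | descent
  | escape
  | halted

/-- A configuration: iteration counter `t`, iterate `x = x_t`, gradient estimate `g = d_t`, phase,
the index `m = m_s` and the point `anchor = x_{m_s}` at which the latest escape phase began, the
number `k` of its iterations made so far, its accumulated squared movement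
`D = ∑_{m_s < i < t} η_i² ‖d_i‖²`, and the number `cost` of stochastic gradients evaluated. -/
structure State (d : ℕ) where
  t : ℕ
  x : Vec d
  g : Vec d
  phase : Phase
  m : ℕ
  anchor : Vec d
  k : ℕ
  D : ℝ
  cost : ℕ

/-- The randomness of one step: a sequence of samples, and a point of the unit ball. -/
abbrev Draw (d : ℕ) (Ξ : Type*) : Type _ := (ℕ → Ξ) × Vec d

/-- Move to `x'`, update the gradient estimate and the evaluation count, increase `t`. -/
def State.moveTo {d : ℕ} {Ξ : Type*} (f : Vec d → Ξ → ℝ) (a : Params) (s : State d)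
    (x' : Vec d) (ω : Draw d Ξ) : State d :=
  { s with
    t := s.t + 1
    x := x'
    g := spider f a s.t s.g s.x x' ω.1
    cost := s.cost + spiderCost a s.t }

/-- One step of the algorithm.  The perturbation `a.r • ω.2` is uniform on the ball of radius
`a.r` about `0`, because `ω.2` is uniform on the unit ball. -/
def step {d : ℕ} {Ξ : Type*} (f : Vec d → Ξ → ℝ) (a : Params) (s : State d)
    (ω : Draw d Ξ) : State d :=
  match s.phase with
  | .halted => s
  | .descent =>
      if a.θ < ‖s.g‖ then
        -- normalized gradient step
        s.moveTo f a (s.x - (a.η / ‖s.g‖) • s.g) ω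
      else
        -- perturbation; an escape phase begins
        { s.moveTo f a (s.x + a.r • ω.2) ω with
          phase := .escape
          m := s.t
          anchor := s.x
          k := 0
          D := 0 }
  | .escape =>
      if a.T ≤ s.k then
        -- the escape phase was completed without a break: stop
        { s with phase := .halted }
      else if (s.t - s.m + 1 : ℝ) * a.Dbar < s.D + a.ηH ^ 2 * ‖s.g‖ ^ 2 then
        -- last step shrinkage, then back to the descent phase; the step size makes the
        -- accumulated squared movement equal to `(t - m + 1) * Dbar`
        { s.moveTo f a
            (s.x - (Real.sqrt ((s.t - s.m + 1 : ℝ) * a.Dbar - s.D) / ‖s.g‖) • s.g) ω with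
          phase := .descent
          D := (s.t - s.m + 1 : ℝ) * a.Dbar }
      else
        { s.moveTo f a (s.x - a.ηH • s.g) ω with
          k := s.k + 1
          D := s.D + a.ηH ^ 2 * ‖s.g‖ ^ 2 }

/-- The initial configuration: `t = 1` at `x₁`, with the estimate made by the call at time `0`. -/
def init {d : ℕ} {Ξ : Type*} (f : Vec d → Ξ → ℝ) (a : Params) (x₁ : Vec d)
    (ω : Draw d Ξ) : State d where
  t := 1
  x := x₁
  g := spider f a 0 0 0 x₁ ω.1
  phase := .descent
  m := 0
  anchor := x₁
  k := 0
  D := 0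
  cost := spiderCost a 0

/-- The run of the algorithm on the random draws `ω 0, ω 1, …`. -/
def run {d : ℕ} {Ξ : Type*} (f : Vec d → Ξ → ℝ) (a : Params) (x₁ : Vec d)
    (ω : ℕ → Draw d Ξ) : ℕ → State d
  | 0 => init f a x₁ (ω 0)
  | n + 1 => step f a (run f a x₁ ω n) (ω (n + 1))

/-- On the draws `ω`, the algorithm stops after at most `K` stochastic gradient evaluations, and
its output `x_{m_s}` is an `(ε, εH)`-approximate local minimum of `F`. -/
def Succeeds {d : ℕ} {Ξ : Type*} (F : Vec d → ℝ) (f : Vec d → Ξ → ℝ) (a : Params)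
    (x₁ : Vec d) (ε εH K : ℝ) (ω : ℕ → Draw d Ξ) : Prop :=
  ∃ n, (run f a x₁ ω n).phase = Phase.halted ∧ ((run f a x₁ ω n).cost : ℝ) ≤ K ∧
    IsApproxLocalMin F ε εH (run f a x₁ ω n).anchor

/-- The uniform distribution on the unit ball of `ℝ^d`. -/
def unifBall (d : ℕ) : Measure (Vec d) :=
  cond volume (Metric.closedBall (0 : Vec d) 1)

instance instUnifBall (d : ℕ) : IsProbabilityMeasure (unifBall d) :=
  cond_isProbabilityMeasure_of_finite
    (Metric.measure_closedBall_pos volume (0 : Vec d) one_pos).ne'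
    measure_closedBall_lt_top.ne

/-- The law of the draws: all samples have law `P`, all perturbations are uniform on the unit
ball, and all of them are independent. -/
def drawLaw {Ξ : Type*} [MeasurableSpace Ξ] (P : Measure Ξ) [IsProbabilityMeasure P] (d : ℕ) :
    Measure (ℕ → Draw d Ξ) :=
  Measure.infinitePi fun _ : ℕ => (Measure.infinitePi fun _ : ℕ => P).prod (unifBall d)

/-! ### The parameter choices -/

/-- The logarithmic factor.  Each of the four factors under the logarithm is at least `1`. -/
def logFactor (d : ℕ) (L ρ Δ ε εH δ ν : ℝ) : ℝ :=
  1 + Real.log (d / (δ * ν) * (1 + L / εH) * (1 + ρ * ε / εH ^ 2) * (1 + L * Δ / ε ^ 2))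

/-- The order `σ² ε⁻² + σ² ρ² εH⁻⁴` of the batch size. -/
def batchOrder (ρ σ ε εH : ℝ) : ℝ :=
  σ ^ 2 / ε ^ 2 + σ ^ 2 * ρ ^ 2 / εH ^ 4

/-- The order `σ L Δ ε⁻³ + σ ρ³ L Δ εH⁻⁶` of the number of stochastic gradient evaluations. -/
def gradOrder (L ρ σ Δ ε εH : ℝ) : ℝ :=
  σ * L * Δ / ε ^ 3 + σ * ρ ^ 3 * L * Δ / εH ^ 6

/-- The largest admissible perturbation radius, for the batch size `b ^ 2`. -/
def rMax (b : ℕ) (ηH L σ ε δ : ℝ) : ℝ :=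
  min (σ / (2 * b * L))
    (min (Real.log (4 / δ) * ηH * σ ^ 2 / (2 * (b : ℝ) ^ 2 * ε))
      (Real.sqrt (2 * Real.log (4 / δ) * ηH * σ ^ 2 / ((b : ℝ) ^ 2 * L))))

/-- The inputs of the algorithm: `B = b²`, `q = b`, `η = σ / (2 √B L)`,
`Dbar = σ² / (4 B L²)`. -/
def params (b T : ℕ) (ηH r θ L σ : ℝ) : Params where
  B := b ^ 2
  b := b
  q := b
  η := σ / (2 * b * L)
  ηH := ηH
  r := r
  T := T
  Dbar := σ ^ 2 / (4 * (b : ℝ) ^ 2 * L ^ 2)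
  θ := θ

end Lena

end

/-!
Why the theorem holds.

*Accuracy.* One SPIDER step adds to the error `g - ∇F x` a mean over a mini-batch of centred vectors
of norm at most `2 L ‖x' - x‖`. In a Hilbert space a centred vector `Y` with `‖Y‖ ≤ c` satisfies `E
cosh (l ‖x + Y‖) ≤ cosh (l ‖x‖) cosh (l c)` (`lintegral_cosh_norm_add_le`), so that `cosh (l ‖g - ∇F
x‖)` grows by a factor governed by the squared movement. The movement test of the escape phase keeps
the squared movement at `Dbar` per iteration on average; weighting by the unused movement budget
(`slack`) gives a one-step bound that can be iterated (`lintegral_errorPotential_step_le`), and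
`measure_error_le` bounds the error by `(σ / b) ℓ` at each time, up to a probability of order `exp
(-ℓ)`.

*Termination.* With accurate estimates, a normalized step decreases `F` by order `η ε`, and an
escape phase that is broken decreases it by order `Dbar / ηH` per iteration, because its accumulated
squared movement equals the budget exactly. As `F` is bounded below, the run halts (`run_halts`),
and a halted run has an anchor with small gradient from which an escape phase was never broken.

*Escape.* Such a phase is unlikely when the Hessian at the anchor has curvature below `-εH`. Couple
two phases with the same samples, started at distance `r₀` along the eigenvector `e` of least
curvature `-γ`. As long as neither is broken, both stay where the Hessian is almost constant, and
their difference follows the linear recursion `w ↦ (1 - ηH H) w` with growth `(1 + ηH γ) ^ k` along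
`e`, up to the difference of the estimation errors. That difference is again a sum of centred
vectors, whose size is controlled by the movement of the difference itself (`varProxy`); an energy
estimate for the recursion bounds the accumulated movement, and hence `gap_growth` makes the two
phases separate beyond the region that an unbroken phase can reach (`measure_both_stuck_le`). So
among points of a grid along `e` at most one can be stuck, apart from rare events. Since the uniform
distribution on the ball changes little under small translations, the perturbed point itself is
rarely stuck (`measure_perturbed_le`, `measure_stuck_le`).

*Parameters.* With `ℓ = 1000 Λ`, `ηH = 1 / (10 ℓ L)`, `T` of order `ℓ / (ηH εH)` and `b` of order `ℓ
^ 5 (σ / ε + σ ρ / εH ^ 2)`, all bounds hold, and every quantity in the union bound is at most a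
power of `exp Λ` with exponent far below `1000` (`Schedule`).
-/

noncomputable section

namespace Lena

open scoped RealInnerProductSpace

set_option linter.unusedSectionVars false

/-! ### Concentration of sums of bounded centred vectors -/

section Concentration

variable {E : Type*} [NormedAddCommGroup E] [InnerProductSpace ℝ E]

/-- The power series of `cosh` reduces this to powers of `s ^ 2`, which lies below the convex
combination of `(a + c) ^ 2` and `(a - c) ^ 2` with weights `(1 + τ) / 2` and `(1 - τ) / 2`. -/
theorem cosh_le_interpolation {a c τ l s : ℝ} (hτ : |τ| ≤ 1)
    (hs : s ^ 2 ≤ a ^ 2 + c ^ 2 + 2 * a * c * τ) :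
    Real.cosh (l * s) ≤ Real.cosh (l * a) * Real.cosh (l * c)
      + τ * (Real.sinh (l * a) * Real.sinh (l * c)) := by
  have h1 : Real.cosh (l * a) * Real.cosh (l * c)
      + τ * (Real.sinh (l * a) * Real.sinh (l * c))
      = (1 + τ) / 2 * Real.cosh (l * (a + c)) + (1 - τ) / 2 * Real.cosh (l * (a - c)) := by
    rw [mul_add, mul_sub, Real.cosh_add, Real.cosh_sub]; ring
  rw [h1]
  obtain ⟨hτ1, hτ2⟩ := abs_le.mp hτ
  refine hasSum_le ?_ (Real.hasSum_cosh (l * s))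
    (((Real.hasSum_cosh (l * (a + c))).mul_left _).add
      ((Real.hasSum_cosh (l * (a - c))).mul_left _))
  intro n
  rw [← mul_div_assoc, ← mul_div_assoc, ← add_div]
  refine div_le_div_of_nonneg_right ?_ (by positivity)
  simp only [pow_mul, mul_pow]
  obtain ⟨-, hconv⟩ := convexOn_pow (𝕜 := ℝ) n
  have hp : l ^ 2 * (a + c) ^ 2 ∈ Set.Ici (0 : ℝ) := by rw [Set.mem_Ici]; positivity
  have hm : l ^ 2 * (a - c) ^ 2 ∈ Set.Ici (0 : ℝ) := by rw [Set.mem_Ici]; positivity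
  have hcv := hconv hp hm (show 0 ≤ (1 + τ) / 2 by linarith) (show 0 ≤ (1 - τ) / 2 by linarith)
    (by ring)
  simp only [smul_eq_mul] at hcv
  simp only [← mul_pow]
  refine le_trans (pow_le_pow_left₀ (by positivity) ?_ n) (hcv.trans_eq ?_)
  · have := mul_le_mul_of_nonneg_left hs (sq_nonneg l)
    nlinarith
  · simp only [mul_pow]

/-- The tangent-type bound behind the Hilbert space Azuma inequality: because `cosh (l √s)` is
convex and increasing in `s`, the left-hand side is at most an affine function of `⟪x, y⟫`. -/
theorem cosh_norm_add_le (x y : E) {c l : ℝ} (hc : 0 < c) (hy : ‖y‖ ≤ c) :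
    Real.cosh (l * ‖x + y‖) ≤ Real.cosh (l * ‖x‖) * Real.cosh (l * c)
      + (Real.sinh (l * ‖x‖) * Real.sinh (l * c) / (‖x‖ * c)) * ⟪x, y⟫ := by
  have h2 : ‖x + y‖ ^ 2 ≤ ‖x‖ ^ 2 + c ^ 2 + 2 * ⟪x, y⟫ := by
    rw [norm_add_sq_real]
    have := pow_le_pow_left₀ (norm_nonneg y) hy 2
    linarith
  have hin : |⟪x, y⟫| ≤ ‖x‖ * c :=
    (abs_real_inner_le_norm x y).trans (by gcongr)
  rcases (norm_nonneg x).eq_or_lt with hx | hx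
  · have h0 : ⟪x, y⟫ = 0 := by
      have : |⟪x, y⟫| ≤ 0 := by simpa [← hx] using hin
      simpa using this
    have := cosh_le_interpolation (a := ‖x‖) (c := c) (τ := 0) (l := l) (s := ‖x + y‖)
      (by simp) (by simpa [h0] using h2)
    simpa [h0] using this
  · have hpos : 0 < ‖x‖ * c := mul_pos hx hc
    have := cosh_le_interpolation (a := ‖x‖) (c := c) (τ := ⟪x, y⟫ / (‖x‖ * c)) (l := l)
      (s := ‖x + y‖) (by rw [abs_div, abs_of_pos hpos]; exact div_le_one_of_le₀ hin hpos.le)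
      (by
        have : 2 * ‖x‖ * c * (⟪x, y⟫ / (‖x‖ * c)) = 2 * ⟪x, y⟫ := by field_simp
        rw [this]; exact h2)
    refine this.trans_eq ?_
    ring

variable [CompleteSpace E] [SecondCountableTopology E] [MeasurableSpace E] [BorelSpace E]

theorem lintegral_cosh_norm_add_le {Ξ : Type*} [MeasurableSpace Ξ] (P : Measure Ξ)
    [IsProbabilityMeasure P] {φ : Ξ → E} (hφ : Measurable φ) {c : ℝ} (hb : ∀ ξ, ‖φ ξ‖ ≤ c)
    (h0 : ∫ ξ, φ ξ ∂P = 0) (l : ℝ) (x : E) :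
    ∫⁻ ξ, ENNReal.ofReal (Real.cosh (l * ‖x + φ ξ‖)) ∂P
      ≤ ENNReal.ofReal (Real.cosh (l * ‖x‖) * Real.exp (l ^ 2 * c ^ 2 / 2)) := by
  have hne : Nonempty Ξ := P.nonempty_of_neZero
  have hc : 0 ≤ c := (norm_nonneg _).trans (hb hne.some)
  have hint : Integrable φ P :=
    Integrable.of_bound hφ.aestronglyMeasurable c (Eventually.of_forall hb)
  rcases hc.eq_or_lt with hc | hc
  · have hφ0 : ∀ ξ, φ ξ = 0 := fun ξ => by
      have := hb ξ; rw [← hc] at this; simpa using this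
    simp [hφ0, ← hc]
  · set K := Real.sinh (l * ‖x‖) * Real.sinh (l * c) / (‖x‖ * c)
    have hI : Integrable (fun ξ => Real.cosh (l * ‖x‖) * Real.cosh (l * c) + K * ⟪x, φ ξ⟫) P :=
      (integrable_const _).add ((hint.const_inner x).const_mul K)
    have hle : ∀ ξ, Real.cosh (l * ‖x + φ ξ‖)
        ≤ Real.cosh (l * ‖x‖) * Real.cosh (l * c) + K * ⟪x, φ ξ⟫ :=
      fun ξ => cosh_norm_add_le x (φ ξ) hc (hb ξ)
    calc ∫⁻ ξ, ENNReal.ofReal (Real.cosh (l * ‖x + φ ξ‖)) ∂P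
        ≤ ∫⁻ ξ, ENNReal.ofReal
            (Real.cosh (l * ‖x‖) * Real.cosh (l * c) + K * ⟪x, φ ξ⟫) ∂P :=
          lintegral_mono fun ξ => ENNReal.ofReal_le_ofReal (hle ξ)
      _ = ENNReal.ofReal (∫ ξ, (Real.cosh (l * ‖x‖) * Real.cosh (l * c) + K * ⟪x, φ ξ⟫) ∂P) :=
          (ofReal_integral_eq_lintegral_ofReal hI (Eventually.of_forall fun ξ =>
            (Real.cosh_pos _).le.trans (hle ξ))).symm
      _ = ENNReal.ofReal (Real.cosh (l * ‖x‖) * Real.cosh (l * c)) := by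
          have hin : ∫ ξ, ⟪x, φ ξ⟫ ∂P = 0 := by rw [integral_inner hint, h0, inner_zero_right]
          rw [integral_add (integrable_const _) ((hint.const_inner x).const_mul K),
            integral_const_mul K, hin]
          simp
      _ ≤ _ := by
          refine ENNReal.ofReal_le_ofReal ?_
          have := Real.cosh_le_exp_half_sq (l * c)
          rw [mul_pow] at this
          exact mul_le_mul_of_nonneg_left this (Real.cosh_pos _).le

end Concentration

/-! ### Resampling coordinates of a product measure -/

section Resampling

variable {X : Type*} [MeasurableSpace X]

theorem map_update_infinitePi (μ : Measure X) [IsProbabilityMeasure μ] (n : ℕ) :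
    ((Measure.infinitePi fun _ : ℕ => μ).prod μ).map
      (fun z => Function.update z.1 n z.2) = Measure.infinitePi fun _ : ℕ => μ := by
  have hm : Measurable fun z : (ℕ → X) × X => Function.update z.1 n z.2 := by
    refine measurable_pi_lambda _ fun i => ?_
    by_cases h : i = n
    · subst h; simpa using measurable_snd
    · simpa [Function.update_of_ne h] using measurable_fst.eval
  refine Measure.eq_infinitePi _ fun s t ht => ?_
  classical
  rw [Measure.map_apply hm (MeasurableSet.pi s.countable_toSet fun i _ => ht i)]
  have hset : (fun z : (ℕ → X) × X => Function.update z.1 n z.2) ⁻¹' Set.pi (↑s) t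
      = (Set.pi (↑(s.erase n)) t) ×ˢ (if n ∈ s then t n else Set.univ) := by
    ext z
    simp only [Set.mem_preimage, Set.mem_pi, Set.mem_prod, Finset.mem_coe, Finset.mem_erase]
    constructor
    · intro h
      refine ⟨fun i hi => by simpa [Function.update_of_ne hi.1] using h i hi.2, ?_⟩
      split_ifs with hn
      · simpa using h n hn
      · trivial
    · rintro ⟨h1, h2⟩ i hi
      by_cases hin : i = n
      · subst hin; simpa [hi] using h2
      · simpa [Function.update_of_ne hin] using h1 i ⟨hin, hi⟩
  rw [hset, Measure.prod_prod, Measure.infinitePi_pi _ (fun i _ => ht i)]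
  split_ifs with hn
  · rw [Finset.prod_erase_mul s _ hn]
  · rw [Finset.erase_eq_of_notMem hn]; simp

/-- One coordinate of an i.i.d. sequence may be drawn last.  An inequality is enough for upper
bounds, and it needs no measurability of `F`. -/
theorem lintegral_infinitePi_le_update (μ : Measure X) [IsProbabilityMeasure μ] (n : ℕ)
    (F : (ℕ → X) → ENNReal) :
    ∫⁻ ω, F ω ∂(Measure.infinitePi fun _ : ℕ => μ)
      ≤ ∫⁻ ω, ∫⁻ z, F (Function.update ω n z) ∂μ ∂(Measure.infinitePi fun _ : ℕ => μ) := by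
  conv_lhs => rw [← map_update_infinitePi μ n]
  exact (lintegral_map_le _ _).trans (lintegral_prod_le _)

/-- The sequence that follows `ω` before the index `n`, and from there on starts `ω'` anew. -/
def splice (n : ℕ) (ω ω' : ℕ → X) (i : ℕ) : X := if i < n then ω i else ω' (i - n)

theorem map_splice_infinitePi (μ : Measure X) [IsProbabilityMeasure μ] (n : ℕ) :
    ((Measure.infinitePi fun _ : ℕ => μ).prod (Measure.infinitePi fun _ : ℕ => μ)).map
      (fun z => splice n z.1 z.2) = Measure.infinitePi fun _ : ℕ => μ := by
  have hm : Measurable fun z : (ℕ → X) × (ℕ → X) => splice n z.1 z.2 := by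
    refine measurable_pi_lambda _ fun i => ?_
    by_cases h : i < n
    · simpa [splice, h] using measurable_fst.eval
    · simpa [splice, h] using measurable_snd.eval
  refine Measure.eq_infinitePi _ fun s t ht => ?_
  classical
  rw [Measure.map_apply hm (MeasurableSet.pi s.countable_toSet fun i _ => ht i)]
  have hinj : Set.InjOn (fun i : ℕ => i - n) (s.filter fun i => ¬ i < n) := by
    intro i hi j hj hij
    simp only [Finset.coe_filter, Set.mem_ofPred_eq] at hi hj hij
    omega
  have hset : (fun z : (ℕ → X) × (ℕ → X) => splice n z.1 z.2) ⁻¹' Set.pi (↑s) t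
      = (Set.pi (↑(s.filter fun i => i < n)) t) ×ˢ
        (Set.pi (↑((s.filter fun i => ¬ i < n).image fun i => i - n)) fun j => t (j + n)) := by
    ext z
    simp only [Set.mem_preimage, Set.mem_pi, Set.mem_prod, Finset.mem_coe, Finset.mem_filter,
      Finset.mem_image, splice]
    constructor
    · intro h
      refine ⟨fun i hi => by simpa [hi.2] using h i hi.1, ?_⟩
      rintro j ⟨i, ⟨hi, hin⟩, rfl⟩
      have := h i hi
      rw [if_neg hin] at this
      rwa [Nat.sub_add_cancel (not_lt.mp hin)]
    · rintro ⟨h1, h2⟩ i hi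
      by_cases hin : i < n
      · simpa [hin] using h1 i ⟨hi, hin⟩
      · have := h2 (i - n) ⟨i, ⟨hi, hin⟩, rfl⟩
        rw [Nat.sub_add_cancel (not_lt.mp hin)] at this
        simpa [hin] using this
  rw [hset, Measure.prod_prod, Measure.infinitePi_pi _ (fun i _ => ht i),
    Measure.infinitePi_pi _ (fun i _ => ht _), Finset.prod_image hinj,
    ← Finset.prod_filter_mul_prod_filter_not s (fun i => i < n)]
  congr 1
  refine Finset.prod_congr rfl fun i hi => ?_
  rw [Nat.sub_add_cancel (not_lt.mp (Finset.mem_filter.mp hi).2)]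

/-- An i.i.d. sequence may be drawn anew from the index `n` on. -/
theorem lintegral_infinitePi_le_splice (μ : Measure X) [IsProbabilityMeasure μ] (n : ℕ)
    (F : (ℕ → X) → ENNReal) :
    ∫⁻ ω, F ω ∂(Measure.infinitePi fun _ : ℕ => μ)
      ≤ ∫⁻ ω, ∫⁻ ω', F (splice n ω ω') ∂(Measure.infinitePi fun _ : ℕ => μ)
        ∂(Measure.infinitePi fun _ : ℕ => μ) := by
  conv_lhs => rw [← map_splice_infinitePi μ n]
  exact (lintegral_map_le _ _).trans (lintegral_prod_le _)

end Resampling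

/-- Exponential moment of the norm of a sum over a mini-batch of bounded centred vectors. -/
theorem lintegral_cosh_batch_le {E : Type*} [NormedAddCommGroup E] [InnerProductSpace ℝ E]
    [CompleteSpace E] [SecondCountableTopology E] [MeasurableSpace E] [BorelSpace E]
    {Ξ : Type*} [MeasurableSpace Ξ] (P : Measure Ξ)
    [IsProbabilityMeasure P] {φ : Ξ → E} (hφ : Measurable φ) {c : ℝ} (hb : ∀ ξ, ‖φ ξ‖ ≤ c)
    (h0 : ∫ ξ, φ ξ ∂P = 0) (l : ℝ) (x : E) (n : ℕ) :
    ∫⁻ s, ENNReal.ofReal (Real.cosh (l * ‖x + ∑ i ∈ Finset.range n, φ (s i)‖))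
        ∂(Measure.infinitePi fun _ : ℕ => P)
      ≤ ENNReal.ofReal (Real.cosh (l * ‖x‖) * Real.exp (n * (l ^ 2 * c ^ 2 / 2))) := by
  induction n with
  | zero => simp
  | succ n ih =>
    refine (lintegral_infinitePi_le_update P n _).trans ?_
    have hstep : ∀ s : ℕ → Ξ,
        ∫⁻ z, ENNReal.ofReal (Real.cosh (l * ‖x + ∑ i ∈ Finset.range (n + 1),
          φ (Function.update s n z i)‖)) ∂P
        ≤ ENNReal.ofReal (Real.cosh (l * ‖x + ∑ i ∈ Finset.range n, φ (s i)‖)) *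
          ENNReal.ofReal (Real.exp (l ^ 2 * c ^ 2 / 2)) := by
      intro s
      rw [← ENNReal.ofReal_mul (Real.cosh_pos _).le]
      refine le_trans (le_of_eq ?_) (lintegral_cosh_norm_add_le P hφ hb h0 l
        (x + ∑ i ∈ Finset.range n, φ (s i)))
      refine lintegral_congr fun z => ?_
      rw [Finset.sum_range_succ, ← add_assoc]
      simp only [Function.update_self]
      congr 6
      refine Finset.sum_congr rfl fun i hi => ?_
      rw [Function.update_of_ne (Finset.mem_range.mp hi).ne]
    refine (lintegral_mono hstep).trans ?_
    rw [lintegral_mul_const' _ _ ENNReal.ofReal_ne_top]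
    refine (mul_le_mul_left ih _).trans_eq ?_
    rw [← ENNReal.ofReal_mul (by positivity), mul_assoc, ← Real.exp_add]
    congr 3
    push_cast
    ring

/-! ### Measurability in finite dimension -/

theorem measurable_of_inner {d : ℕ} {Ξ : Type*} [MeasurableSpace Ξ] {φ : Ξ → Vec d}
    (h : ∀ v, Measurable fun ξ => ⟪v, φ ξ⟫) : Measurable φ := by
  have e := EuclideanSpace.basisFun (Fin d) ℝ
  have : φ = fun ξ => ∑ i, ⟪e i, φ ξ⟫ • e i := by
    funext ξ; exact (e.sum_repr' (φ ξ)).symm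
  rw [this]
  exact Finset.measurable_sum _ fun i _ => (h (e i)).smul_const (e i)

theorem measurable_clm_of_apply {d : ℕ} {Ξ : Type*} [MeasurableSpace Ξ]
    {A : Ξ → Vec d →L[ℝ] Vec d} (h : ∀ v, Measurable fun ξ => A ξ v) :
    StronglyMeasurable A := by
  have e := EuclideanSpace.basisFun (Fin d) ℝ
  have : A = fun ξ => ∑ i, ContinuousLinearMap.smulRightL ℝ (Vec d) (Vec d)
      (innerSL ℝ (e i)) (A ξ (e i)) := by
    funext ξ
    ext1 v
    conv_lhs => rw [← e.sum_repr' v]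
    rw [map_sum, _root_.sum_apply]
    refine Finset.sum_congr rfl fun i _ => ?_
    simp
  rw [this]
  refine Finset.stronglyMeasurable_fun_sum _ fun i _ => ?_
  exact (ContinuousLinearMap.continuous _).comp_stronglyMeasurable (h (e i)).stronglyMeasurable

theorem tendsto_slope_of_hasFDerivAt {E F : Type*} [NormedAddCommGroup E] [NormedSpace ℝ E]
    [NormedAddCommGroup F] [NormedSpace ℝ F] {g : E → F} {g' : E →L[ℝ] F} {x : E}
    (h : HasFDerivAt g g' x) (v : E) :
    Tendsto (fun n : ℕ => (n : ℝ) • (g (x + (n : ℝ)⁻¹ • v) - g x)) atTop (𝓝 (g' v)) := by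
  exact h.lim v (by simpa using tendsto_natCast_atTop_atTop (R := ℝ))

/-! ### The objective: differentiation under the expectation -/

section Objective

variable {d : ℕ} {Ξ : Type*} [MeasurableSpace Ξ] {P : Measure Ξ} {f : Vec d → Ξ → ℝ}
  {x₁ : Vec d} {L ρ σ Δ : ℝ}

theorem hasFDerivAt_gradient_of_contDiff {g : Vec d → ℝ} (hg : ContDiff ℝ 2 g) (x : Vec d) :
    HasFDerivAt (gradient g) (hess g x) x := by
  have h1 : Differentiable ℝ (fderiv ℝ g) :=
    (hg.fderiv_right (m := 1) (by norm_num)).differentiable (by norm_num)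
  have h2 : DifferentiableAt ℝ (gradient g) x :=
    ((InnerProductSpace.toDual ℝ (Vec d)).symm.toContinuousLinearEquiv.differentiableAt).comp x
      (h1 x)
  exact h2.hasFDerivAt

theorem norm_hess_le {g : Vec d → ℝ} (hL : 0 ≤ L)
    (h : ∀ x y, ‖gradient g x - gradient g y‖ ≤ L * ‖x - y‖) (x : Vec d) : ‖hess g x‖ ≤ L := by
  have : LipschitzWith (Real.toNNReal L) (gradient g) :=
    LipschitzWith.of_dist_le_mul fun x y => by
      rw [dist_eq_norm, dist_eq_norm, Real.coe_toNNReal _ hL]; exact h x y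
  simpa [hess, Real.coe_toNNReal _ hL] using norm_fderiv_le_of_lipschitz ℝ this (x₀ := x)

namespace Assumptions

theorem hasGradientAt_sample (h : Assumptions P f x₁ L ρ σ Δ) (x : Vec d) (ξ : Ξ) :
    HasGradientAt (fun z => f z ξ) (sgrad f x ξ) x :=
  (((h.contDiff ξ).differentiable (by norm_num)) x).hasGradientAt

theorem hasFDerivAt_sgrad (h : Assumptions P f x₁ L ρ σ Δ) (x : Vec d) (ξ : Ξ) :
    HasFDerivAt (fun z => sgrad f z ξ) (hess (fun z => f z ξ) x) x :=
  hasFDerivAt_gradient_of_contDiff (h.contDiff ξ) x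

theorem continuous_sgrad (h : Assumptions P f x₁ L ρ σ Δ) (ξ : Ξ) :
    Continuous fun x => sgrad f x ξ :=
  continuous_iff_continuousAt.mpr fun x => (h.hasFDerivAt_sgrad x ξ).continuousAt

theorem measurable_sgrad (h : Assumptions P f x₁ L ρ σ Δ) (x : Vec d) :
    Measurable (sgrad f x) := by
  refine measurable_of_inner fun v => ?_
  refine measurable_of_tendsto_metrizable
    (f := fun (n : ℕ) ξ => (n : ℝ) • (f (x + (n : ℝ)⁻¹ • v) ξ - f x ξ)) (fun n => ?_) ?_
  · exact ((h.measurable _).sub (h.measurable _)).const_smul (n : ℝ)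
  · refine tendsto_pi_nhds.mpr fun ξ => ?_
    have := tendsto_slope_of_hasFDerivAt (h.hasGradientAt_sample x ξ).hasFDerivAt v
    rw [InnerProductSpace.toDual_apply_apply, real_inner_comm] at this
    exact this

theorem measurable_uncurry_sgrad (h : Assumptions P f x₁ L ρ σ Δ) :
    Measurable (Function.uncurry (sgrad f)) :=
  measurable_uncurry_of_continuous_of_measurable (fun ξ => h.continuous_sgrad ξ)
    fun x => h.measurable_sgrad x

theorem stronglyMeasurable_hess (h : Assumptions P f x₁ L ρ σ Δ) (x : Vec d) :
    StronglyMeasurable fun ξ => hess (fun z => f z ξ) x := by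
  refine measurable_clm_of_apply fun v => ?_
  refine measurable_of_tendsto_metrizable
    (f := fun (n : ℕ) ξ => (n : ℝ) • (sgrad f (x + (n : ℝ)⁻¹ • v) ξ - sgrad f x ξ))
    (fun n => ?_) ?_
  · exact ((h.measurable_sgrad _).sub (h.measurable_sgrad _)).const_smul (n : ℝ)
  · exact tendsto_pi_nhds.mpr fun ξ => tendsto_slope_of_hasFDerivAt (h.hasFDerivAt_sgrad x ξ) v

theorem norm_sgrad_sub_le (h : Assumptions P f x₁ L ρ σ Δ) (hσ : 0 ≤ σ) (x : Vec d) (ξ : Ξ) :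
    ‖sgrad f x ξ - gradient (objective P f) x‖ ≤ σ :=
  (sq_le_sq₀ (norm_nonneg _) hσ).mp (h.noise x ξ)

variable [IsProbabilityMeasure P]

theorem integrable_sgrad (h : Assumptions P f x₁ L ρ σ Δ) (hσ : 0 ≤ σ) (x : Vec d) :
    Integrable (sgrad f x) P := by
  refine Integrable.of_bound (h.measurable_sgrad x).aestronglyMeasurable
    (‖gradient (objective P f) x‖ + σ) (Eventually.of_forall fun ξ => ?_)
  have := norm_add_le (gradient (objective P f) x) (sgrad f x ξ - gradient (objective P f) x)
  rw [add_sub_cancel] at this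
  linarith [h.norm_sgrad_sub_le hσ x ξ]

theorem hasGradientAt_objective (h : Assumptions P f x₁ L ρ σ Δ) (hσ : 0 ≤ σ) (hL : 0 ≤ L)
    (x : Vec d) : HasGradientAt (objective P f) (∫ ξ, sgrad f x ξ ∂P) x := by
  have key := hasFDerivAt_integral_of_dominated_of_fderiv_le (𝕜 := ℝ) (μ := P) (F := f)
    (F' := fun y ξ => InnerProductSpace.toDual ℝ (Vec d) (sgrad f y ξ)) (x₀ := x)
    (s := Metric.ball x 1) (bound := fun _ => ‖gradient (objective P f) x‖ + σ + L)
    (Metric.ball_mem_nhds x one_pos)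
    (Eventually.of_forall fun y => (h.measurable y).aestronglyMeasurable)
    (h.integrable x)
    ((InnerProductSpace.toDual ℝ (Vec d)).continuous.comp_aestronglyMeasurable
      (h.measurable_sgrad x).aestronglyMeasurable)
    (Eventually.of_forall fun ξ y hy => ?_) (integrable_const _)
    (Eventually.of_forall fun ξ y _ => (h.hasGradientAt_sample y ξ).hasFDerivAt)
  · rw [hasGradientAt_iff_hasFDerivAt]
    have e : InnerProductSpace.toDual ℝ (Vec d) (∫ ξ, sgrad f x ξ ∂P)
        = ∫ ξ, InnerProductSpace.toDual ℝ (Vec d) (sgrad f x ξ) ∂P :=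
      ((InnerProductSpace.toDual ℝ (Vec d)).toContinuousLinearEquiv.integral_comp_comm
        (sgrad f x)).symm
    rw [e]
    exact key
  · rw [LinearIsometryEquiv.norm_map]
    have h1 := norm_add_le (gradient (objective P f) x) (sgrad f x ξ - gradient (objective P f) x)
    rw [add_sub_cancel] at h1
    have h2 := norm_add_le (sgrad f x ξ) (sgrad f y ξ - sgrad f x ξ)
    rw [add_sub_cancel] at h2
    have h3 := h.smooth ξ y x
    have h4 : ‖y - x‖ ≤ 1 := by rw [← dist_eq_norm]; exact (Metric.mem_ball.mp hy).le
    nlinarith [h.norm_sgrad_sub_le hσ x ξ]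

theorem gradient_objective (h : Assumptions P f x₁ L ρ σ Δ) (hσ : 0 ≤ σ) (hL : 0 ≤ L)
    (x : Vec d) : gradient (objective P f) x = ∫ ξ, sgrad f x ξ ∂P :=
  (h.hasGradientAt_objective hσ hL x).gradient

theorem hasGradientAt (h : Assumptions P f x₁ L ρ σ Δ) (hσ : 0 ≤ σ) (hL : 0 ≤ L)
    (x : Vec d) : HasGradientAt (objective P f) (gradient (objective P f) x) x := by
  rw [h.gradient_objective hσ hL]; exact h.hasGradientAt_objective hσ hL x

theorem norm_gradient_sub_le (h : Assumptions P f x₁ L ρ σ Δ) (hσ : 0 ≤ σ) (hL : 0 ≤ L)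
    (x y : Vec d) :
    ‖gradient (objective P f) x - gradient (objective P f) y‖ ≤ L * ‖x - y‖ := by
  rw [h.gradient_objective hσ hL, h.gradient_objective hσ hL,
    ← integral_sub (h.integrable_sgrad hσ x) (h.integrable_sgrad hσ y)]
  refine (norm_integral_le_of_norm_le_const (Eventually.of_forall fun ξ => h.smooth ξ x y)).trans ?_
  simp

theorem hasFDerivAt_gradient (h : Assumptions P f x₁ L ρ σ Δ) (hσ : 0 ≤ σ) (hL : 0 ≤ L)
    (x : Vec d) :
    HasFDerivAt (gradient (objective P f)) (∫ ξ, hess (fun z => f z ξ) x ∂P) x := by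
  have hfun : gradient (objective P f) = fun y => ∫ ξ, sgrad f y ξ ∂P :=
    funext fun y => h.gradient_objective hσ hL y
  rw [hfun]
  exact hasFDerivAt_integral_of_dominated_of_fderiv_le (𝕜 := ℝ) (μ := P) (F := sgrad f)
    (F' := fun y ξ => hess (fun z => f z ξ) y) (x₀ := x)
    (s := Metric.ball x 1) (bound := fun _ => L)
    (Metric.ball_mem_nhds x one_pos)
    (Eventually.of_forall fun y => (h.measurable_sgrad y).aestronglyMeasurable)
    (h.integrable_sgrad hσ x)
    (h.stronglyMeasurable_hess x).aestronglyMeasurable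
    (Eventually.of_forall fun ξ y _ => norm_hess_le hL (h.smooth ξ) y) (integrable_const _)
    (Eventually.of_forall fun ξ y _ => h.hasFDerivAt_sgrad y ξ)

theorem hess_objective (h : Assumptions P f x₁ L ρ σ Δ) (hσ : 0 ≤ σ) (hL : 0 ≤ L)
    (x : Vec d) : hess (objective P f) x = ∫ ξ, hess (fun z => f z ξ) x ∂P :=
  (h.hasFDerivAt_gradient hσ hL x).fderiv

theorem norm_hess_objective_sub_le (h : Assumptions P f x₁ L ρ σ Δ) (hσ : 0 ≤ σ) (hL : 0 ≤ L)
    (x y : Vec d) :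
    ‖hess (objective P f) x - hess (objective P f) y‖ ≤ ρ * ‖x - y‖ := by
  have hi : ∀ z, Integrable (fun ξ => hess (fun z => f z ξ) z) P := fun z =>
    Integrable.of_bound (h.stronglyMeasurable_hess z).aestronglyMeasurable L
      (Eventually.of_forall fun ξ => norm_hess_le hL (h.smooth ξ) z)
  rw [h.hess_objective hσ hL, h.hess_objective hσ hL, ← integral_sub (hi x) (hi y)]
  refine (norm_integral_le_of_norm_le_const
    (Eventually.of_forall fun ξ => h.hessLipschitz ξ x y)).trans ?_
  simp

theorem hess_objective_isSymmetric (h : Assumptions P f x₁ L ρ σ Δ) (hσ : 0 ≤ σ) (hL : 0 ≤ L)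
    (x : Vec d) : (hess (objective P f) x : Vec d →ₗ[ℝ] Vec d).IsSymmetric := by
  intro v w
  have h1 : ∀ y, HasFDerivAt (objective P f)
      (InnerProductSpace.toDual ℝ (Vec d) (gradient (objective P f) y)) y :=
    fun y => (h.hasGradientAt hσ hL y).hasFDerivAt
  have h2 : HasFDerivAt (fun y => InnerProductSpace.toDual ℝ (Vec d) (gradient (objective P f) y))
      ((InnerProductSpace.toDual ℝ (Vec d)).toContinuousLinearEquiv.toContinuousLinearMap.comp
        (hess (objective P f) x)) x := by
    have := h.hasFDerivAt_gradient hσ hL x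
    rw [← h.hess_objective hσ hL] at this
    exact ((InnerProductSpace.toDual ℝ (Vec d)).toContinuousLinearEquiv.hasFDerivAt).comp x this
  have := second_derivative_symmetric h1 h2 v w
  simp only [ContinuousLinearMap.comp_apply] at this
  rw [real_inner_comm]
  simpa [real_inner_comm] using this

end Assumptions

end Objective

/-! ### Taylor bounds -/

theorem le_of_lipschitz_gradient {d : ℕ} {F : Vec d → ℝ} {L : ℝ}
    (hF : ∀ x, HasGradientAt F (gradient F x) x)
    (hL : ∀ x y, ‖gradient F x - gradient F y‖ ≤ L * ‖x - y‖) (x v : Vec d) :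
    F (x + v) ≤ F x + ⟪gradient F x, v⟫ + L / 2 * ‖v‖ ^ 2 := by
  let G : ℝ → ℝ := fun t => F (x + t • v) - t * ⟪gradient F x, v⟫ - L / 2 * t ^ 2 * ‖v‖ ^ 2
  have hG : ∀ t, HasDerivAt G
      (⟪gradient F (x + t • v), v⟫ - ⟪gradient F x, v⟫ - L * t * ‖v‖ ^ 2) t := by
    intro t
    have h1 : HasDerivAt (fun t : ℝ => x + t • v) v t := by
      simpa using ((hasDerivAt_id t).smul_const v).const_add x
    have h2 := (hF (x + t • v)).hasFDerivAt.comp_hasDerivAt t h1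
    rw [InnerProductSpace.toDual_apply_apply] at h2
    have h3 := ((hasDerivAt_id t).mul_const ⟪gradient F x, v⟫)
    have h4 := (((hasDerivAt_id t).pow 2).const_mul (L / 2)).mul_const (‖v‖ ^ 2)
    refine ((h2.sub h3).sub h4).congr_deriv ?_
    simp
    left
    ring
  have hanti : AntitoneOn G (Set.Icc 0 1) := by
    refine antitoneOn_of_deriv_nonpos (convex_Icc 0 1)
      (fun t _ => (hG t).continuousAt.continuousWithinAt)
      (fun t _ => (hG t).differentiableAt.differentiableWithinAt) fun t ht => ?_
    rw [interior_Icc] at ht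
    rw [(hG t).deriv, ← inner_sub_left]
    have h5 := real_inner_le_norm (gradient F (x + t • v) - gradient F x) v
    have h6 := hL (x + t • v) x
    rw [add_sub_cancel_left, norm_smul, Real.norm_of_nonneg ht.1.le] at h6
    nlinarith [mul_le_mul_of_nonneg_right h6 (norm_nonneg v)]
  have := hanti (Set.left_mem_Icc.mpr zero_le_one) (Set.right_mem_Icc.mpr zero_le_one) zero_le_one
  simp only [G, one_smul, zero_smul, add_zero, one_mul, one_pow, zero_mul, mul_one, sub_zero] at this
  nlinarith

/-- The error of the linearization at `c` of a gradient map, on two points of a ball about `c`. -/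
theorem norm_sub_sub_hess_le {d : ℕ} {G : Vec d → Vec d} {H : Vec d → Vec d →L[ℝ] Vec d} {ρ R : ℝ}
    (hρ : 0 ≤ ρ)
    (hG : ∀ x, HasFDerivAt G (H x) x) (hH : ∀ x y, ‖H x - H y‖ ≤ ρ * ‖x - y‖)
    (c x y : Vec d) (hx : ‖x - c‖ ≤ R) (hy : ‖y - c‖ ≤ R) :
    ‖G y - G x - H c (y - x)‖ ≤ ρ * R * ‖y - x‖ := by
  refine Convex.norm_image_sub_le_of_norm_hasFDerivWithin_le' (𝕜 := ℝ) (s := Metric.closedBall c R)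
    (fun z _ => (hG z).hasFDerivWithinAt) (fun z hz => ?_) (convex_closedBall c R)
    (mem_closedBall_iff_norm.mpr hx) (mem_closedBall_iff_norm.mpr hy)
  exact (hH z c).trans (mul_le_mul_of_nonneg_left (mem_closedBall_iff_norm.mp hz) hρ)

/-! ### Negative curvature -/

/-- The Hessian of `F` at `x` has a direction of curvature below `-κ`.  For a symmetric Hessian
this is `lambdaMin < -κ`; in this form the set of such points is visibly open. -/
def NegCurv {d : ℕ} (F : Vec d → ℝ) (κ : ℝ) (x : Vec d) : Prop :=
  ∃ v, ⟪hess F x v, v⟫ < -κ * ‖v‖ ^ 2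

theorem neg_le_lambdaMin {d : ℕ} {F : Vec d → ℝ} {κ : ℝ} (hκ : 0 ≤ κ) {x : Vec d}
    (h : ¬ NegCurv F κ x) : -κ ≤ lambdaMin (hess F x) := by
  unfold lambdaMin
  -- Without eigenvalues the infimum is the junk value `0`, for which the claim holds as well.
  rcases Set.eq_empty_or_nonempty
    {c : ℝ | Module.End.HasEigenvalue (hess F x : Vec d →ₗ[ℝ] Vec d) c} with he | hne
  · rw [he, Real.sInf_empty]; linarith
  · refine le_csInf hne fun c hc => ?_
    obtain ⟨v, hv⟩ := Module.End.HasEigenvalue.exists_hasEigenvector hc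
    have h1 : hess F x v = c • v := hv.apply_eq_smul
    have h2 : 0 < ‖v‖ ^ 2 := by have := norm_pos_iff.mpr hv.2; positivity
    have h3 := not_lt.mp fun hlt => h ⟨v, hlt⟩
    rw [h1, inner_smul_left, real_inner_self_eq_norm_sq] at h3
    simp only [conj_trivial] at h3
    exact le_of_mul_le_mul_right h3 h2

theorem isOpen_negCurv {d : ℕ} {F : Vec d → ℝ} (κ : ℝ) (hF : Continuous (hess F)) :
    IsOpen {x | NegCurv F κ x} := by
  have : {x | NegCurv F κ x} = ⋃ v, {x | ⟪hess F x v, v⟫ < -κ * ‖v‖ ^ 2} := by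
    ext x; simp [NegCurv]
  rw [this]
  refine isOpen_iUnion fun v => isOpen_lt ?_ continuous_const
  exact (hF.clm_apply continuous_const).inner continuous_const

/-- The direction of least curvature: a unit eigenvector for the least value `-γ` of the Rayleigh
quotient. -/
theorem NegCurv.exists_eigenvector {d : ℕ} {F : Vec d → ℝ} {κ : ℝ} {x : Vec d}
    (hs : (hess F x : Vec d →ₗ[ℝ] Vec d).IsSymmetric) (h : NegCurv F κ x) :
    ∃ (γ : ℝ) (e : Vec d), κ < γ ∧ ‖e‖ = 1 ∧ hess F x e = -γ • e ∧
      ∀ v, -γ * ‖v‖ ^ 2 ≤ ⟪hess F x v, v⟫ := by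
  obtain ⟨v₀, hv₀⟩ := h
  have hv₀0 : v₀ ≠ 0 := by rintro rfl; simp at hv₀
  have : Nontrivial (Vec d) := ⟨⟨v₀, 0, hv₀0⟩⟩
  set R : {v : Vec d // v ≠ 0} → ℝ := fun v => ⟪hess F x v, (v : Vec d)⟫ / ‖(v : Vec d)‖ ^ 2
    with hR
  have heig := hs.hasEigenvalue_iInf_of_finiteDimensional
  have hbdd : BddBelow (Set.range R) := by
    refine ⟨-‖hess F x‖, ?_⟩
    rintro _ ⟨⟨v, hv⟩, rfl⟩
    have h2 : 0 < ‖v‖ ^ 2 := by have := norm_pos_iff.mpr hv; positivity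
    simp only [hR]
    rw [le_div_iff₀ h2]
    have h3 := (abs_le.mp (abs_real_inner_le_norm (hess F x v) v)).1
    nlinarith [(hess F x).le_opNorm v, norm_nonneg v]
  have hmin : ∀ v, (⨅ v, R v) * ‖v‖ ^ 2 ≤ ⟪hess F x v, v⟫ := by
    intro v
    by_cases hv : v = 0
    · simp [hv]
    · have h2 : 0 < ‖v‖ ^ 2 := by have := norm_pos_iff.mpr hv; positivity
      have := ciInf_le hbdd ⟨v, hv⟩
      rwa [← le_div_iff₀ h2]
  obtain ⟨e, he⟩ := Module.End.HasEigenvalue.exists_hasEigenvector heig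
  have he0 : 0 < ‖e‖ := norm_pos_iff.mpr he.2
  have heq : hess F x e = (⨅ v, R v) • e := he.apply_eq_smul
  refine ⟨-(⨅ v, R v), ‖e‖⁻¹ • e, ?_, ?_, ?_, ?_⟩
  · have h2 : 0 < ‖v₀‖ ^ 2 := by have := norm_pos_iff.mpr hv₀0; positivity
    have := (hmin v₀).trans_lt hv₀
    have := lt_of_mul_lt_mul_right this h2.le
    linarith
  · rw [norm_smul, norm_inv, norm_norm, inv_mul_cancel₀ he0.ne']
  · rw [map_smul, heq, neg_neg, smul_comm]
  · intro v; rw [neg_neg]; exact hmin v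

/-! ### Structure of a run -/

section Run

variable {d : ℕ} {Ξ : Type*} (f : Vec d → Ξ → ℝ) (a : Params)

section Step

variable {f a} {s : State d} (ω : Draw d Ξ)

theorem step_halted (h : s.phase = .halted) : step f a s ω = s := by
  simp [step, h]

theorem step_descent (h : s.phase = .descent) (hg : a.θ < ‖s.g‖) :
    step f a s ω = s.moveTo f a (s.x - (a.η / ‖s.g‖) • s.g) ω := by
  simp [step, h, hg]

theorem step_perturb (h : s.phase = .descent) (hg : ¬ a.θ < ‖s.g‖) :
    step f a s ω = { s.moveTo f a (s.x + a.r • ω.2) ω with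
          phase := .escape
          m := s.t
          anchor := s.x
          k := 0
          D := 0 } := by
  simp [step, h, hg]

theorem step_stop (h : s.phase = .escape) (hk : a.T ≤ s.k) :
    step f a s ω = { s with phase := .halted } := by
  simp [step, h, hk]

theorem step_break (h : s.phase = .escape) (hk : ¬ a.T ≤ s.k)
    (hD : (s.t - s.m + 1 : ℝ) * a.Dbar < s.D + a.ηH ^ 2 * ‖s.g‖ ^ 2) :
    step f a s ω = { s.moveTo f a
            (s.x - (Real.sqrt ((s.t - s.m + 1 : ℝ) * a.Dbar - s.D) / ‖s.g‖) • s.g) ω with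
          phase := .descent
          D := (s.t - s.m + 1 : ℝ) * a.Dbar } := by
  simp [step, h, hk, hD]

theorem step_escape (h : s.phase = .escape) (hk : ¬ a.T ≤ s.k)
    (hD : ¬ (s.t - s.m + 1 : ℝ) * a.Dbar < s.D + a.ηH ^ 2 * ‖s.g‖ ^ 2) :
    step f a s ω = { s.moveTo f a (s.x - a.ηH • s.g) ω with
          k := s.k + 1
          D := s.D + a.ηH ^ 2 * ‖s.g‖ ^ 2 } := by
  simp [step, h, hk, hD]

end Step

/-- The iterates and gradient estimates of an escape phase that starts from the configuration `s`
with the perturbed point `p`, when its test for the squared movement is left out. -/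
def path (s : State d) (p : Vec d) (ω : ℕ → Draw d Ξ) : ℕ → Vec d × Vec d
  | 0 => (p, spider f a s.t s.g s.x p (ω 0).1)
  | k + 1 =>
      ((path s p ω k).1 - a.ηH • (path s p ω k).2,
        spider f a (s.t + 1 + k) (path s p ω k).2 (path s p ω k).1
          ((path s p ω k).1 - a.ηH • (path s p ω k).2) (ω (k + 1)).1)

/-- The squared movement of the first `k` steps of `path`. -/
def movement (s : State d) (p : Vec d) (ω : ℕ → Draw d Ξ) (k : ℕ) : ℝ :=
  ∑ i ∈ Finset.range k, a.ηH ^ 2 * ‖(path f a s p ω i).2‖ ^ 2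

/-- The path passes all movement tests, so that the escape phase is never broken. -/
def Stuck (s : State d) (p : Vec d) (ω : ℕ → Draw d Ξ) : Prop :=
  ∀ k ≤ a.T, movement f a s p ω k ≤ (k + 1) * a.Dbar

variable {f a} {x₁ : Vec d}

/-- How a configuration `s` of an escape phase, reached at time `n`, came about: the phase began at
time `n₀`. -/
structure EscapeHistory (f : Vec d → Ξ → ℝ) (a : Params) (x₁ : Vec d) (ω : ℕ → Draw d Ξ)
    (s : State d) (n₀ : ℕ) : Prop where
  phase_start : (run f a x₁ ω n₀).phase = .descent
  start_small : ‖(run f a x₁ ω n₀).g‖ ≤ a.θ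
  t_start : (run f a x₁ ω n₀).t = n₀ + 1
  anchor_eq : s.anchor = (run f a x₁ ω n₀).x
  m_eq : s.m = n₀ + 1
  t_eq : s.t = n₀ + 1 + s.k + 1
  le_T : s.k ≤ a.T
  x_eq : s.x = (path f a (run f a x₁ ω n₀) ((run f a x₁ ω n₀).x + a.r • (ω (n₀ + 1)).2)
    (fun i => ω (n₀ + 1 + i)) s.k).1
  g_eq : s.g = (path f a (run f a x₁ ω n₀) ((run f a x₁ ω n₀).x + a.r • (ω (n₀ + 1)).2)
    (fun i => ω (n₀ + 1 + i)) s.k).2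
  D_eq : s.D = movement f a (run f a x₁ ω n₀)
    ((run f a x₁ ω n₀).x + a.r • (ω (n₀ + 1)).2) (fun i => ω (n₀ + 1 + i)) s.k
  small : ∀ j ≤ s.k, movement f a (run f a x₁ ω n₀)
    ((run f a x₁ ω n₀).x + a.r • (ω (n₀ + 1)).2) (fun i => ω (n₀ + 1 + i)) j ≤ (j + 1) * a.Dbar

/-- The shape of the configuration at time `n`. -/
inductive RunShape (f : Vec d → Ξ → ℝ) (a : Params) (x₁ : Vec d) (ω : ℕ → Draw d Ξ)
    (n : ℕ) : Prop
  | descent (hp : (run f a x₁ ω n).phase = .descent) (ht : (run f a x₁ ω n).t = n + 1)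
  | escape (n₀ : ℕ) (hp : (run f a x₁ ω n).phase = .escape)
      (hn : n = n₀ + 1 + (run f a x₁ ω n).k)
      (h : EscapeHistory f a x₁ ω (run f a x₁ ω n) n₀)
  | halted (n₀ : ℕ) (hp : (run f a x₁ ω n).phase = .halted)
      (hn : n₀ + 1 + a.T < n) (hk : (run f a x₁ ω n).k = a.T)
      (h : EscapeHistory f a x₁ ω (run f a x₁ ω n) n₀)

theorem runShape (hD : 0 ≤ a.Dbar) (ω : ℕ → Draw d Ξ) (n : ℕ) : RunShape f a x₁ ω n := by
  induction n with
  | zero => exact .descent rfl rfl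
  | succ n ih =>
    have hrun : run f a x₁ ω (n + 1) = step f a (run f a x₁ ω n) (ω (n + 1)) := rfl
    cases ih with
    | descent hp ht =>
      by_cases hg : a.θ < ‖(run f a x₁ ω n).g‖
      · rw [step_descent _ hp hg] at hrun
        refine .descent ?_ ?_
        · rw [hrun]; exact hp
        · rw [hrun]; simp [State.moveTo, ht]
      · rw [step_perturb _ hp hg] at hrun
        refine .escape n ?_ ?_ ⟨hp, not_lt.mp hg, ht, ?_, ?_, ?_, ?_, ?_, ?_, ?_, ?_⟩ <;> rw [hrun]
        · simp
        · exact ht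
        · simp [State.moveTo, ht]
        · simp
        · simp [State.moveTo, path]
        · simp [State.moveTo, path]
        · simp [movement]
        · intro j hj
          obtain rfl : j = 0 := by simpa using hj
          simpa [movement] using hD
    | escape n₀ hp hn h =>
      have hts : ((run f a x₁ ω n).t - (run f a x₁ ω n).m + 1 : ℝ)
          = ((run f a x₁ ω n).k + 1 : ℕ) + 1 := by
        rw [h.t_eq, h.m_eq]; push_cast; ring
      by_cases hk : a.T ≤ (run f a x₁ ω n).k
      · rw [step_stop _ hp hk] at hrun
        have hkT := le_antisymm h.le_T hk
        refine .halted n₀ (by rw [hrun]) (by omega) (by rw [hrun]; exact hkT) ?_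
        rw [hrun]
        exact ⟨h.1, h.2, h.3, h.4, h.5, h.6, h.7, h.8, h.9, h.10, h.11⟩
      · by_cases hb : ((run f a x₁ ω n).t - (run f a x₁ ω n).m + 1 : ℝ) * a.Dbar
            < (run f a x₁ ω n).D + a.ηH ^ 2 * ‖(run f a x₁ ω n).g‖ ^ 2
        · rw [step_break _ hp hk hb] at hrun
          refine .descent (by rw [hrun]) ?_
          rw [hrun]
          have := h.t_eq
          simp only [State.moveTo]
          omega
        · rw [step_escape _ hp hk hb] at hrun
          have hm : movement f a (run f a x₁ ω n₀)
              ((run f a x₁ ω n₀).x + a.r • (ω (n₀ + 1)).2) (fun i => ω (n₀ + 1 + i))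
              ((run f a x₁ ω n).k + 1) = (run f a x₁ ω n).D
                + a.ηH ^ 2 * ‖(run f a x₁ ω n).g‖ ^ 2 := by
            rw [h.D_eq, h.g_eq, movement, Finset.sum_range_succ]; rfl
          have ht1 : (run f a x₁ ω n).t = (run f a x₁ ω n₀).t + 1 + (run f a x₁ ω n).k := by
            rw [h.t_eq, h.t_start]; omega
          refine .escape n₀ ?_ ?_ ⟨h.1, h.2, h.3, ?_, ?_, ?_, ?_, ?_, ?_, ?_, ?_⟩ <;> rw [hrun]
          · exact hp
          · dsimp only; omega
          · exact h.4
          · exact h.5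
          · simp only [State.moveTo, h.t_eq]; omega
          · dsimp only; omega
          · simp only [State.moveTo, path]; rw [← h.x_eq, ← h.g_eq]
          · simp only [State.moveTo, path]
            rw [← h.x_eq, ← h.g_eq, ← ht1]
            congr 3
            omega
          · exact hm.symm
          · intro j hj
            rcases Nat.lt_or_ge j ((run f a x₁ ω n).k + 1) with hj' | hj'
            · exact h.small j (by omega)
            · obtain rfl : j = (run f a x₁ ω n).k + 1 := le_antisymm hj hj'
              rw [hm, ← hts]
              exact not_lt.mp hb
    | halted n₀ hp hn hk h =>
      rw [step_halted _ hp] at hrun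
      refine .halted n₀ (by rw [hrun]; exact hp) (by omega) (by rw [hrun]; exact hk) ?_
      rw [hrun]
      exact h

theorem run_t (hD : 0 ≤ a.Dbar) {ω : ℕ → Draw d Ξ} {n : ℕ}
    (h : (run f a x₁ ω n).phase ≠ .halted) : (run f a x₁ ω n).t = n + 1 := by
  cases runShape (f := f) (x₁ := x₁) hD ω n with
  | descent hp ht => exact ht
  | escape n₀ hp hn h' => rw [h'.t_eq]; omega
  | halted n₀ hp => exact absurd hp h

/-- Every `b` steps cost `b ^ 2` gradients at a restart and less than `b * 2 * b` between. -/
theorem run_cost_le (hD : 0 ≤ a.Dbar) (hb : 0 < a.b) (hq : a.q = a.b) (hB : a.B = a.b ^ 2)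
    (ω : ℕ → Draw d Ξ) (n : ℕ) :
    (run f a x₁ ω n).cost ≤ 3 * a.b * n + a.b ^ 2 := by
  -- The term `b * (n % b)` saves up, at `b` per step, for the next restart.
  have key : ((run f a x₁ ω n).phase ≠ .halted →
      (run f a x₁ ω n).cost + a.b * (n % a.b) ≤ 3 * a.b * n + a.b ^ 2) ∧
      (run f a x₁ ω n).cost ≤ 3 * a.b * n + a.b ^ 2 := by
    induction n with
    | zero => simp [run, init, spiderCost, hB]
    | succ n ih =>
      have hrun : run f a x₁ ω (n + 1) = step f a (run f a x₁ ω n) (ω (n + 1)) := rfl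
      have hmove : (run f a x₁ ω n).phase ≠ .halted →
          (run f a x₁ ω n).cost + spiderCost a (run f a x₁ ω n).t + a.b * ((n + 1) % a.b)
            ≤ 3 * a.b * (n + 1) + a.b ^ 2 := by
        intro h
        have h1 := ih.1 h
        rw [run_t hD h, spiderCost, hq, hB]
        have hlt := Nat.mod_lt n hb
        split_ifs with h0
        · rw [h0]
          have h2 : n % a.b + 1 = a.b := by
            rcases Nat.lt_or_ge (n % a.b + 1) a.b with h3 | h3
            · have := Nat.add_mod n 1 a.b
              rw [Nat.mod_eq_of_lt (by omega : 1 < a.b), Nat.mod_eq_of_lt h3] at this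
              omega
            · omega
          nlinarith
        · have h2 : (n + 1) % a.b ≤ n % a.b + 1 := by
            rw [Nat.add_mod]
            refine (Nat.mod_le _ _).trans ?_
            have := Nat.mod_le 1 a.b
            omega
          nlinarith
      have hfin : ∀ c : ℕ, (c = (run f a x₁ ω n).cost + spiderCost a (run f a x₁ ω n).t) →
          (run f a x₁ ω n).phase ≠ .halted →
          (c + a.b * ((n + 1) % a.b) ≤ 3 * a.b * (n + 1) + a.b ^ 2) ∧
          c ≤ 3 * a.b * (n + 1) + a.b ^ 2 := by
        rintro c rfl h
        have := hmove h
        exact ⟨this, by omega⟩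
      have hold : (run f a x₁ ω n).cost ≤ 3 * a.b * (n + 1) + a.b ^ 2 := by
        have := ih.2; nlinarith
      rcases hp : (run f a x₁ ω n).phase with _ | _ | _
      · have hne : (run f a x₁ ω n).phase ≠ .halted := by rw [hp]; simp
        by_cases hg : a.θ < ‖(run f a x₁ ω n).g‖
        · rw [step_descent _ hp hg] at hrun
          rw [hrun]
          exact ⟨fun _ => (hfin _ rfl hne).1, (hfin _ rfl hne).2⟩
        · rw [step_perturb _ hp hg] at hrun
          rw [hrun]
          exact ⟨fun _ => (hfin _ rfl hne).1, (hfin _ rfl hne).2⟩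
      · have hne : (run f a x₁ ω n).phase ≠ .halted := by rw [hp]; simp
        by_cases hk : a.T ≤ (run f a x₁ ω n).k
        · rw [step_stop _ hp hk] at hrun
          rw [hrun]
          exact ⟨fun h => absurd rfl h, hold⟩
        · by_cases hb : ((run f a x₁ ω n).t - (run f a x₁ ω n).m + 1 : ℝ) * a.Dbar
            < (run f a x₁ ω n).D + a.ηH ^ 2 * ‖(run f a x₁ ω n).g‖ ^ 2
          · rw [step_break _ hp hk hb] at hrun
            rw [hrun]
            exact ⟨fun _ => (hfin _ rfl hne).1, (hfin _ rfl hne).2⟩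
          · rw [step_escape _ hp hk hb] at hrun
            rw [hrun]
            exact ⟨fun _ => (hfin _ rfl hne).1, (hfin _ rfl hne).2⟩
      · rw [step_halted _ hp] at hrun
        rw [hrun]
        exact ⟨fun h => absurd hp h, hold⟩
  exact key.2

end Run

/-! ### Decrease of the objective along a run with accurate estimates -/

section Decrease

variable {d : ℕ} {F : Vec d → ℝ} {L : ℝ}

/-- A step along the estimate `g`, for a step size `τ ≤ 1 / (2 L)`. -/
theorem decrease_of_step (hF : ∀ x, HasGradientAt F (gradient F x) x)
    (hL : ∀ x y, ‖gradient F x - gradient F y‖ ≤ L * ‖x - y‖) {x g : Vec d} {τ E : ℝ}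
    (hτ : 0 ≤ τ) (hLτ : L * τ ≤ 1 / 2) (hE : ‖g - gradient F x‖ ≤ E) :
    F (x - τ • g) ≤ F x - τ / 4 * ‖g‖ ^ 2 + τ * E ^ 2 := by
  have h1 := le_of_lipschitz_gradient hF hL x (-(τ • g))
  rw [← sub_eq_add_neg, norm_neg, norm_smul, Real.norm_of_nonneg hτ, inner_neg_right,
    inner_smul_right] at h1
  have h2 : ⟪gradient F x, g⟫ = ‖g‖ ^ 2 - ⟪g - gradient F x, g⟫ := by
    rw [inner_sub_left, real_inner_self_eq_norm_sq]; ring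
  have h3 := real_inner_le_norm (g - gradient F x) g
  have h4 : ⟪g - gradient F x, g⟫ ≤ E * ‖g‖ :=
    h3.trans (mul_le_mul_of_nonneg_right hE (norm_nonneg _))
  rw [h2] at h1
  have h5 : E * ‖g‖ ≤ E ^ 2 / 2 + ‖g‖ ^ 2 / 2 := by nlinarith [sq_nonneg (E - ‖g‖)]
  have h6 : τ * ⟪g - gradient F x, g⟫ ≤ τ * (E ^ 2 / 2 + ‖g‖ ^ 2 / 2) :=
    mul_le_mul_of_nonneg_left (h4.trans h5) hτ
  have h7 : L / 2 * (τ * ‖g‖) ^ 2 ≤ τ * ‖g‖ ^ 2 / 4 := by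
    have : 0 ≤ τ * ‖g‖ ^ 2 := by positivity
    nlinarith
  have h8 : 0 ≤ τ * E ^ 2 := by positivity
  nlinarith

/-- A normalized step of length `τ`. -/
theorem decrease_of_normalized_step (hF : ∀ x, HasGradientAt F (gradient F x) x)
    (hL : ∀ x y, ‖gradient F x - gradient F y‖ ≤ L * ‖x - y‖) {x g : Vec d} {τ E : ℝ}
    (hτ : 0 ≤ τ) (hg : 0 < ‖g‖) (hE : ‖g - gradient F x‖ ≤ E) :
    F (x - (τ / ‖g‖) • g) ≤ F x - τ * (‖g‖ - E - L / 2 * τ) := by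
  have h1 := le_of_lipschitz_gradient hF hL x (-((τ / ‖g‖) • g))
  have h0 : 0 ≤ τ / ‖g‖ := by positivity
  rw [← sub_eq_add_neg, norm_neg, norm_smul, Real.norm_of_nonneg h0, inner_neg_right,
    inner_smul_right, div_mul_cancel₀ _ hg.ne'] at h1
  have h2 : ⟪gradient F x, g⟫ = ‖g‖ ^ 2 - ⟪g - gradient F x, g⟫ := by
    rw [inner_sub_left, real_inner_self_eq_norm_sq]; ring
  have h3 := real_inner_le_norm (g - gradient F x) g
  have h4 : ⟪g - gradient F x, g⟫ ≤ E * ‖g‖ :=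
    h3.trans (mul_le_mul_of_nonneg_right hE (norm_nonneg _))
  have h5 : τ / ‖g‖ * (‖g‖ ^ 2 - E * ‖g‖) ≤ τ / ‖g‖ * ⟪gradient F x, g⟫ := by
    rw [h2]; exact mul_le_mul_of_nonneg_left (by linarith) h0
  have h6 : τ / ‖g‖ * (‖g‖ ^ 2 - E * ‖g‖) = τ * (‖g‖ - E) := by field_simp
  rw [h6] at h5
  nlinarith

variable {Ξ : Type*} {f : Vec d → Ξ → ℝ} {a : Params} {x₁ : Vec d}

/-- The numerical conditions under which every iteration of a descent phase or of a broken escape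
phase decreases the objective by `α` on average, if the estimates are within `E` of the
gradients. -/
structure DecreaseConditions (a : Params) (L E α : ℝ) : Prop where
  Dbar_nonneg : 0 ≤ a.Dbar
  η_nonneg : 0 ≤ a.η
  ηH_pos : 0 < a.ηH
  r_nonneg : 0 ≤ a.r
  θ_nonneg : 0 ≤ a.θ
  step_le : L * a.ηH ≤ 1 / 2
  L_nonneg : 0 ≤ L
  descent : α ≤ a.η * (a.θ - E - L / 2 * a.η)
  perturb : (a.θ + E) * a.r + L / 2 * a.r ^ 2 ≤ a.Dbar / (12 * a.ηH)
  error : a.ηH * E ^ 2 ≤ a.Dbar / (12 * a.ηH)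
  rate : α ≤ a.Dbar / (12 * a.ηH)

/-- In a descent phase each of the first `n` iterations has paid for a decrease `α`.  In an escape
phase this holds up to its beginning; since then the perturbation may have cost
`Dbar / (12 * ηH)` and each of the `k` steps `ηH * E ^ 2`, while the squared movement `D` has gained
`D / (4 * ηH)`. -/
theorem run_decrease (hF : ∀ x, HasGradientAt F (gradient F x) x)
    (hL : ∀ x y, ‖gradient F x - gradient F y‖ ≤ L * ‖x - y‖) {E α : ℝ}
    (hc : DecreaseConditions a L E α) {ω : ℕ → Draw d Ξ} {N : ℕ} (hball : ∀ n, ‖(ω n).2‖ ≤ 1)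
    (hgood : ∀ n ≤ N, (run f a x₁ ω n).phase ≠ .halted →
      ‖(run f a x₁ ω n).g - gradient F (run f a x₁ ω n).x‖ ≤ E) (n : ℕ) (hn : n ≤ N) :
    ((run f a x₁ ω n).phase = .descent → F (run f a x₁ ω n).x ≤ F x₁ - α * n) ∧
    ((run f a x₁ ω n).phase = .escape → F (run f a x₁ ω n).x
      ≤ F x₁ - α * ((run f a x₁ ω n).m - 1) + a.Dbar / (12 * a.ηH)
        + (run f a x₁ ω n).k * (a.ηH * E ^ 2) - (run f a x₁ ω n).D / (4 * a.ηH)) := by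
  induction n with
  | zero => exact ⟨fun _ => by simp [run, init], fun h => by simp [run, init] at h⟩
  | succ n ih =>
    have hrun : run f a x₁ ω (n + 1) = step f a (run f a x₁ ω n) (ω (n + 1)) := rfl
    obtain ⟨ih1, ih2⟩ := ih (by omega)
    have hgn := hgood n (by omega)
    cases runShape (f := f) (x₁ := x₁) hc.Dbar_nonneg ω n with
    | descent hp ht =>
      have hE := hgn (by rw [hp]; simp)
      by_cases hg : a.θ < ‖(run f a x₁ ω n).g‖
      · rw [step_descent _ hp hg] at hrun
        rw [hrun]
        refine ⟨fun _ => ?_, fun h => by simp [State.moveTo, hp] at h⟩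
        have h1 := decrease_of_normalized_step hF hL hc.η_nonneg
          (hc.θ_nonneg.trans_lt hg) hE
        have h2 := hc.descent
        have h3 : a.η * (a.θ - E - L / 2 * a.η)
            ≤ a.η * (‖(run f a x₁ ω n).g‖ - E - L / 2 * a.η) :=
          mul_le_mul_of_nonneg_left (by linarith) hc.η_nonneg
        simp only [State.moveTo]
        push_cast
        linarith [ih1 hp]
      · rw [step_perturb _ hp hg] at hrun
        rw [hrun]
        refine ⟨fun h => by simp at h, fun _ => ?_⟩
        have h1 := le_of_lipschitz_gradient hF hL (run f a x₁ ω n).x (a.r • (ω (n + 1)).2)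
        have h2 : ‖a.r • (ω (n + 1)).2‖ ≤ a.r := by
          rw [norm_smul, Real.norm_of_nonneg hc.r_nonneg]
          exact mul_le_of_le_one_right hc.r_nonneg (hball _)
        have h3 : ‖gradient F (run f a x₁ ω n).x‖ ≤ a.θ + E := by
          have := norm_sub_le (run f a x₁ ω n).g
            ((run f a x₁ ω n).g - gradient F (run f a x₁ ω n).x)
          rw [sub_sub_cancel] at this
          linarith [not_lt.mp hg]
        have h4 := real_inner_le_norm (gradient F (run f a x₁ ω n).x) (a.r • (ω (n + 1)).2)
        have h5 : ‖gradient F (run f a x₁ ω n).x‖ * ‖a.r • (ω (n + 1)).2‖ ≤ (a.θ + E) * a.r :=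
          mul_le_mul h3 h2 (norm_nonneg _) ((norm_nonneg _).trans h3)
        have h6 : L / 2 * ‖a.r • (ω (n + 1)).2‖ ^ 2 ≤ L / 2 * a.r ^ 2 :=
          mul_le_mul_of_nonneg_left (pow_le_pow_left₀ (norm_nonneg _) h2 2)
            (by linarith [hc.L_nonneg])
        have h7 := hc.perturb
        have h8 := ih1 hp
        simp only [State.moveTo, ht]
        push_cast
        simp only [add_sub_cancel_right, zero_mul, zero_div]
        linarith
    | escape n₀ hp hn' h =>
      have hE := hgn (by rw [hp]; simp)
      have hts : ((run f a x₁ ω n).t - (run f a x₁ ω n).m : ℝ)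
          = (run f a x₁ ω n).k + 1 := by
        rw [h.t_eq, h.m_eq]; push_cast; ring
      have h2 := ih2 hp
      by_cases hk : a.T ≤ (run f a x₁ ω n).k
      · rw [step_stop _ hp hk] at hrun
        rw [hrun]
        exact ⟨fun h => by simp at h, fun h => by simp at h⟩
      · by_cases hb : ((run f a x₁ ω n).t - (run f a x₁ ω n).m + 1 : ℝ) * a.Dbar
            < (run f a x₁ ω n).D + a.ηH ^ 2 * ‖(run f a x₁ ω n).g‖ ^ 2
        · rw [step_break _ hp hk hb] at hrun
          rw [hrun]
          refine ⟨fun _ => ?_, fun h => by simp at h⟩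
          have hDle : (run f a x₁ ω n).D ≤ ((run f a x₁ ω n).k + 1) * a.Dbar := by
            rw [h.D_eq]; exact h.small _ le_rfl
          set s := run f a x₁ ω n with hs
          rw [hts] at hb ⊢
          have hrem : 0 ≤ (s.k + 1 + 1 : ℝ) * a.Dbar - s.D := by
            nlinarith [hc.Dbar_nonneg]
          have hg0 : 0 < ‖s.g‖ := by
            rcases (norm_nonneg s.g).eq_or_lt with h0 | h0
            · rw [← h0] at hb; linarith
            · exact h0
          set τ := Real.sqrt ((s.k + 1 + 1 : ℝ) * a.Dbar - s.D) / ‖s.g‖ with hτ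
          have hτ0 : 0 ≤ τ := by positivity
          have hτg : τ ^ 2 * ‖s.g‖ ^ 2 = (s.k + 1 + 1 : ℝ) * a.Dbar - s.D := by
            rw [hτ, div_pow, div_mul_cancel₀ _ (by positivity), Real.sq_sqrt hrem]
          have hτle : τ ≤ a.ηH := by
            have h3 : τ ^ 2 * ‖s.g‖ ^ 2 ≤ a.ηH ^ 2 * ‖s.g‖ ^ 2 := by rw [hτg]; linarith
            have h4 := le_of_mul_le_mul_right h3 (by positivity)
            exact (sq_le_sq₀ hτ0 hc.ηH_pos.le).mp h4
          have h3 := decrease_of_step hF hL hτ0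
            ((mul_le_mul_of_nonneg_left hτle hc.L_nonneg).trans hc.step_le) hE
          have h4 : ((s.k + 1 + 1 : ℝ) * a.Dbar - s.D) / (4 * a.ηH) ≤ τ / 4 * ‖s.g‖ ^ 2 := by
            rw [← hτg, div_le_iff₀ (by linarith [hc.ηH_pos])]
            have : 0 ≤ τ * ‖s.g‖ ^ 2 := by positivity
            nlinarith
          have h5 : τ * E ^ 2 ≤ a.ηH * E ^ 2 := mul_le_mul_of_nonneg_right hτle (sq_nonneg E)
          have h6 := hc.error
          have h7 := hc.rate
          -- After the break the movement is `(k + 2) * Dbar`.  Of its gain, which is three times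
          -- `(k + 2) * Dbar / (12 * ηH)`, one third covers the perturbation and the errors, one
          -- third covers `α` for each iteration of the phase.
          have h8 : ((s.k + 1 + 1 : ℝ) * a.Dbar - s.D) / (4 * a.ηH)
              = 3 * (s.k + 2) * (a.Dbar / (12 * a.ηH)) - s.D / (4 * a.ηH) := by
            have := hc.ηH_pos.ne'
            field_simp
            ring
          have h9 : (s.m : ℝ) = n - s.k := by
            have : s.m + s.k = n := by rw [h.m_eq]; omega
            rw [← this]; push_cast; ring
          rw [h8] at h4
          have hk0 : (0 : ℝ) ≤ s.k := Nat.cast_nonneg _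
          have h10 : (s.k + 1) * (a.ηH * E ^ 2) ≤ (s.k + 1) * (a.Dbar / (12 * a.ηH)) :=
            mul_le_mul_of_nonneg_left h6 (by linarith)
          have h11 : (s.k + 2) * α ≤ (s.k + 2) * (a.Dbar / (12 * a.ηH)) :=
            mul_le_mul_of_nonneg_left h7 (by linarith)
          have h12 : 0 ≤ (s.k + 2) * (a.Dbar / (12 * a.ηH)) := by
            have := hc.Dbar_nonneg
            have := hc.ηH_pos
            positivity
          rw [h9] at h2
          simp only [State.moveTo]
          push_cast
          linarith
        · rw [step_escape _ hp hk hb] at hrun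
          rw [hrun]
          refine ⟨fun h => by simp [State.moveTo, hp] at h, fun _ => ?_⟩
          have h3 := decrease_of_step hF hL hc.ηH_pos.le hc.step_le hE
          have h4 : a.ηH ^ 2 * ‖(run f a x₁ ω n).g‖ ^ 2 / (4 * a.ηH)
              = a.ηH / 4 * ‖(run f a x₁ ω n).g‖ ^ 2 := by
            have := hc.ηH_pos.ne'
            field_simp
          simp only [State.moveTo]
          push_cast
          rw [add_div, h4]
          linarith
    | halted n₀ hp =>
      rw [step_halted _ hp] at hrun
      rw [hrun, hp]
      exact ⟨fun h => by simp at h, fun h => by simp at h⟩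

/-- A run with accurate estimates halts before time `N`, if `N` exceeds the number of iterations
that the total decrease allows by the length of one escape phase. -/
theorem run_halts (hF : ∀ x, HasGradientAt F (gradient F x) x)
    (hL : ∀ x y, ‖gradient F x - gradient F y‖ ≤ L * ‖x - y‖) {E α Δ : ℝ} (hα : 0 < α)
    (hc : DecreaseConditions a L E α) {ω : ℕ → Draw d Ξ} {N : ℕ} (hball : ∀ n, ‖(ω n).2‖ ≤ 1)
    (hgood : ∀ n ≤ N, (run f a x₁ ω n).phase ≠ .halted →
      ‖(run f a x₁ ω n).g - gradient F (run f a x₁ ω n).x‖ ≤ E)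
    (hΔ : ∀ x, F x₁ - F x ≤ Δ) (hN : Δ / α + a.T + 1 < N) :
    (run f a x₁ ω N).phase = .halted := by
  have hdesc : ∀ n ≤ N, (run f a x₁ ω n).phase = .descent → (n : ℝ) ≤ Δ / α := by
    intro n hn hp
    have h1 := (run_decrease hF hL hc hball hgood n hn).1 hp
    have h2 := hΔ (run f a x₁ ω n).x
    rw [le_div_iff₀ hα]
    linarith
  cases runShape (f := f) (x₁ := x₁) hc.Dbar_nonneg ω N with
  | descent hp ht =>
    have := hdesc N le_rfl hp
    have : (0 : ℝ) ≤ a.T := Nat.cast_nonneg _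
    linarith
  | escape n₀ hp hn h =>
    exfalso
    have h1 := hdesc n₀ (by omega) h.phase_start
    have h2 : (N : ℝ) = n₀ + 1 + (run f a x₁ ω N).k := by exact_mod_cast hn
    have h3 : ((run f a x₁ ω N).k : ℝ) ≤ a.T := by exact_mod_cast h.le_T
    linarith
  | halted n₀ hp => exact hp

end Decrease

/-! ### Measurability of a run -/

section Measurability

variable {d : ℕ} {Ξ : Type*} [MeasurableSpace Ξ] {f : Vec d → Ξ → ℝ} {a : Params} {x₁ : Vec d}

instance : MeasurableSpace Phase := ⊤

/-- The fields of a configuration, as a tuple. -/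
def State.toTuple (s : State d) : ℕ × Vec d × Vec d × Phase × ℕ × Vec d × ℕ × ℝ × ℕ :=
  (s.t, s.x, s.g, s.phase, s.m, s.anchor, s.k, s.D, s.cost)

/-- The σ-algebra that makes all fields measurable. -/
instance : MeasurableSpace (State d) := MeasurableSpace.comap State.toTuple inferInstance

theorem measurable_toTuple : Measurable (State.toTuple (d := d)) := comap_measurable _

section Projections

theorem measurable_state_t : Measurable (State.t (d := d)) := measurable_toTuple.fst
theorem measurable_state_x : Measurable (State.x (d := d)) := measurable_toTuple.snd.fst
theorem measurable_state_g : Measurable (State.g (d := d)) := measurable_toTuple.snd.snd.fst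
theorem measurable_state_phase : Measurable (State.phase (d := d)) :=
  measurable_toTuple.snd.snd.snd.fst
theorem measurable_state_m : Measurable (State.m (d := d)) :=
  measurable_toTuple.snd.snd.snd.snd.fst
theorem measurable_state_anchor : Measurable (State.anchor (d := d)) :=
  measurable_toTuple.snd.snd.snd.snd.snd.fst
theorem measurable_state_k : Measurable (State.k (d := d)) :=
  measurable_toTuple.snd.snd.snd.snd.snd.snd.fst
theorem measurable_state_D : Measurable (State.D (d := d)) :=
  measurable_toTuple.snd.snd.snd.snd.snd.snd.snd.fst
theorem measurable_state_cost : Measurable (State.cost (d := d)) :=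
  measurable_toTuple.snd.snd.snd.snd.snd.snd.snd.snd

end Projections

theorem measurable_mk {Z : Type*} [MeasurableSpace Z] {φ : Z → State d}
    (ht : Measurable fun z => (φ z).t) (hx : Measurable fun z => (φ z).x)
    (hg : Measurable fun z => (φ z).g) (hp : Measurable fun z => (φ z).phase)
    (hm : Measurable fun z => (φ z).m) (ha : Measurable fun z => (φ z).anchor)
    (hk : Measurable fun z => (φ z).k) (hD : Measurable fun z => (φ z).D)
    (hc : Measurable fun z => (φ z).cost) : Measurable φ :=
  measurable_comap_iff.mpr
    (ht.prodMk (hx.prodMk (hg.prodMk (hp.prodMk (hm.prodMk (ha.prodMk (hk.prodMk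
      (hD.prodMk hc))))))))

variable {Z : Type*} [MeasurableSpace Z]

theorem measurable_spider (hf : Measurable (Function.uncurry (sgrad f))) {t : Z → ℕ}
    {g x x' : Z → Vec d} {s : Z → ℕ → Ξ} (ht : Measurable t) (hg : Measurable g)
    (hx : Measurable x) (hx' : Measurable x') (hs : Measurable s) :
    Measurable fun z => spider f a (t z) (g z) (x z) (x' z) (s z) := by
  have hsg : ∀ {y : Z → Vec d}, Measurable y → ∀ i, Measurable fun z => sgrad f (y z) (s z i) :=
    fun hy i => hf.comp (hy.prodMk hs.eval)
  unfold spider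
  refine Measurable.ite (ht (MeasurableSet.of_discrete (s := {t | t % a.q = 0}))) ?_ ?_
  · exact (Finset.measurable_sum _ fun i _ => hsg hx' i).const_smul (a.B : ℝ)⁻¹
  · exact hg.add ((Finset.measurable_sum _ fun i _ => (hsg hx' i).sub (hsg hx i)).const_smul
      (a.b : ℝ)⁻¹)

theorem measurable_spiderCost {t : Z → ℕ} (ht : Measurable t) :
    Measurable fun z => spiderCost a (t z) :=
  (Measurable.of_discrete (f := spiderCost a)).comp ht

theorem measurable_moveTo (hf : Measurable (Function.uncurry (sgrad f))) {s : Z → State d}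
    {x' : Z → Vec d} {ω : Z → Draw d Ξ} (hs : Measurable s) (hx' : Measurable x')
    (hω : Measurable ω) : Measurable fun z => (s z).moveTo f a (x' z) (ω z) := by
  refine measurable_mk ?_ hx' ?_ ?_ ?_ ?_ ?_ ?_ ?_
  · exact (measurable_state_t.comp hs).add_const 1
  · exact measurable_spider hf (measurable_state_t.comp hs) (measurable_state_g.comp hs)
      (measurable_state_x.comp hs) hx' hω.fst
  · exact (measurable_state_phase.comp hs :)
  · exact (measurable_state_m.comp hs :)
  · exact (measurable_state_anchor.comp hs :)
  · exact (measurable_state_k.comp hs :)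
  · exact (measurable_state_D.comp hs :)
  · exact (measurable_state_cost.comp hs).add (measurable_spiderCost (measurable_state_t.comp hs))

open scoped Classical in
theorem step_eq_ite (f : Vec d → Ξ → ℝ) (a : Params) (s : State d) (ω : Draw d Ξ) :
    step f a s ω = if s.phase ∈ ({Phase.descent} : Set Phase) then
        (if a.θ < ‖s.g‖ then s.moveTo f a (s.x - (a.η / ‖s.g‖) • s.g) ω
        else { s.moveTo f a (s.x + a.r • ω.2) ω with
          phase := .escape, m := s.t, anchor := s.x, k := 0, D := 0 })
      else if s.phase ∈ ({Phase.escape} : Set Phase) then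
        (if s.k ∈ {k | a.T ≤ k} then { s with phase := .halted }
        else if (s.t - s.m + 1 : ℝ) * a.Dbar < s.D + a.ηH ^ 2 * ‖s.g‖ ^ 2 then
          { s.moveTo f a
            (s.x - (Real.sqrt ((s.t - s.m + 1 : ℝ) * a.Dbar - s.D) / ‖s.g‖) • s.g) ω with
            phase := .descent, D := (s.t - s.m + 1 : ℝ) * a.Dbar }
        else { s.moveTo f a (s.x - a.ηH • s.g) ω with
          k := s.k + 1, D := s.D + a.ηH ^ 2 * ‖s.g‖ ^ 2 })
      else s := by
  unfold step
  rcases hp : s.phase with _ | _ | _ <;> simp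

open scoped Classical in
theorem measurable_step (hf : Measurable (Function.uncurry (sgrad f))) {s : Z → State d}
    {ω : Z → Draw d Ξ} (hs : Measurable s) (hω : Measurable ω) :
    Measurable fun z => step f a (s z) (ω z) := by
  have ht := measurable_state_t.comp hs
  have hx := measurable_state_x.comp hs
  have hg := measurable_state_g.comp hs
  have hp := measurable_state_phase.comp hs
  have hm := measurable_state_m.comp hs
  have ha := measurable_state_anchor.comp hs
  have hk := measurable_state_k.comp hs
  have hD := measurable_state_D.comp hs
  have hc := measurable_state_cost.comp hs
  simp only [Function.comp_def] at ht hx hg hp hm ha hk hD hc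
  have htR : Measurable fun z => ((s z).t : ℝ) := (Measurable.of_discrete).comp ht
  have hmR : Measurable fun z => ((s z).m : ℝ) := (Measurable.of_discrete).comp hm
  have hb : Measurable fun z => ((s z).t - (s z).m + 1 : ℝ) * a.Dbar :=
    ((htR.sub hmR).add_const 1).mul_const _
  have hD' : Measurable fun z => (s z).D + a.ηH ^ 2 * ‖(s z).g‖ ^ 2 :=
    hD.add ((hg.norm.pow_const 2).const_mul _)
  simp only [step_eq_ite]
  refine Measurable.ite (hp (MeasurableSet.of_discrete)) (Measurable.ite ?_ ?_ ?_)
    (Measurable.ite (hp (MeasurableSet.of_discrete))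
      (Measurable.ite (hk (MeasurableSet.of_discrete)) ?_ (Measurable.ite ?_ ?_ ?_)) hs)
  · exact measurableSet_lt measurable_const hg.norm
  · exact measurable_moveTo hf hs (hx.sub ((measurable_const.div hg.norm).smul hg)) hω
  · have h := measurable_moveTo (a := a) hf hs (hx.add (hω.snd.const_smul a.r)) hω
    exact measurable_mk (measurable_state_t.comp h :) (measurable_state_x.comp h :)
      (measurable_state_g.comp h :) measurable_const ht hx measurable_const measurable_const
      (measurable_state_cost.comp h :)
  · exact measurable_mk ht hx hg measurable_const hm ha hk hD hc
  · exact measurableSet_lt hb hD'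
  · have h := measurable_moveTo (a := a) hf hs
      (hx.sub (((hb.sub hD).sqrt.div hg.norm).smul hg)) hω
    exact measurable_mk (measurable_state_t.comp h :) (measurable_state_x.comp h :)
      (measurable_state_g.comp h :) measurable_const hm ha hk hb
      (measurable_state_cost.comp h :)
  · have h := measurable_moveTo (a := a) hf hs (hx.sub (hg.const_smul a.ηH)) hω
    exact measurable_mk (measurable_state_t.comp h :) (measurable_state_x.comp h :)
      (measurable_state_g.comp h :) hp hm ha (hk.add_const 1) hD'
      (measurable_state_cost.comp h :)

theorem measurable_run (hf : Measurable (Function.uncurry (sgrad f))) (n : ℕ) :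
    Measurable fun ω : ℕ → Draw d Ξ => run f a x₁ ω n := by
  induction n with
  | zero =>
    refine measurable_mk measurable_const measurable_const ?_ measurable_const measurable_const
      measurable_const measurable_const measurable_const measurable_const
    change Measurable fun ω : ℕ → Draw d Ξ => spider f a 0 0 0 x₁ (ω 0).1
    exact measurable_spider hf measurable_const measurable_const measurable_const
      measurable_const (measurable_pi_apply (X := fun _ => Draw d Ξ) 0).fst
  | succ n ih => exact measurable_step hf ih (measurable_pi_apply (n + 1))

theorem run_congr {ω ω' : ℕ → Draw d Ξ} {n : ℕ} (h : ∀ i ≤ n, ω i = ω' i) :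
    run f a x₁ ω n = run f a x₁ ω' n := by
  induction n with
  | zero => simp [run, h 0 le_rfl]
  | succ n ih =>
    simp only [run]
    rw [ih fun i hi => h i (by omega), h (n + 1) le_rfl]

end Measurability

/-! ### Accuracy of the gradient estimates -/

section Accuracy

variable {d : ℕ} {Ξ : Type*} [MeasurableSpace Ξ] {P : Measure Ξ} [IsProbabilityMeasure P]
  {f : Vec d → Ξ → ℝ} {a : Params} {x₁ : Vec d} {L ρ σ Δ : ℝ}

/-- Exponential moment of a mini-batch mean about its expectation. -/
theorem lintegral_cosh_mean_le {ψ : Ξ → Vec d} (hψ : Measurable ψ) {c : ℝ} {μ : Vec d}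
    (hμ : ∫ ξ, ψ ξ ∂P = μ) (hb : ∀ ξ, ‖ψ ξ - μ‖ ≤ c) (l : ℝ) (x : Vec d) {n : ℕ} (hn : 0 < n) :
    ∫⁻ s, ENNReal.ofReal
        (Real.cosh (l * ‖x + ((n : ℝ)⁻¹ • ∑ i ∈ Finset.range n, ψ (s i) - μ)‖))
        ∂(Measure.infinitePi fun _ : ℕ => P)
      ≤ ENNReal.ofReal (Real.cosh (l * ‖x‖) * Real.exp (l ^ 2 * c ^ 2 / (2 * n))) := by
  have hn' : (n : ℝ) ≠ 0 := by positivity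
  have hint : Integrable ψ P := by
    refine Integrable.of_bound hψ.aestronglyMeasurable (‖μ‖ + c) (Eventually.of_forall fun ξ => ?_)
    have := norm_add_le μ (ψ ξ - μ)
    rw [add_sub_cancel] at this
    linarith [hb ξ]
  have key := lintegral_cosh_batch_le P (φ := fun ξ => (n : ℝ)⁻¹ • (ψ ξ - μ)) (c := (n : ℝ)⁻¹ * c)
    ((hψ.sub_const μ).const_smul (n : ℝ)⁻¹)
    (fun ξ => by
      rw [norm_smul, Real.norm_of_nonneg (by positivity)]
      exact mul_le_mul_of_nonneg_left (hb ξ) (by positivity))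
    (by
      rw [integral_smul, integral_sub hint (integrable_const _), hμ]
      simp) l x n
  refine le_trans (le_of_eq (lintegral_congr fun s => ?_)) (key.trans_eq ?_)
  · rw [← Finset.smul_sum, Finset.sum_sub_distrib, smul_sub, Finset.sum_const, Finset.card_range,
      ← Nat.cast_smul_eq_nsmul ℝ, smul_smul, inv_mul_cancel₀ hn', one_smul]
  · congr 3
    field_simp

/-- Exponential moment of the error of the estimate, given the past. -/
theorem lintegral_cosh_spider_le (h : Assumptions P f x₁ L ρ σ Δ) (hσ : 0 ≤ σ) (hL : 0 ≤ L)
    (hB : 0 < a.B) (hb : 0 < a.b) (l : ℝ) (t : ℕ) (g x x' : Vec d) :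
    ∫⁻ s, ENNReal.ofReal (Real.cosh (l * ‖spider f a t g x x' s
          - gradient (objective P f) x'‖)) ∂(Measure.infinitePi fun _ : ℕ => P)
      ≤ ENNReal.ofReal (if t % a.q = 0 then Real.exp (l ^ 2 * σ ^ 2 / (2 * a.B))
        else Real.cosh (l * ‖g - gradient (objective P f) x‖) *
          Real.exp (2 * l ^ 2 * L ^ 2 / a.b * ‖x' - x‖ ^ 2)) := by
  have hgx := h.gradient_objective hσ hL
  unfold spider
  split_ifs with ht
  · have := lintegral_cosh_mean_le (P := P) (h.measurable_sgrad x') (hgx x').symm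
      (fun ξ => h.norm_sgrad_sub_le hσ x' ξ) l 0 hB
    simpa using this
  · have := lintegral_cosh_mean_le (P := P) (c := 2 * L * ‖x' - x‖)
      (μ := gradient (objective P f) x' - gradient (objective P f) x)
      ((h.measurable_sgrad x').sub (h.measurable_sgrad x))
      (by
        simp only [Pi.sub_apply]
        rw [integral_sub (h.integrable_sgrad hσ x') (h.integrable_sgrad hσ x), hgx, hgx])
      (fun ξ => (norm_sub_le _ _).trans (by
        have h1 := h.smooth ξ x' x
        have h2 := h.norm_gradient_sub_le hσ hL x' x
        simp only [Pi.sub_apply]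
        linarith)) l (g - gradient (objective P f) x) hb
    refine le_trans (le_of_eq (lintegral_congr fun s => ?_)) (this.trans_eq ?_)
    · congr 4
      simp only [Pi.sub_apply]
      abel
    · congr 3
      field_simp

/-- The part of the movement budget of an escape phase that has not been used. -/
def slack (a : Params) (s : State d) : ℝ :=
  match s.phase with
  | .escape => (s.t - s.m : ℝ) * a.Dbar - s.D
  | _ => 0

/-- The potential that controls the error of the estimate: the weight `c` of the unused movement
budget compensates the growth of the error in the steps that use it up. -/
def errorPotential (F : Vec d → ℝ) (a : Params) (l c : ℝ) (s : State d) : ENNReal :=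
  match s.phase with
  | .halted => 0
  | _ => ENNReal.ofReal (Real.cosh (l * ‖s.g - gradient F s.x‖) * Real.exp (c * slack a s))

theorem errorPotential_of_ne {F : Vec d → ℝ} {l c : ℝ} {s : State d} (h : s.phase ≠ .halted) :
    errorPotential F a l c s
      = ENNReal.ofReal (Real.cosh (l * ‖s.g - gradient F s.x‖) * Real.exp (c * slack a s)) := by
  unfold errorPotential
  rcases hp : s.phase with _ | _ | _
  · rfl
  · rfl
  · exact absurd hp h

/-- The conditions on the step lengths that make the squared movement per iteration at most
`Dbar` on average. -/
structure MovementConditions (a : Params) : Prop where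
  Dbar_nonneg : 0 ≤ a.Dbar
  r_nonneg : 0 ≤ a.r
  η_nonneg : 0 ≤ a.η
  r_sq_le : a.r ^ 2 ≤ a.Dbar
  η_sq_le : a.η ^ 2 ≤ a.Dbar
  θ_nonneg : 0 ≤ a.θ

/-- Each step either stops or moves to a point `y + τ • ζ`; its squared length is paid for by
`2 * Dbar` and the unused movement budget. -/
theorem step_movement (hc : MovementConditions a) {ω : ℕ → Draw d Ξ} {n : ℕ} :
    (∀ z, (step f a (run f a x₁ ω n) z).phase = .halted) ∨
    ((run f a x₁ ω n).phase ≠ .halted ∧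
    ∃ (y : Vec d) (τ U : ℝ), U ≤ (a.T + 1) * a.Dbar ∧
      (∀ ζ : Vec d, ‖ζ‖ ≤ 1 →
        ‖y + τ • ζ - (run f a x₁ ω n).x‖ ^ 2 + U ≤ slack a (run f a x₁ ω n) + 2 * a.Dbar) ∧
      ∀ z, (step f a (run f a x₁ ω n) z).phase ≠ .halted ∧
        (step f a (run f a x₁ ω n) z).x = y + τ • z.2 ∧
        (step f a (run f a x₁ ω n) z).g = spider f a (n + 1) (run f a x₁ ω n).g
          (run f a x₁ ω n).x (y + τ • z.2) z.1 ∧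
        slack a (step f a (run f a x₁ ω n) z) = U) := by
  have hD := hc.Dbar_nonneg
  have hT : (0 : ℝ) ≤ (a.T + 1) * a.Dbar := by positivity
  cases runShape (f := f) (x₁ := x₁) hD ω n with
  | descent hp ht =>
    set s := run f a x₁ ω n
    have hsl : slack a s = 0 := by simp [slack, hp]
    by_cases hg : a.θ < ‖s.g‖
    · refine Or.inr ⟨by rw [hp]; simp, s.x - (a.η / ‖s.g‖) • s.g, 0, 0, hT, fun ζ _ => ?_,
        fun z => ?_⟩
      · have hg0 : ‖s.g‖ ≠ 0 := (hc.θ_nonneg.trans_lt hg).ne'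
        have h1 : s.x - (a.η / ‖s.g‖) • s.g + (0 : ℝ) • ζ - s.x = -((a.η / ‖s.g‖) • s.g) := by
          rw [zero_smul]; abel
        rw [h1, norm_neg, norm_smul, Real.norm_of_nonneg (div_nonneg hc.η_nonneg (norm_nonneg _)),
          div_mul_cancel₀ _ hg0, hsl]
        linarith [hc.η_sq_le]
      · rw [step_descent _ hp hg]
        simp [State.moveTo, hp, ht, slack]
    · refine Or.inr ⟨by rw [hp]; simp, s.x, a.r, a.Dbar, ?_, fun ζ hζ => ?_, fun z => ?_⟩
      · have : (0 : ℝ) ≤ a.T := Nat.cast_nonneg _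
        nlinarith
      · rw [add_sub_cancel_left, norm_smul, Real.norm_of_nonneg hc.r_nonneg, mul_pow, hsl]
        have h1 : ‖ζ‖ ^ 2 ≤ 1 := pow_le_one₀ (norm_nonneg _) hζ
        nlinarith [hc.r_sq_le, sq_nonneg a.r]
      · rw [step_perturb _ hp hg]
        simp [State.moveTo, ht, slack]
  | escape n₀ hp hn h =>
    set s := run f a x₁ ω n
    have hts : (s.t - s.m : ℝ) = s.k + 1 := by
      rw [h.t_eq, h.m_eq]; push_cast; ring
    have htn : s.t = n + 1 := by rw [h.t_eq]; omega
    have hsl : slack a s = (s.k + 1) * a.Dbar - s.D := by simp [slack, hp, hts]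
    have hDle : s.D ≤ (s.k + 1) * a.Dbar := by rw [h.D_eq]; exact h.small _ le_rfl
    have hD0 : 0 ≤ s.D := by
      rw [h.D_eq]; exact Finset.sum_nonneg fun i _ => by positivity
    by_cases hk : a.T ≤ s.k
    · left
      intro z
      rw [step_stop _ hp hk]
    · have hkT : (s.k : ℝ) + 1 ≤ a.T := by exact_mod_cast not_le.mp hk
      by_cases hb : (s.t - s.m + 1 : ℝ) * a.Dbar < s.D + a.ηH ^ 2 * ‖s.g‖ ^ 2
      · refine Or.inr ⟨by rw [hp]; simp,
          s.x - (Real.sqrt ((s.t - s.m + 1 : ℝ) * a.Dbar - s.D) / ‖s.g‖) • s.g, 0, 0, hT,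
          fun ζ _ => ?_, fun z => ?_⟩
        · have hrem : 0 ≤ (s.t - s.m + 1 : ℝ) * a.Dbar - s.D := by rw [hts]; nlinarith
          have hg0 : 0 < ‖s.g‖ := by
            rcases (norm_nonneg s.g).eq_or_lt with h0 | h0
            · rw [← h0] at hb; nlinarith
            · exact h0
          have h1 : ∀ v : Vec d, s.x - v + (0 : ℝ) • ζ - s.x = -v := by
            intro v; rw [zero_smul]; abel
          rw [h1, norm_neg, norm_smul, Real.norm_of_nonneg (by positivity),
            div_mul_cancel₀ _ hg0.ne', Real.sq_sqrt hrem, hsl, hts]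
          linarith
        · rw [step_break _ hp hk hb]
          simp [State.moveTo, htn, slack]
      · refine Or.inr ⟨by rw [hp]; simp, s.x - a.ηH • s.g, 0,
          (s.k + 2) * a.Dbar - (s.D + a.ηH ^ 2 * ‖s.g‖ ^ 2), ?_, fun ζ _ => ?_, fun z => ?_⟩
        · have : 0 ≤ a.ηH ^ 2 * ‖s.g‖ ^ 2 := by positivity
          nlinarith
        · have h1 : ∀ v : Vec d, s.x - v + (0 : ℝ) • ζ - s.x = -v := by
            intro v; rw [zero_smul]; abel
          rw [h1, norm_neg, norm_smul, mul_pow, Real.norm_eq_abs, sq_abs, hsl]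
          linarith
        · rw [step_escape _ hp hk hb]
          have h2 : ((s.t + 1 : ℕ) - s.m : ℝ) = s.k + 2 := by push_cast; linarith
          refine ⟨by simp [State.moveTo, hp], by simp [State.moveTo], by
            simp [State.moveTo, htn], ?_⟩
          simp only [slack, State.moveTo, hp]
          rw [h2]
  | halted n₀ hp =>
    left
    intro z
    rw [step_halted _ hp, hp]

theorem ae_norm_le_one_unifBall (d : ℕ) : ∀ᵐ ζ ∂(unifBall d), ‖ζ‖ ≤ 1 := by
  have h := ae_cond_mem (μ := (volume : Measure (Vec d))) (s := Metric.closedBall (0 : Vec d) 1)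
    measurableSet_closedBall
  filter_upwards [h] with ζ hζ
  simpa using hζ

open scoped Classical in
theorem measurable_errorPotential {F : Vec d → ℝ} (hF : Continuous (gradient F)) (l c : ℝ) :
    Measurable (errorPotential F a l c) := by
  have hR : Measurable fun s : State d => ((s.t : ℝ) - s.m) * a.Dbar - s.D :=
    (((Measurable.of_discrete.comp measurable_state_t).sub
      (Measurable.of_discrete.comp measurable_state_m)).mul_const _).sub measurable_state_D
  have hsl : Measurable (slack (d := d) a) := by
    have : slack (d := d) a = fun s => if s.phase ∈ ({Phase.escape} : Set Phase) then
        (s.t - s.m : ℝ) * a.Dbar - s.D else 0 := by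
      funext s
      rcases hp : s.phase with _ | _ | _ <;> simp [slack, hp]
    rw [this]
    exact Measurable.ite (measurable_state_phase (MeasurableSet.of_discrete)) hR measurable_const
  have : errorPotential F a l c = fun s => if s.phase ∈ ({Phase.halted} : Set Phase) then 0 else
      ENNReal.ofReal (Real.cosh (l * ‖s.g - gradient F s.x‖) * Real.exp (c * slack a s)) := by
    funext s
    rcases hp : s.phase with _ | _ | _ <;> simp [errorPotential, hp]
  rw [this]
  refine Measurable.ite (measurable_state_phase (MeasurableSet.of_discrete)) measurable_const ?_
  refine ENNReal.measurable_ofReal.comp (Measurable.mul ?_ ?_)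
  · exact Real.measurable_cosh.comp ((measurable_state_g.sub
      (hF.measurable.comp measurable_state_x)).norm.const_mul l)
  · exact Real.measurable_exp.comp (hsl.const_mul c)

theorem Assumptions.continuous_gradient (h : Assumptions P f x₁ L ρ σ Δ) (hσ : 0 ≤ σ)
    (hL : 0 ≤ L) : Continuous (gradient (objective P f)) :=
  continuous_iff_continuousAt.mpr fun x => (h.hasFDerivAt_gradient hσ hL x).continuousAt

/-- One step multiplies the expected potential by at most a constant close to `1`, and a restart of
the estimator resets it. -/
theorem lintegral_errorPotential_step_le (h : Assumptions P f x₁ L ρ σ Δ) (hσ : 0 ≤ σ)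
    (hL : 0 ≤ L) (hB : 0 < a.B) (hb : 0 < a.b) (hc : MovementConditions a) (l : ℝ)
    (ω : ℕ → Draw d Ξ) (n : ℕ) :
    ∫⁻ z, errorPotential (objective P f) a l (2 * l ^ 2 * L ^ 2 / a.b)
        (step f a (run f a x₁ ω n) z) ∂((Measure.infinitePi fun _ : ℕ => P).prod (unifBall d))
      ≤ if (n + 1) % a.q = 0 then
          ENNReal.ofReal (Real.exp (l ^ 2 * σ ^ 2 / (2 * a.B)
            + 2 * l ^ 2 * L ^ 2 / a.b * ((a.T + 1) * a.Dbar)))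
        else errorPotential (objective P f) a l (2 * l ^ 2 * L ^ 2 / a.b) (run f a x₁ ω n) *
          ENNReal.ofReal (Real.exp (2 * l ^ 2 * L ^ 2 / a.b * (2 * a.Dbar))) := by
  set c := 2 * l ^ 2 * L ^ 2 / a.b with hcdef
  have hc0 : 0 ≤ c := by positivity
  rcases step_movement (f := f) (x₁ := x₁) hc (ω := ω) (n := n) with hh | ⟨hne, y, τ, U, hU, hmv, hz⟩
  · have : ∀ z, errorPotential (objective P f) a l c (step f a (run f a x₁ ω n) z) = 0 := by
      intro z; simp [errorPotential, hh z]
    simp [this]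
  · set s := run f a x₁ ω n
    have hpt : ∀ z : Draw d Ξ, errorPotential (objective P f) a l c (step f a s z)
        = ENNReal.ofReal (Real.cosh (l * ‖spider f a (n + 1) s.g s.x (y + τ • z.2) z.1
            - gradient (objective P f) (y + τ • z.2)‖)) * ENNReal.ofReal (Real.exp (c * U)) := by
      intro z
      obtain ⟨h1, h2, h3, h4⟩ := hz z
      rw [errorPotential_of_ne h1, h2, h3, h4, ENNReal.ofReal_mul (Real.cosh_pos _).le]
    simp_rw [hpt]
    rw [lintegral_mul_const' _ _ ENNReal.ofReal_ne_top]
    have hmeas : Measurable fun z : Draw d Ξ =>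
        ENNReal.ofReal (Real.cosh (l * ‖spider f a (n + 1) s.g s.x (y + τ • z.2) z.1
            - gradient (objective P f) (y + τ • z.2)‖)) := by
      have hX : Measurable fun z : Draw d Ξ => y + τ • z.2 :=
        (measurable_snd.const_smul τ).const_add y
      refine ENNReal.measurable_ofReal.comp (Real.measurable_cosh.comp
        (Measurable.const_mul (Measurable.norm (Measurable.sub ?_ ?_)) l))
      · exact measurable_spider h.measurable_uncurry_sgrad measurable_const measurable_const
          measurable_const hX measurable_fst
      · exact (h.continuous_gradient hσ hL).measurable.comp hX
    rw [lintegral_prod_symm _ hmeas.aemeasurable]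
    have hbd : ∫⁻ ζ, ∫⁻ w, ENNReal.ofReal (Real.cosh (l * ‖spider f a (n + 1) s.g s.x
          (y + τ • ζ) w - gradient (objective P f) (y + τ • ζ)‖))
          ∂(Measure.infinitePi fun _ : ℕ => P) ∂(unifBall d)
        ≤ ∫⁻ ζ, ENNReal.ofReal (if (n + 1) % a.q = 0 then Real.exp (l ^ 2 * σ ^ 2 / (2 * a.B))
          else Real.cosh (l * ‖s.g - gradient (objective P f) s.x‖) *
            Real.exp (c * (slack a s + 2 * a.Dbar - U))) ∂(unifBall d) := by
      refine lintegral_mono_ae ?_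
      filter_upwards [ae_norm_le_one_unifBall d] with ζ hζ
      refine (lintegral_cosh_spider_le h hσ hL hB hb l (n + 1) s.g s.x (y + τ • ζ)).trans
        (ENNReal.ofReal_le_ofReal ?_)
      split_ifs with hq
      · exact le_rfl
      · refine mul_le_mul_of_nonneg_left (Real.exp_le_exp.mpr ?_) (Real.cosh_pos _).le
        exact mul_le_mul_of_nonneg_left (by linarith [hmv ζ hζ]) hc0
    refine (mul_le_mul_left hbd _).trans ?_
    rw [lintegral_const, measure_univ, mul_one]
    split_ifs with hq
    · rw [← ENNReal.ofReal_mul (Real.exp_pos _).le, ← Real.exp_add]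
      refine ENNReal.ofReal_le_ofReal (Real.exp_le_exp.mpr ?_)
      have := mul_le_mul_of_nonneg_left hU hc0
      linarith
    · rw [errorPotential_of_ne hne, ← ENNReal.ofReal_mul (by positivity),
        ← ENNReal.ofReal_mul (by positivity), mul_assoc, mul_assoc, ← Real.exp_add,
        ← Real.exp_add]
      refine ENNReal.ofReal_le_ofReal (le_of_eq ?_)
      ring_nf

/-- Between two restarts, that is for less than `q` steps, the factors of
`lintegral_errorPotential_step_le` accumulate. -/
theorem lintegral_errorPotential_run_le (h : Assumptions P f x₁ L ρ σ Δ) (hσ : 0 ≤ σ)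
    (hL : 0 ≤ L) (hB : 0 < a.B) (hb : 0 < a.b) (hq : 0 < a.q) (hc : MovementConditions a) (l : ℝ)
    (n : ℕ) :
    ∫⁻ ω, errorPotential (objective P f) a l (2 * l ^ 2 * L ^ 2 / a.b)
        (run f a x₁ ω n) ∂(drawLaw P d)
      ≤ ENNReal.ofReal (Real.exp (l ^ 2 * σ ^ 2 / (2 * a.B)
            + 2 * l ^ 2 * L ^ 2 / a.b * ((a.T + 1) * a.Dbar)
            + 2 * l ^ 2 * L ^ 2 / a.b * (2 * a.Dbar) * (n % a.q : ℕ))) := by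
  set c := 2 * l ^ 2 * L ^ 2 / a.b with hcdef
  have hc0 : 0 ≤ c := by positivity
  have hD := hc.Dbar_nonneg
  induction n with
  | zero =>
    have hpt : ∀ ω : ℕ → Draw d Ξ, errorPotential (objective P f) a l c (run f a x₁ ω 0)
        = ENNReal.ofReal (Real.cosh (l * ‖spider f a 0 0 0 x₁ (ω 0).1
          - gradient (objective P f) x₁‖)) := by
      intro ω
      rw [errorPotential_of_ne (by simp [run, init])]
      simp [run, init, slack]
    simp_rw [hpt]
    refine (lintegral_infinitePi_le_update _ 0 _).trans ?_
    simp only [Function.update_self, lintegral_const, measure_univ, mul_one]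
    refine (lintegral_prod_le _).trans ?_
    simp only [lintegral_const, measure_univ, mul_one]
    refine (lintegral_cosh_spider_le h hσ hL hB hb l 0 0 0 x₁).trans
      (ENNReal.ofReal_le_ofReal ?_)
    simp only [Nat.zero_mod, if_true]
    refine Real.exp_le_exp.mpr ?_
    have : 0 ≤ c * ((a.T + 1) * a.Dbar) := by positivity
    simp only [Nat.cast_zero, mul_zero, add_zero]
    linarith
  | succ n ih =>
    refine (lintegral_infinitePi_le_update _ (n + 1) _).trans ?_
    have hpt : ∀ (ω : ℕ → Draw d Ξ) (z : Draw d Ξ),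
        run f a x₁ (Function.update ω (n + 1) z) (n + 1) = step f a (run f a x₁ ω n) z := by
      intro ω z
      simp only [run, Function.update_self]
      congr 1
      exact run_congr fun i hi => Function.update_of_ne (by omega) _ _
    simp_rw [hpt]
    refine (lintegral_mono fun ω =>
      lintegral_errorPotential_step_le h hσ hL hB hb hc l ω n).trans ?_
    split_ifs with h0
    · rw [lintegral_const]
      refine (mul_le_of_le_one_right' prob_le_one).trans (ENNReal.ofReal_le_ofReal ?_)
      rw [h0]
      simp [hcdef]
    · rw [lintegral_mul_const' _ _ ENNReal.ofReal_ne_top]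
      refine (mul_le_mul_left ih _).trans ?_
      rw [← ENNReal.ofReal_mul (Real.exp_pos _).le, ← Real.exp_add]
      refine ENNReal.ofReal_le_ofReal (Real.exp_le_exp.mpr (le_of_eq ?_))
      have h1 : (n + 1) % a.q = n % a.q + 1 := by
        have h2 := Nat.mod_lt n hq
        rcases Nat.lt_or_ge (n % a.q + 1) a.q with h3 | h3
        · rw [Nat.add_mod, Nat.mod_eq_of_lt (by omega : 1 < a.q), Nat.mod_eq_of_lt h3]
        · exfalso
          apply h0
          have h4 : n % a.q + 1 = a.q := by omega
          rw [← Nat.mod_add_div n a.q, add_right_comm, h4, Nat.add_mul_mod_self_left, Nat.mod_self]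
      rw [h1]
      push_cast
      ring

/-- The probability that the estimate is far from the gradient at time `n`. -/
theorem measure_error_le (h : Assumptions P f x₁ L ρ σ Δ) (hσ : 0 < σ)
    (hL : 0 < L) {b : ℕ} (hb : 0 < b) (hB : a.B = b ^ 2) (hab : a.b = b) (hq : a.q = b)
    (hDbar : a.Dbar = σ ^ 2 / (4 * (b : ℝ) ^ 2 * L ^ 2)) (hT : a.T + 1 ≤ b)
    (hc : MovementConditions a) (ℓ : ℝ) (n : ℕ) :
    drawLaw P d {ω | (run f a x₁ ω n).phase ≠ .halted ∧
      σ / b * ℓ < ‖(run f a x₁ ω n).g - gradient (objective P f) (run f a x₁ ω n).x‖}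
      ≤ ENNReal.ofReal (2 * Real.exp 2 * Real.exp (-ℓ)) := by
  have hb' : (0 : ℝ) < b := by exact_mod_cast hb
  -- With this `l` each of the three exponents in `key` is at most `1`.
  set l := (b : ℝ) / σ with hl
  have hl0 : 0 < l := by positivity
  have key := lintegral_errorPotential_run_le (x₁ := x₁) h hσ.le hL.le
    (by rw [hB]; positivity) (by rw [hab]; exact hb) (by rw [hq]; exact hb) hc l n
  set c := 2 * l ^ 2 * L ^ 2 / a.b with hcdef
  have hcD : c * a.Dbar = 1 / (2 * b) := by
    rw [hcdef, hDbar, hab, hl]; field_simp; ring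
  have hmeas : Measurable fun ω : ℕ → Draw d Ξ =>
      errorPotential (objective P f) a l c (run f a x₁ ω n) :=
    (measurable_errorPotential (h.continuous_gradient hσ.le hL.le) l c).comp
      (measurable_run h.measurable_uncurry_sgrad n)
  have hexp : Real.exp (l ^ 2 * σ ^ 2 / (2 * a.B)
            + c * ((a.T + 1) * a.Dbar)
            + c * (2 * a.Dbar) * (n % a.q : ℕ)) ≤ Real.exp 2 := by
    refine Real.exp_le_exp.mpr ?_
    have e1 : l ^ 2 * σ ^ 2 / (2 * a.B) = 1 / 2 := by
      rw [hB, hl]; push_cast; field_simp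
    have e2 : c * ((a.T + 1) * a.Dbar) ≤ 1 / 2 := by
      have : c * ((a.T + 1) * a.Dbar) = (a.T + 1) * (c * a.Dbar) := by ring
      rw [this, hcD, mul_one_div, div_le_iff₀ (by positivity)]
      have : (a.T : ℝ) + 1 ≤ b := by exact_mod_cast hT
      linarith
    have e3 : c * (2 * a.Dbar) * (n % a.q : ℕ) ≤ 1 := by
      have : c * (2 * a.Dbar) * (n % a.q : ℕ) = 2 * (c * a.Dbar) * (n % a.q : ℕ) := by ring
      rw [this, hcD, hq]
      have h2 : ((n % b : ℕ) : ℝ) ≤ b := by exact_mod_cast (Nat.mod_lt n hb).le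
      have h3 : 2 * (1 / (2 * (b : ℝ))) = 1 / b := by field_simp
      rw [h3, one_div_mul_eq_div]
      exact div_le_one_of_le₀ h2 hb'.le
    linarith
  have hsub : {ω | (run f a x₁ ω n).phase ≠ .halted ∧
      σ / b * ℓ < ‖(run f a x₁ ω n).g - gradient (objective P f) (run f a x₁ ω n).x‖}
      ⊆ {ω | ENNReal.ofReal (Real.exp ℓ / 2)
        ≤ errorPotential (objective P f) a l c (run f a x₁ ω n)} := by
    rintro ω ⟨h1, h2⟩
    rw [Set.mem_ofPred_eq, errorPotential_of_ne h1]
    refine ENNReal.ofReal_le_ofReal ?_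
    have h3 : ℓ ≤ l * ‖(run f a x₁ ω n).g - gradient (objective P f) (run f a x₁ ω n).x‖ := by
      have := mul_le_mul_of_nonneg_left h2.le hl0.le
      have e : l * (σ / b * ℓ) = ℓ := by rw [hl]; field_simp
      rwa [e] at this
    have hsl : 0 ≤ slack a (run f a x₁ ω n) := by
      cases runShape (f := f) (x₁ := x₁) hc.Dbar_nonneg ω n with
      | descent hp ht => simp [slack, hp]
      | escape n₀ hp hn hh =>
        have hDle := hh.small _ le_rfl
        rw [← hh.D_eq] at hDle
        simp only [slack, hp]
        rw [hh.t_eq, hh.m_eq]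
        push_cast
        linarith
      | halted n₀ hp => simp [slack, hp]
    have h4 : 1 ≤ Real.exp (c * slack a (run f a x₁ ω n)) :=
      Real.one_le_exp (by positivity)
    have h5 : Real.exp ℓ / 2 ≤ Real.cosh
        (l * ‖(run f a x₁ ω n).g - gradient (objective P f) (run f a x₁ ω n).x‖) := by
      rw [Real.cosh_eq]
      have := Real.exp_le_exp.mpr h3
      have := Real.exp_pos
        (-(l * ‖(run f a x₁ ω n).g - gradient (objective P f) (run f a x₁ ω n).x‖))
      linarith
    nlinarith [Real.exp_pos ℓ]
  refine (measure_mono hsub).trans ((meas_ge_le_lintegral_div hmeas.aemeasurable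
    (by simpa using Real.exp_pos ℓ) ENNReal.ofReal_ne_top).trans ?_)
  refine (ENNReal.div_le_div_right (key.trans (ENNReal.ofReal_le_ofReal hexp)) _).trans ?_
  rw [← ENNReal.ofReal_div_of_pos (by positivity)]
  refine ENNReal.ofReal_le_ofReal (le_of_eq ?_)
  rw [Real.exp_neg]
  field_simp

end Accuracy

/-! ### Perturbed gradient descent on a quadratic with negative curvature -/

section Quadratic

variable {E : Type*} [NormedAddCommGroup E] [InnerProductSpace ℝ E]

/-- A symmetric operator between `-γ` and `L`, whose eigenvector `e` belongs to the least
eigenvalue `-γ`; `η` is a step size. -/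
structure QuadraticModel (H : E →L[ℝ] E) (e : E) (γ L η : ℝ) : Prop where
  symm : (H : E →ₗ[ℝ] E).IsSymmetric
  norm_le : ‖H‖ ≤ L
  lower : ∀ v, -γ * ‖v‖ ^ 2 ≤ ⟪H v, v⟫
  norm_e : ‖e‖ = 1
  eigen : H e = -γ • e
  γ_pos : 0 < γ
  η_pos : 0 < η
  step_le : η * L ≤ 1 / 10

namespace QuadraticModel

variable {H : E →L[ℝ] E} {e : E} {γ L η : ℝ}

theorem γ_le (h : QuadraticModel H e γ L η) : γ ≤ L := by
  have := H.le_opNorm e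
  rw [h.eigen, norm_smul, h.norm_e, Real.norm_eq_abs, abs_neg, abs_of_pos h.γ_pos] at this
  linarith [h.norm_le]

theorem inner_le (h : QuadraticModel H e γ L η) (v : E) : ⟪H v, v⟫ ≤ L * ‖v‖ ^ 2 := by
  have h1 := real_inner_le_norm (H v) v
  have h2 := (H.le_opNorm v).trans (mul_le_mul_of_nonneg_right h.norm_le (norm_nonneg v))
  nlinarith [norm_nonneg v]

/-- `I - η H` is positive semidefinite and at most `1 + η γ`, hence has norm at most `1 + η γ`. -/
theorem norm_sub_smul_le (h : QuadraticModel H e γ L η) (v : E) :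
    ‖v - η • H v‖ ≤ (1 + η * γ) * ‖v‖ := by
  have hη := h.η_pos
  have hγ := h.γ_pos
  set g := 1 + η * γ with hg
  have hg0 : 0 < g := by positivity
  set u := v - η • H v with hu
  have hA : ∀ z : E, 0 ≤ ⟪z - η • H z, z⟫ := by
    intro z
    rw [inner_sub_left, inner_smul_left, real_inner_self_eq_norm_sq]
    simp only [conj_trivial]
    have := mul_le_mul_of_nonneg_left (h.inner_le z) hη.le
    nlinarith [sq_nonneg ‖z‖, h.step_le]
  have hup : ∀ z : E, ⟪z - η • H z, z⟫ ≤ g * ‖z‖ ^ 2 := by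
    intro z
    rw [inner_sub_left, inner_smul_left, real_inner_self_eq_norm_sq]
    simp only [conj_trivial]
    have := mul_le_mul_of_nonneg_left (h.lower z) hη.le
    nlinarith
  have hsym : ∀ y z : E, ⟪y - η • H y, z⟫ = ⟪y, z - η • H z⟫ := by
    intro y z
    rw [inner_sub_left, inner_sub_right, inner_smul_left, inner_smul_right]
    simp only [conj_trivial]
    have : ⟪H y, z⟫ = ⟪y, H z⟫ := h.symm y z
    rw [this]
  -- The form of `I - ηH` is nonnegative at `v - g⁻¹ (I - ηH) v`.
  have key := hA (v - g⁻¹ • u)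
  have e1 : (v - g⁻¹ • u) - η • H (v - g⁻¹ • u) = u - g⁻¹ • (u - η • H u) := by
    rw [map_sub, map_smul, hu]
    module
  have e2 : ⟪u - η • H u, v⟫ = ‖u‖ ^ 2 := by
    rw [hsym, ← hu, real_inner_self_eq_norm_sq]
  rw [e1] at key
  have e3 : ⟪u - g⁻¹ • (u - η • H u), v - g⁻¹ • u⟫
      = ⟪u, v⟫ - 2 * g⁻¹ * ‖u‖ ^ 2 + g⁻¹ ^ 2 * ⟪u - η • H u, u⟫ := by
    rw [inner_sub_left, inner_sub_right, inner_sub_right, inner_smul_left, inner_smul_left,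
      inner_smul_right, inner_smul_right, e2, real_inner_self_eq_norm_sq]
    simp only [conj_trivial]
    ring
  rw [e3] at key
  have h4 := hup v
  rw [← hu] at h4
  have h5 : g⁻¹ ^ 2 * ⟪u - η • H u, u⟫ ≤ g⁻¹ ^ 2 * (g * ‖u‖ ^ 2) :=
    mul_le_mul_of_nonneg_left (hup u) (by positivity)
  have h6 : g⁻¹ ^ 2 * (g * ‖u‖ ^ 2) = g⁻¹ * ‖u‖ ^ 2 := by field_simp
  have h7 : g⁻¹ * ‖u‖ ^ 2 ≤ g * ‖v‖ ^ 2 := by linarith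
  have h8 : ‖u‖ ^ 2 ≤ (g * ‖v‖) ^ 2 := by
    rw [inv_mul_le_iff₀ hg0] at h7
    nlinarith
  exact (sq_le_sq₀ (norm_nonneg u) (by positivity)).mp h8

variable {w u : ℕ → E} {r₀ κ : ℝ} {n : ℕ}

/-- If the disturbances `u k` are small relative to the growth `(1 + η γ) ^ k`, then so is the
deviation of `w k` from the undisturbed solution `(1 + η γ) ^ k • w 0`. -/
theorem growth (h : QuadraticModel H e γ L η) (hw0 : w 0 = r₀ • e) (hr₀ : 0 ≤ r₀) (hκ : 0 ≤ κ)
    (hw : ∀ k < n, w (k + 1) = w k - η • (H (w k) + u k))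
    (hu : ∀ k < n, ‖u k‖ ≤ κ * (r₀ * (1 + η * γ) ^ k)) (k : ℕ) (hk : k ≤ n) :
    ‖w k‖ ≤ (1 + k * (η * κ)) * (r₀ * (1 + η * γ) ^ k) ∧
      (1 - k * (η * κ)) * (r₀ * (1 + η * γ) ^ k) ≤ ⟪w k, e⟫ := by
  have hη := h.η_pos
  have hγ := h.γ_pos
  set g := 1 + η * γ with hg
  have hg1 : 1 ≤ g := by
    have : 0 ≤ η * γ := by positivity
    linarith
  induction k with
  | zero =>
    rw [hw0]
    simp [norm_smul, h.norm_e, abs_of_nonneg hr₀, inner_smul_left]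
  | succ k ih =>
    obtain ⟨ih1, ih2⟩ := ih (by omega)
    have hgk : r₀ * g ^ k ≤ r₀ * g ^ (k + 1) := by
      rw [pow_succ, ← mul_assoc]
      exact le_mul_of_one_le_right (by positivity) hg1
    have huk := hu k (by omega)
    have hηu : η * ‖u k‖ ≤ η * κ * (r₀ * g ^ (k + 1)) := by
      rw [mul_assoc]
      exact mul_le_mul_of_nonneg_left
        (huk.trans (mul_le_mul_of_nonneg_left hgk hκ)) hη.le
    have e1 : w (k + 1) = (w k - η • H (w k)) - η • u k := by
      rw [hw k (by omega), smul_add]; abel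
    constructor
    · have h1 := norm_sub_le (w k - η • H (w k)) (η • u k)
      rw [← e1, norm_smul, Real.norm_of_nonneg hη.le] at h1
      have h2 := h.norm_sub_smul_le (w k)
      have h3 : g * ‖w k‖ ≤ g * ((1 + k * (η * κ)) * (r₀ * g ^ k)) :=
        mul_le_mul_of_nonneg_left ih1 (by linarith)
      have e2 : g * ((1 + k * (η * κ)) * (r₀ * g ^ k))
          = (1 + k * (η * κ)) * (r₀ * g ^ (k + 1)) := by ring
      push_cast
      nlinarith
    · have hsym : ⟪H (w k), e⟫ = ⟪w k, H e⟫ := h.symm (w k) e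
      have e3 : ⟪w (k + 1), e⟫ = g * ⟪w k, e⟫ - η * ⟪u k, e⟫ := by
        rw [e1, inner_sub_left, inner_sub_left, inner_smul_left, inner_smul_left, hsym, h.eigen,
          inner_smul_right]
        simp only [conj_trivial, hg]
        ring
      have h4 : ⟪u k, e⟫ ≤ ‖u k‖ := by
        have := real_inner_le_norm (u k) e
        rwa [h.norm_e, mul_one] at this
      have h5 : η * ⟪u k, e⟫ ≤ η * ‖u k‖ := mul_le_mul_of_nonneg_left h4 hη.le
      have h6 : g * ((1 - k * (η * κ)) * (r₀ * g ^ k)) ≤ g * ⟪w k, e⟫ :=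
        mul_le_mul_of_nonneg_left ih2 (by linarith)
      have e4 : g * ((1 - k * (η * κ)) * (r₀ * g ^ k))
          = (1 - k * (η * κ)) * (r₀ * g ^ (k + 1)) := by ring
      rw [e3]
      push_cast
      nlinarith

/-- The energy estimate: the quadratic form `⟪H w, w⟫` pays for the squared step lengths. -/
theorem sum_sq_le (h : QuadraticModel H e γ L η) (hw0 : w 0 = r₀ • e)
    (hw : ∀ k < n, w (k + 1) = w k - η • (H (w k) + u k)) :
    ∑ k ∈ Finset.range n, ‖w (k + 1) - w k‖ ^ 2
      ≤ η * γ * ‖w n‖ ^ 2 + 2 * η ^ 2 * ∑ k ∈ Finset.range n, ‖u k‖ ^ 2 := by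
  have hη := h.η_pos
  have hγ := h.γ_pos
  have key : ∀ m ≤ n, ∑ k ∈ Finset.range m, ‖w (k + 1) - w k‖ ^ 2
      ≤ -η * ⟪H (w m), w m⟫ + 2 * η ^ 2 * ∑ k ∈ Finset.range m, ‖u k‖ ^ 2 := by
    intro m hm
    induction m with
    | zero =>
      rw [hw0, map_smul, h.eigen, inner_smul_left, inner_smul_right, inner_smul_left,
        real_inner_self_eq_norm_sq, h.norm_e]
      simp only [Finset.range_zero, Finset.sum_empty, mul_zero, conj_trivial, one_pow, mul_one,
        add_zero]
      have : 0 ≤ η * γ * r₀ ^ 2 := by positivity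
      nlinarith
    | succ m ih =>
      rw [Finset.sum_range_succ, Finset.sum_range_succ]
      have ih' := ih (by omega)
      set D := w (m + 1) - w m with hD
      have e0 : w (m + 1) = w m + D := by rw [hD]; abel
      have e1 : D = -(η • (H (w m) + u m)) := by rw [hD, hw m (by omega)]; abel
      have hsym : ⟪H D, w m⟫ = ⟪H (w m), D⟫ := by
        have : ⟪H D, w m⟫ = ⟪D, H (w m)⟫ := h.symm D (w m)
        rw [this, real_inner_comm]
      have e2 : ⟪H (w (m + 1)), w (m + 1)⟫
          = ⟪H (w m), w m⟫ + 2 * ⟪H (w m), D⟫ + ⟪H D, D⟫ := by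
        rw [e0, map_add, inner_add_left, inner_add_right, inner_add_right, hsym]; ring
      have e3 : ‖D‖ ^ 2 = -η * ⟪H (w m), D⟫ - η * ⟪u m, D⟫ := by
        have e4 : ⟪D, D⟫ = ⟪-(η • (H (w m) + u m)), D⟫ := by rw [← e1]
        rw [← real_inner_self_eq_norm_sq, e4, inner_neg_left, inner_smul_left, inner_add_left]
        simp only [conj_trivial]
        ring
      have h1 := mul_le_mul_of_nonneg_left (h.inner_le D) hη.le
      have h2 : η * (L * ‖D‖ ^ 2) ≤ 1 / 10 * ‖D‖ ^ 2 := by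
        rw [← mul_assoc]; exact mul_le_mul_of_nonneg_right h.step_le (sq_nonneg _)
      have h3 := (abs_le.mp (abs_real_inner_le_norm (u m) D)).1
      have h4 : η * (‖u m‖ * ‖D‖) ≤ η ^ 2 * ‖u m‖ ^ 2 + 1 / 4 * ‖D‖ ^ 2 := by
        nlinarith [sq_nonneg (η * ‖u m‖ - 1 / 2 * ‖D‖)]
      have h5 := mul_le_mul_of_nonneg_left h3 hη.le
      rw [e2]
      nlinarith [sq_nonneg ‖D‖]
  have h1 := key n le_rfl
  have h2 := mul_le_mul_of_nonneg_left (h.lower (w n)) hη.le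
  nlinarith

end QuadraticModel

end Quadratic

/-! ### Two coupled escape phases -/

section Coupling

variable {d : ℕ} {Ξ : Type*} {f : Vec d → Ξ → ℝ} {a : Params}

theorem path_congr {s : State d} {p : Vec d} {ω ω' : ℕ → Draw d Ξ} {k : ℕ}
    (h : ∀ i ≤ k, (ω i).1 = (ω' i).1) : path f a s p ω k = path f a s p ω' k := by
  induction k with
  | zero => simp [path, h 0 le_rfl]
  | succ k ih =>
    simp only [path]
    rw [ih fun i hi => h i (by omega), h (k + 1) le_rfl]

/-- The path of an unbroken escape phase stays close to its starting point. -/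
theorem Stuck.norm_sub_le {s : State d} {p : Vec d} {ω : ℕ → Draw d Ξ} (hη : 0 ≤ a.ηH)
    (hD : 0 ≤ a.Dbar) (h : Stuck f a s p ω) {k : ℕ} (hk : k ≤ a.T) :
    ‖(path f a s p ω k).1 - p‖ ≤ (a.T + 1) * Real.sqrt a.Dbar := by
  have h1 : ∀ m, ‖(path f a s p ω m).1 - p‖
      ≤ ∑ i ∈ Finset.range m, a.ηH * ‖(path f a s p ω i).2‖ := by
    intro m
    induction m with
    | zero => simp [path]
    | succ m ih =>
      rw [Finset.sum_range_succ]
      have e : (path f a s p ω (m + 1)).1 - p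
          = ((path f a s p ω m).1 - p) - a.ηH • (path f a s p ω m).2 := by
        simp only [path]; abel
      rw [e]
      refine (_root_.norm_sub_le _ _).trans (add_le_add ih ?_)
      rw [norm_smul, Real.norm_of_nonneg hη]
  refine (h1 k).trans ?_
  have h2 : (∑ i ∈ Finset.range k, a.ηH * ‖(path f a s p ω i).2‖) ^ 2
      ≤ k * movement f a s p ω k := by
    have := sq_sum_le_card_mul_sum_sq (s := Finset.range k)
      (f := fun i => a.ηH * ‖(path f a s p ω i).2‖)
    simpa [movement, mul_pow] using this
  have hkT : (k : ℝ) ≤ a.T := by exact_mod_cast hk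
  have h3 : (k : ℝ) * movement f a s p ω k ≤ ((a.T + 1) * Real.sqrt a.Dbar) ^ 2 := by
    rw [mul_pow, Real.sq_sqrt hD]
    have h4 := mul_le_mul_of_nonneg_left (h k hk) (Nat.cast_nonneg (α := ℝ) k)
    have h5 : (k : ℝ) * (k + 1) ≤ (a.T + 1) ^ 2 := by
      have : (0 : ℝ) ≤ k := Nat.cast_nonneg k
      nlinarith
    nlinarith [mul_le_mul_of_nonneg_right h5 hD]
  exact abs_le_of_sq_le_sq' (h2.trans h3) (by positivity) |>.2

/-- The difference of the estimation errors of two escape phases that use the same samples. -/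
def errorGap (F : Vec d → ℝ) (f : Vec d → Ξ → ℝ) (a : Params) (s : State d) (p p' : Vec d)
    (ω : ℕ → Draw d Ξ) (k : ℕ) : Vec d :=
  ((path f a s p' ω k).2 - gradient F (path f a s p' ω k).1)
    - ((path f a s p ω k).2 - gradient F (path f a s p ω k).1)

/-- Distance of the two coupled iterates from the point at which the escape phase began. -/
def spread (f : Vec d → Ξ → ℝ) (a : Params) (s : State d) (p p' : Vec d)
    (ω : ℕ → Draw d Ξ) (k : ℕ) : ℝ :=
  max ‖(path f a s p ω k).1 - s.x‖ ‖(path f a s p' ω k).1 - s.x‖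

/-- The difference of the iterates of the two coupled phases. -/
def gap (f : Vec d → Ξ → ℝ) (a : Params) (s : State d) (p p' : Vec d)
    (ω : ℕ → Draw d Ξ) (k : ℕ) : Vec d :=
  (path f a s p' ω k).1 - (path f a s p ω k).1

/-- A bound for the mixed second difference of the stochastic gradient in one step of the two
coupled phases. -/
def mixedDiff (f : Vec d → Ξ → ℝ) (a : Params) (L ρ : ℝ) (s : State d) (p p' : Vec d)
    (ω : ℕ → Draw d Ξ) (k : ℕ) : ℝ :=
  L * ‖gap f a s p p' ω (k + 1) - gap f a s p p' ω k‖
    + ρ * (spread f a s p p' ω k * ‖gap f a s p p' ω k‖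
      + spread f a s p p' ω (k + 1) * ‖gap f a s p p' ω (k + 1)‖)

/-- The accumulated variance proxy of `errorGap`; it starts anew at each restart of the
estimator. -/
def varProxy (f : Vec d → Ξ → ℝ) (a : Params) (L ρ : ℝ) (s : State d) (p p' : Vec d)
    (ω : ℕ → Draw d Ξ) : ℕ → ℝ
  | 0 => 4 * (L * ‖gap f a s p p' ω 0‖) ^ 2 / a.b
  | k + 1 =>
      if (s.t + 1 + k) % a.q = 0 then 4 * (L * ‖gap f a s p p' ω (k + 1)‖) ^ 2 / a.b
      else varProxy f a L ρ s p p' ω k + 4 * mixedDiff f a L ρ s p p' ω k ^ 2 / a.b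

theorem sub_smul_sub_eq {E : Type*} [AddCommGroup E] [Module ℝ E] (η : ℝ) (x x' g g' y y' h : E) :
    x' - η • g' - (x - η • g)
      = x' - x - η • (h + ((y' - y - h) + ((g' - y') - (g - y)))) := by
  module

/-- The gap follows the linear recursion of the Hessian `H`, disturbed by the nonlinearity of the
gradient and by the difference of the errors. -/
theorem gap_succ (F : Vec d → ℝ) (H : Vec d →L[ℝ] Vec d) (s : State d) (p p' : Vec d)
    (ω : ℕ → Draw d Ξ) (k : ℕ) :
    gap f a s p p' ω (k + 1) = gap f a s p p' ω k - a.ηH • (H (gap f a s p p' ω k)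
      + ((gradient F (path f a s p' ω k).1 - gradient F (path f a s p ω k).1
        - H (gap f a s p p' ω k)) + errorGap F f a s p p' ω k)) := by
  exact sub_smul_sub_eq _ _ _ _ _ _ _ _

/-- The numerical conditions for the coupling argument: the iterates stay within `R` of a point
where the least curvature is `-γ`, and the error difference is at most `κ₁` relative to the growth
of the gap. -/
structure CouplingConditions (a : Params) (L ρ R κ₁ : ℝ) : Prop where
  ρ_nonneg : 0 ≤ ρ
  L_pos : 0 < L
  κ₁_nonneg : 0 ≤ κ₁
  R_nonneg : 0 ≤ R
  b_pos : 0 < a.b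
  one_le_T : 1 ≤ a.T
  drift : a.T * (a.ηH * (2 * (ρ * R) + κ₁)) ≤ 1 / 2
  variance : 16 * a.T * (ρ * R) ^ 2 ≤ L ^ 2

/-- If two coupled escape phases stay within `R` of their origin, and the difference of their
estimation errors obeys the bound that its variance proxy suggests, then the difference of
their iterates grows exponentially. -/
theorem gap_growth {F : Vec d → ℝ} {L ρ R κ₁ γ r₀ : ℝ} {s : State d} {p : Vec d} {e : Vec d}
    {ω : ℕ → Draw d Ξ} (hc : CouplingConditions a L ρ R κ₁)
    (hG : ∀ x, HasFDerivAt (gradient F) (hess F x) x)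
    (hH : ∀ x y, ‖hess F x - hess F y‖ ≤ ρ * ‖x - y‖)
    (hq : QuadraticModel (hess F s.x) e γ L a.ηH) (hr₀ : 0 ≤ r₀)
    (hR : ∀ k ≤ a.T, spread f a s p (p + r₀ • e) ω k ≤ R)
    (hν : ∀ k ≤ a.T, varProxy f a L ρ s p (p + r₀ • e) ω k
        ≤ 32 * L ^ 2 / a.b * (r₀ * (1 + a.ηH * γ) ^ k) ^ 2 →
      ‖errorGap F f a s p (p + r₀ • e) ω k‖ ≤ κ₁ * (r₀ * (1 + a.ηH * γ) ^ k)) :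
    1 / 2 * (r₀ * (1 + a.ηH * γ) ^ a.T) ≤ ‖gap f a s p (p + r₀ • e) ω a.T‖ := by
  have hη := hq.η_pos
  have hγ := hq.γ_pos
  have hb : (0 : ℝ) < a.b := by exact_mod_cast hc.b_pos
  set p' := p + r₀ • e with hp'
  set g := 1 + a.ηH * γ with hg
  have hg1 : 1 ≤ g := by
    have : 0 ≤ a.ηH * γ := by positivity
    linarith
  set w := gap f a s p p' ω with hw
  set u : ℕ → Vec d := fun k => (gradient F (path f a s p' ω k).1
    - gradient F (path f a s p ω k).1 - hess F s.x (w k)) + errorGap F f a s p p' ω k with hu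
  set κ := 2 * (ρ * R) + κ₁ with hκdef
  have hρR : 0 ≤ ρ * R := mul_nonneg hc.ρ_nonneg hc.R_nonneg
  have hκ : 0 ≤ κ := by have := hc.κ₁_nonneg; positivity
  have hw0 : w 0 = r₀ • e := by simp [hw, gap, path, hp']
  have hwk : ∀ k, w (k + 1) = w k - a.ηH • (hess F s.x (w k) + u k) := fun k =>
    gap_succ F (hess F s.x) s p p' ω k
  have hmono : ∀ {i j : ℕ}, i ≤ j → r₀ * g ^ i ≤ r₀ * g ^ j := fun hij =>
    mul_le_mul_of_nonneg_left (pow_le_pow_right₀ hg1 hij) hr₀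
  have hpos : ∀ i : ℕ, 0 ≤ r₀ * g ^ i := fun i => by positivity
  have hlin : ∀ k : ℕ, k ≤ a.T → (k : ℝ) * (a.ηH * κ) ≤ 1 / 2 := by
    intro k hk
    have hk' : (k : ℝ) ≤ a.T := by exact_mod_cast hk
    exact (mul_le_mul_of_nonneg_right hk' (by positivity)).trans hc.drift
  have hbound : ∀ n ≤ a.T, (∀ i < n, ‖u i‖ ≤ κ * (r₀ * g ^ i)) →
      ∀ k ≤ n, ‖w k‖ ≤ 2 * (r₀ * g ^ k) := by
    intro n hn hui k hk
    have h1 := (hq.growth hw0 hr₀ hκ (fun k _ => hwk k) hui k hk).1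
    have h2 := hlin k (hk.trans hn)
    nlinarith [hpos k]
  -- Induction in time: if all earlier disturbances are small, then so are the gap, its accumulated
  -- squared movement, the variance proxy, and therefore the present disturbance.
  have hall : ∀ n ≤ a.T, ∀ i < n, ‖u i‖ ≤ κ * (r₀ * g ^ i) := by
    intro n
    induction n with
    | zero => intro _ i hi; omega
    | succ n ih =>
      intro hn i hi
      have ihn := ih (by omega)
      rcases Nat.lt_succ_iff_lt_or_eq.mp hi with hi' | rfl
      · exact ihn i hi'
      · have hwb := hbound i (by omega) ihn
        set S := (r₀ * g ^ i) ^ 2 with hS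
        have hS0 : 0 ≤ S := sq_nonneg _
        have hsumu : ∑ k ∈ Finset.range i, ‖u k‖ ^ 2 ≤ i * (κ ^ 2 * S) := by
          have : ∀ k ∈ Finset.range i, ‖u k‖ ^ 2 ≤ κ ^ 2 * S := by
            intro k hk
            have hk' := Finset.mem_range.mp hk
            rw [hS, ← mul_pow]
            exact pow_le_pow_left₀ (norm_nonneg _)
              ((ihn k hk').trans (mul_le_mul_of_nonneg_left (hmono hk'.le) hκ)) 2
          simpa using Finset.sum_le_card_nsmul _ _ _ this
        have hen := hq.sum_sq_le (n := i) hw0 (fun k _ => hwk k)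
        have hwi : ‖w i‖ ^ 2 ≤ 4 * S := by
          have := pow_le_pow_left₀ (norm_nonneg _) (hwb i le_rfl) 2
          rw [mul_pow] at this
          linarith
        have hD : ∑ k ∈ Finset.range i, ‖w (k + 1) - w k‖ ^ 2 ≤ S := by
          have h1 : a.ηH * γ ≤ 1 / 10 :=
            (mul_le_mul_of_nonneg_left hq.γ_le hη.le).trans hq.step_le
          have h2 : a.ηH * γ * ‖w i‖ ^ 2 ≤ 1 / 10 * (4 * S) :=
            mul_le_mul h1 hwi (sq_nonneg _) (by norm_num)
          have h3 : 2 * a.ηH ^ 2 * (i * (κ ^ 2 * S)) ≤ 1 / 2 * S := by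
            have h4 := hlin i (by omega)
            have h5 := hlin 1 hc.one_le_T
            have e : 2 * a.ηH ^ 2 * (i * (κ ^ 2 * S))
              = 2 * ((i * (a.ηH * κ)) * ((1 : ℕ) * (a.ηH * κ))) * S := by push_cast; ring
            rw [e]
            refine mul_le_mul_of_nonneg_right ?_ hS0
            have h6 : (i * (a.ηH * κ)) * ((1 : ℕ) * (a.ηH * κ)) ≤ 1 / 2 * (1 / 2) :=
              mul_le_mul h4 h5 (by positivity) (by norm_num)
            linarith
          have h7 : 2 * a.ηH ^ 2 * ∑ k ∈ Finset.range i, ‖u k‖ ^ 2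
              ≤ 2 * a.ηH ^ 2 * (i * (κ ^ 2 * S)) :=
            mul_le_mul_of_nonneg_left hsumu (by positivity)
          linarith
        have hmix : ∀ k < i, mixedDiff f a L ρ s p p' ω k ^ 2
            ≤ 2 * L ^ 2 * ‖w (k + 1) - w k‖ ^ 2 + 32 * (ρ * R) ^ 2 * S := by
          intro k hk
          have hk1 := (hwb k hk.le).trans (mul_le_mul_of_nonneg_left (hmono hk.le) zero_le_two)
          have hk2 := (hwb (k + 1) hk).trans (mul_le_mul_of_nonneg_left (hmono hk) zero_le_two)
          have hm1 : mixedDiff f a L ρ s p p' ω k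
              ≤ L * ‖w (k + 1) - w k‖ + (ρ * R) * (4 * (r₀ * g ^ i)) := by
            unfold mixedDiff
            have e1 : spread f a s p p' ω k * ‖w k‖ ≤ R * (2 * (r₀ * g ^ i)) :=
              mul_le_mul (hR k (by omega)) hk1 (norm_nonneg _) hc.R_nonneg
            have e2 : spread f a s p p' ω (k + 1) * ‖w (k + 1)‖ ≤ R * (2 * (r₀ * g ^ i)) :=
              mul_le_mul (hR (k + 1) (by omega)) hk2 (norm_nonneg _) hc.R_nonneg
            have := mul_le_mul_of_nonneg_left (add_le_add e1 e2) hc.ρ_nonneg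
            linarith
          have hm0 : 0 ≤ mixedDiff f a L ρ s p p' ω k := by
            have := hc.ρ_nonneg
            have := hc.L_pos
            unfold mixedDiff spread
            positivity
          have hm2 := pow_le_pow_left₀ hm0 hm1 2
          have hm3 := add_sq_le (a := L * ‖w (k + 1) - w k‖) (b := (ρ * R) * (4 * (r₀ * g ^ i)))
          rw [hS]
          nlinarith
        -- A restart contributes the term of the current gap instead of the accumulated ones; both
        -- are covered by the same bound.
        have hrestart : ∀ j ≤ i, 4 * (L * ‖w j‖) ^ 2 / a.b ≤ 4 / a.b * (4 * L ^ 2 * S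
            + ∑ k ∈ Finset.range j, mixedDiff f a L ρ s p p' ω k ^ 2) := by
          intro j hj
          have h1 := pow_le_pow_left₀ (norm_nonneg _)
            ((hwb j hj).trans (mul_le_mul_of_nonneg_left (hmono hj) zero_le_two)) 2
          have h2 : (L * ‖w j‖) ^ 2 ≤ 4 * L ^ 2 * S := by
            rw [mul_pow, hS]
            nlinarith [sq_nonneg L]
          have h3 : 0 ≤ ∑ k ∈ Finset.range j, mixedDiff f a L ρ s p p' ω k ^ 2 :=
            Finset.sum_nonneg fun _ _ => sq_nonneg _
          rw [div_mul_eq_mul_div]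
          exact div_le_div_of_nonneg_right (by linarith) hb.le
        have hV : ∀ j ≤ i, varProxy f a L ρ s p p' ω j ≤ 4 / a.b * (4 * L ^ 2 * S
            + ∑ k ∈ Finset.range j, mixedDiff f a L ρ s p p' ω k ^ 2) := by
          intro j hj
          have hbase : 4 * (L * ‖w j‖) ^ 2 / a.b ≤ 4 / a.b * (4 * L ^ 2 * S
            + ∑ k ∈ Finset.range j, mixedDiff f a L ρ s p p' ω k ^ 2) := hrestart j hj
          induction j with
          | zero => exact hbase
          | succ j ihj =>
            rw [varProxy]
            split_ifs with hck
            · exact hbase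
            · have hj' := ihj (by omega) (hrestart j (by omega))
              rw [Finset.sum_range_succ, ← add_assoc, mul_add (4 / (a.b : ℝ)),
                div_mul_eq_mul_div 4 (a.b : ℝ) (mixedDiff f a L ρ s p p' ω j ^ 2)]
              linarith
        have hVi : varProxy f a L ρ s p p' ω i ≤ 32 * L ^ 2 / a.b * (r₀ * g ^ i) ^ 2 := by
          refine (hV i le_rfl).trans ?_
          have h1 : ∑ k ∈ Finset.range i, mixedDiff f a L ρ s p p' ω k ^ 2
              ≤ 2 * L ^ 2 * S + i * (32 * (ρ * R) ^ 2 * S) := by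
            refine (Finset.sum_le_sum fun k hk => hmix k (Finset.mem_range.mp hk)).trans ?_
            rw [Finset.sum_add_distrib, ← Finset.mul_sum, Finset.sum_const, Finset.card_range,
              nsmul_eq_mul]
            have := mul_le_mul_of_nonneg_left hD (by positivity : (0 : ℝ) ≤ 2 * L ^ 2)
            linarith
          have h2 : i * (32 * (ρ * R) ^ 2 * S) ≤ 2 * L ^ 2 * S := by
            have hiT : (i : ℝ) ≤ a.T := by exact_mod_cast (by omega : i ≤ a.T)
            have h3 : (i : ℝ) * (32 * (ρ * R) ^ 2) ≤ 2 * L ^ 2 := by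
              have := mul_le_mul_of_nonneg_right hiT
                (by positivity : (0 : ℝ) ≤ 32 * (ρ * R) ^ 2)
              have := hc.variance
              linarith
            nlinarith
          have h4 : 4 / (a.b : ℝ) * (4 * L ^ 2 * S
              + ∑ k ∈ Finset.range i, mixedDiff f a L ρ s p p' ω k ^ 2)
              ≤ 4 / (a.b : ℝ) * (8 * L ^ 2 * S) :=
            mul_le_mul_of_nonneg_left (by linarith) (by positivity)
          refine h4.trans (le_of_eq ?_)
          ring
        have hνi := hν i (by omega) hVi
        have hRi := hR i (by omega)
        have hlinr := norm_sub_sub_hess_le hc.ρ_nonneg hG hH s.x (path f a s p ω i).1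
          (path f a s p' ω i).1 ((le_max_left _ _).trans hRi) ((le_max_right _ _).trans hRi)
        have h1 : ‖u i‖ ≤ ρ * R * ‖w i‖ + κ₁ * (r₀ * g ^ i) :=
          (norm_add_le _ _).trans (add_le_add hlinr hνi)
        have h2 := mul_le_mul_of_nonneg_left (hwb i le_rfl) hρR
        rw [hκdef]
        linarith
  have hfin := (hq.growth hw0 hr₀ hκ (fun k _ => hwk k) (hall a.T le_rfl) a.T le_rfl).2
  have h1 := hlin a.T le_rfl
  have h2 := real_inner_le_norm (w a.T) e
  rw [hq.norm_e, mul_one] at h2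
  nlinarith [hpos a.T]

end Coupling

/-! ### Concentration of the difference of two coupled errors -/

section CoupledErrors

variable {d : ℕ} {Ξ : Type*} [MeasurableSpace Ξ] {P : Measure Ξ} [IsProbabilityMeasure P]
  {f : Vec d → Ξ → ℝ} {a : Params} {x₁ : Vec d} {L ρ σ Δ : ℝ}

/-- The mixed second difference of a stochastic gradient, for pairs of points close to `x`. -/
theorem Assumptions.norm_mixed_le (h : Assumptions P f x₁ L ρ σ Δ) (hL : 0 ≤ L) (hρ : 0 ≤ ρ)
    (x y y' z z' : Vec d) (ξ : Ξ) :
    ‖(sgrad f z' ξ - sgrad f y' ξ) - (sgrad f z ξ - sgrad f y ξ)‖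
      ≤ L * ‖(z' - z) - (y' - y)‖ + ρ * (max ‖y - x‖ ‖y' - x‖ * ‖y' - y‖
        + max ‖z - x‖ ‖z' - x‖ * ‖z' - z‖) := by
  set H := hess (fun w => f w ξ) x with hH
  have h1 := norm_sub_sub_hess_le hρ (fun w => h.hasFDerivAt_sgrad w ξ) (h.hessLipschitz ξ) x y y'
    (le_max_left _ _) (le_max_right _ _)
  have h2 := norm_sub_sub_hess_le hρ (fun w => h.hasFDerivAt_sgrad w ξ) (h.hessLipschitz ξ) x z z'
    (le_max_left _ _) (le_max_right _ _)
  have h3 : ‖H ((z' - z) - (y' - y))‖ ≤ L * ‖(z' - z) - (y' - y)‖ :=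
    (H.le_opNorm _).trans
      (mul_le_mul_of_nonneg_right (norm_hess_le hL (h.smooth ξ) x) (norm_nonneg _))
  have e : (sgrad f z' ξ - sgrad f y' ξ) - (sgrad f z ξ - sgrad f y ξ)
      = H ((z' - z) - (y' - y)) + ((sgrad f z' ξ - sgrad f z ξ - H (z' - z))
        - (sgrad f y' ξ - sgrad f y ξ - H (y' - y))) := by
    rw [map_sub]; abel
  rw [e]
  refine (norm_add_le _ _).trans ?_
  have h4 := norm_sub_le (sgrad f z' ξ - sgrad f z ξ - H (z' - z))
    (sgrad f y' ξ - sgrad f y ξ - H (y' - y))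
  linarith

/-- Exponential moment of the difference of the errors of two estimates made from the same
samples, given the past. -/
theorem lintegral_cosh_spider_sub_le (h : Assumptions P f x₁ L ρ σ Δ) (hσ : 0 ≤ σ) (hL : 0 ≤ L)
    (hb : 0 < a.b) (hBb : a.b ≤ a.B) (l : ℝ) (t : ℕ) (g g' y y' z z' : Vec d) {c : ℝ}
    (hc : ∀ ξ, ‖(sgrad f z' ξ - sgrad f y' ξ) - (sgrad f z ξ - sgrad f y ξ)‖ ≤ c) :
    ∫⁻ s, ENNReal.ofReal (Real.cosh (l * ‖(spider f a t g' y' z' s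
          - gradient (objective P f) z') - (spider f a t g y z s
          - gradient (objective P f) z)‖)) ∂(Measure.infinitePi fun _ : ℕ => P)
      ≤ ENNReal.ofReal (if t % a.q = 0 then
          Real.exp (l ^ 2 * (4 * (L * ‖z' - z‖) ^ 2 / a.b) / 2)
        else Real.cosh (l * ‖(g' - gradient (objective P f) y')
            - (g - gradient (objective P f) y)‖) *
          Real.exp (l ^ 2 * (4 * c ^ 2 / a.b) / 2)) := by
  have hgx := h.gradient_objective hσ hL
  have hb' : (0 : ℝ) < a.b := by exact_mod_cast hb
  have hms := h.measurable_sgrad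
  have hin := h.integrable_sgrad hσ
  unfold spider
  split_ifs with ht
  · have hB : 0 < a.B := hb.trans_le hBb
    have := lintegral_cosh_mean_le (P := P) (ψ := fun ξ => sgrad f z' ξ - sgrad f z ξ)
      (c := 2 * L * ‖z' - z‖)
      (μ := gradient (objective P f) z' - gradient (objective P f) z)
      ((hms z').sub (hms z))
      (by rw [integral_sub (hin z') (hin z), hgx, hgx])
      (fun ξ => (norm_sub_le _ _).trans (by
        have h1 := h.smooth ξ z' z
        have h2 := h.norm_gradient_sub_le hσ hL z' z
        linarith)) l 0 hB
    refine le_trans (le_of_eq (lintegral_congr fun s => ?_))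
      (this.trans (ENNReal.ofReal_le_ofReal ?_))
    · congr 4
      rw [Finset.sum_sub_distrib, smul_sub]
      abel
    · rw [norm_zero, mul_zero, Real.cosh_zero, one_mul]
      refine Real.exp_le_exp.mpr ?_
      have hBb' : (a.b : ℝ) ≤ a.B := by exact_mod_cast hBb
      have e : l ^ 2 * (4 * (L * ‖z' - z‖) ^ 2 / a.b) / 2
          = l ^ 2 * (2 * L * ‖z' - z‖) ^ 2 / (2 * a.b) := by field_simp; ring
      rw [e]
      exact div_le_div_of_nonneg_left (by positivity) (by positivity) (by linarith)
  · have hμ : ∫ ξ, ((sgrad f z' ξ - sgrad f y' ξ) - (sgrad f z ξ - sgrad f y ξ)) ∂P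
        = (gradient (objective P f) z' - gradient (objective P f) y')
          - (gradient (objective P f) z - gradient (objective P f) y) := by
      have e := integral_sub ((hin z').sub (hin y')) ((hin z).sub (hin y))
      simp only [Pi.sub_apply] at e
      rw [e, integral_sub (hin z') (hin y'),
        integral_sub (hin z) (hin y), hgx, hgx, hgx, hgx]
    have hμc : ‖(gradient (objective P f) z' - gradient (objective P f) y')
          - (gradient (objective P f) z - gradient (objective P f) y)‖ ≤ c := by
      rw [← hμ]
      refine (norm_integral_le_of_norm_le_const (Eventually.of_forall hc)).trans ?_
      simp
    have := lintegral_cosh_mean_le (P := P)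
      (ψ := fun ξ => (sgrad f z' ξ - sgrad f y' ξ) - (sgrad f z ξ - sgrad f y ξ)) (c := 2 * c)
      (((hms z').sub (hms y')).sub ((hms z).sub (hms y))) hμ
      (fun ξ => (norm_sub_le _ _).trans (by linarith [hc ξ])) l
      ((g' - gradient (objective P f) y') - (g - gradient (objective P f) y)) hb
    refine le_trans (le_of_eq (lintegral_congr fun s => ?_)) (this.trans_eq ?_)
    · congr 4
      rw [Finset.sum_sub_distrib (fun i => sgrad f z' (s i) - sgrad f y' (s i)), smul_sub]
      abel
    · congr 3
      field_simp
      ring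

/-- The weighted exponential moment of the difference of the errors of two coupled escape
phases. -/
def gapPotential (F : Vec d → ℝ) (f : Vec d → Ξ → ℝ) (a : Params) (L ρ l : ℝ) (s : State d)
    (p p' : Vec d) (ω : ℕ → Draw d Ξ) (k : ℕ) : ENNReal :=
  ENNReal.ofReal (Real.cosh (l * ‖errorGap F f a s p p' ω k‖)) *
    ENNReal.ofReal (Real.exp (-(l ^ 2 * varProxy f a L ρ s p p' ω k / 2)))

omit [MeasurableSpace Ξ] in
theorem path_fst_succ_congr {s : State d} {p : Vec d} {ω ω' : ℕ → Draw d Ξ} {k : ℕ}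
    (h : ∀ i ≤ k, (ω i).1 = (ω' i).1) :
    (path f a s p ω (k + 1)).1 = (path f a s p ω' (k + 1)).1 := by
  simp only [path]
  rw [path_congr h]

omit [MeasurableSpace Ξ] in
/-- The variance proxy is predictable: at time `k + 1` it depends on the samples up to time `k`. -/
theorem varProxy_succ_congr {s : State d} {p p' : Vec d} {ω ω' : ℕ → Draw d Ξ} {k : ℕ}
    (h : ∀ i ≤ k, (ω i).1 = (ω' i).1) :
    varProxy f a L ρ s p p' ω (k + 1) = varProxy f a L ρ s p p' ω' (k + 1) := by
  have hg : ∀ j ≤ k + 1, gap f a s p p' ω j = gap f a s p p' ω' j := by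
    intro j hj
    unfold gap
    rcases j with _ | j
    · simp [path]
    · rw [path_fst_succ_congr fun i hi => h i (by omega),
        path_fst_succ_congr fun i hi => h i (by omega)]
  have hs : ∀ j ≤ k + 1, spread f a s p p' ω j = spread f a s p p' ω' j := by
    intro j hj
    unfold spread
    rcases j with _ | j
    · simp [path]
    · rw [path_fst_succ_congr fun i hi => h i (by omega),
        path_fst_succ_congr fun i hi => h i (by omega)]
  have hv : ∀ j ≤ k + 1, varProxy f a L ρ s p p' ω j = varProxy f a L ρ s p p' ω' j := by
    intro j
    induction j with
    | zero => intro _; simp only [varProxy]; rw [hg 0 (by omega)]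
    | succ j ih =>
      intro hj
      simp only [varProxy, mixedDiff]
      rw [ih (by omega), hg (j + 1) hj, hg j (by omega), hs j (by omega), hs (j + 1) hj]
  exact hv (k + 1) le_rfl

/-- The variance proxy compensates the growth of the exponential moment in each step. -/
theorem lintegral_gapPotential_le (h : Assumptions P f x₁ L ρ σ Δ) (hσ : 0 ≤ σ) (hL : 0 ≤ L)
    (hρ : 0 ≤ ρ) (hb : 0 < a.b) (hBb : a.b ≤ a.B) (l : ℝ) (s : State d) (p p' : Vec d) (k : ℕ) :
    ∫⁻ ω, gapPotential (objective P f) f a L ρ l s p p' ω k ∂(drawLaw P d) ≤ 1 := by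
  have hcancel : ∀ v : ℝ, ENNReal.ofReal (Real.exp (l ^ 2 * v / 2))
      * ENNReal.ofReal (Real.exp (-(l ^ 2 * v / 2))) = 1 := by
    intro v
    rw [← ENNReal.ofReal_mul (Real.exp_pos _).le, ← Real.exp_add, add_neg_cancel, Real.exp_zero,
      ENNReal.ofReal_one]
  induction k with
  | zero =>
    refine (lintegral_infinitePi_le_update _ 0 _).trans ?_
    simp only [gapPotential, errorGap, path, varProxy, gap, Function.update_self, lintegral_const,
      measure_univ, mul_one]
    refine (lintegral_prod_le _).trans ?_
    simp only [lintegral_const, measure_univ, mul_one]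
    rw [lintegral_mul_const' _ _ ENNReal.ofReal_ne_top]
    have := lintegral_cosh_spider_sub_le h hσ hL hb hBb l s.t s.g s.g s.x s.x p p'
      (c := L * ‖p' - p‖) (fun ξ => by rw [sub_sub_sub_cancel_right]; exact h.smooth ξ p' p)
    refine (mul_le_mul_left this _).trans (le_of_eq ?_)
    rw [sub_self, norm_zero, mul_zero, Real.cosh_zero, one_mul, ite_self]
    exact hcancel _
  | succ k ih =>
    -- After a restart the conditional expectation is at most `1`, otherwise it is at most the
    -- previous value.
    refine (lintegral_infinitePi_le_update _ (k + 1) _).trans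
      (le_trans (lintegral_mono (g := fun ω => if (s.t + 1 + k) % a.q = 0 then 1
        else gapPotential (objective P f) f a L ρ l s p p' ω k) fun ω => ?_) ?_)
    swap
    · split_ifs
      · rw [lintegral_one]; exact prob_le_one
      · exact ih
    refine (lintegral_prod_le _).trans ?_
    have hup : ∀ (z : Draw d Ξ), ∀ i ≤ k, (Function.update ω (k + 1) z i).1 = (ω i).1 := by
      intro z i hi
      rw [Function.update_of_ne (by omega)]
    set y := (path f a s p ω k).1 with hy
    set y' := (path f a s p' ω k).1 with hy'
    set g := (path f a s p ω k).2 with hg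
    set g' := (path f a s p' ω k).2 with hg'
    have hpt : ∀ z : Draw d Ξ, gapPotential (objective P f) f a L ρ l s p p'
        (Function.update ω (k + 1) z) (k + 1)
        = ENNReal.ofReal (Real.cosh (l * ‖(spider f a (s.t + 1 + k) g' y' (y' - a.ηH • g') z.1
            - gradient (objective P f) (y' - a.ηH • g'))
            - (spider f a (s.t + 1 + k) g y (y - a.ηH • g) z.1
            - gradient (objective P f) (y - a.ηH • g))‖)) *
          ENNReal.ofReal (Real.exp (-(l ^ 2 * varProxy f a L ρ s p p' ω (k + 1) / 2))) := by
      intro z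
      unfold gapPotential
      rw [varProxy_succ_congr (hup z)]
      simp only [errorGap, path, Function.update_self]
      rw [path_congr (hup z), path_congr (hup z)]
    simp_rw [hpt]
    simp only [lintegral_const, measure_univ, mul_one]
    rw [lintegral_mul_const' _ _ ENNReal.ofReal_ne_top]
    have key := lintegral_cosh_spider_sub_le h hσ hL hb hBb l (s.t + 1 + k) g g' y y'
      (y - a.ηH • g) (y' - a.ηH • g') (c := mixedDiff f a L ρ s p p' ω k)
      (fun ξ => h.norm_mixed_le hL hρ s.x y y' _ _ ξ)
    refine (mul_le_mul_left key _).trans ?_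
    by_cases ht : (s.t + 1 + k) % a.q = 0
    · rw [if_pos ht, if_pos ht, varProxy, if_pos ht]
      have e1 : gap f a s p p' ω (k + 1) = y' - a.ηH • g' - (y - a.ηH • g) := rfl
      rw [e1, hcancel]
    · rw [if_neg ht, if_neg ht, varProxy, if_neg ht]
      unfold gapPotential errorGap
      rw [ENNReal.ofReal_mul (Real.cosh_pos _).le, mul_assoc]
      refine mul_le_mul_right (le_of_eq ?_) _
      rw [← ENNReal.ofReal_mul (Real.exp_pos _).le, ← Real.exp_add]
      congr 2
      ring

variable {Z : Type*} [MeasurableSpace Z]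

theorem measurable_path (hf : Measurable (Function.uncurry (sgrad f))) {s : Z → State d}
    {p : Z → Vec d} {ω : Z → ℕ → Draw d Ξ} (hs : Measurable s) (hp : Measurable p)
    (hω : Measurable ω) (k : ℕ) : Measurable fun z => path f a (s z) (p z) (ω z) k := by
  have ht : Measurable fun z => (s z).t := measurable_state_t.comp hs
  induction k with
  | zero =>
    exact hp.prodMk (measurable_spider hf ht (measurable_state_g.comp hs)
      (measurable_state_x.comp hs) hp hω.eval.fst)
  | succ k ih =>
    have hx := ih.fst.sub (ih.snd.const_smul a.ηH)
    exact hx.prodMk (measurable_spider hf ((ht.add_const 1).add_const k) ih.snd ih.fst hx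
      hω.eval.fst)

theorem measurableSet_stuck (hf : Measurable (Function.uncurry (sgrad f))) {s : Z → State d}
    {p : Z → Vec d} {ω : Z → ℕ → Draw d Ξ} (hs : Measurable s) (hp : Measurable p)
    (hω : Measurable ω) : MeasurableSet {z | Stuck f a (s z) (p z) (ω z)} := by
  have : {z | Stuck f a (s z) (p z) (ω z)}
      = ⋂ k, ⋂ (_ : k ≤ a.T), {z | movement f a (s z) (p z) (ω z) k ≤ (k + 1) * a.Dbar} := by
    ext z; simp [Stuck]
  rw [this]
  refine MeasurableSet.iInter fun k => MeasurableSet.iInter fun _ =>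
    measurableSet_le ?_ measurable_const
  unfold movement
  exact Finset.measurable_sum _ fun i _ =>
    (((measurable_path hf hs hp hω i).snd.norm).pow_const 2).const_mul _

theorem measurable_gapPotential {F : Vec d → ℝ} (hF : Continuous (gradient F))
    (hf : Measurable (Function.uncurry (sgrad f))) (l : ℝ) (s : State d) (p p' : Vec d) (k : ℕ) :
    Measurable fun ω : ℕ → Draw d Ξ => gapPotential F f a L ρ l s p p' ω k := by
  have hpath : ∀ p k, Measurable fun ω : ℕ → Draw d Ξ => path f a s p ω k :=
    fun p k => measurable_path hf measurable_const measurable_const measurable_id k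
  have hgap : ∀ k, Measurable fun ω : ℕ → Draw d Ξ => gap f a s p p' ω k :=
    fun k => (hpath p' k).fst.sub (hpath p k).fst
  have hspread : ∀ k, Measurable fun ω : ℕ → Draw d Ξ => spread f a s p p' ω k :=
    fun k => ((hpath p k).fst.sub_const _).norm.max ((hpath p' k).fst.sub_const _).norm
  have hmix : ∀ k, Measurable fun ω : ℕ → Draw d Ξ => mixedDiff f a L ρ s p p' ω k :=
    fun k => (((hgap (k + 1)).sub (hgap k)).norm.const_mul L).add
      ((((hspread k).mul (hgap k).norm).add ((hspread (k + 1)).mul (hgap (k + 1)).norm)).const_mul ρ)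
  have hvar : ∀ k, Measurable fun ω : ℕ → Draw d Ξ => varProxy f a L ρ s p p' ω k := by
    intro k
    induction k with
    | zero => exact ((((hgap 0).norm.const_mul L).pow_const 2).const_mul 4).div_const _
    | succ k ih =>
      simp only [varProxy]
      split_ifs
      · exact ((((hgap (k + 1)).norm.const_mul L).pow_const 2).const_mul 4).div_const _
      · exact ih.add ((((hmix k).pow_const 2).const_mul 4).div_const _)
  have herr : Measurable fun ω : ℕ → Draw d Ξ => errorGap F f a s p p' ω k :=
    ((hpath p' k).snd.sub (hF.measurable.comp (hpath p' k).fst)).sub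
      ((hpath p k).snd.sub (hF.measurable.comp (hpath p k).fst))
  exact (ENNReal.measurable_ofReal.comp (Real.measurable_cosh.comp (herr.norm.const_mul l))).mul
    (ENNReal.measurable_ofReal.comp (Real.measurable_exp.comp
      (((hvar k).const_mul (l ^ 2)).div_const 2).neg))

/-- At a given time, the difference of the errors exceeds the bound suggested by its variance
proxy only with small probability. -/
theorem measure_errorGap_le (h : Assumptions P f x₁ L ρ σ Δ) (hσ : 0 ≤ σ) (hL : 0 ≤ L)
    (hρ : 0 ≤ ρ) (hb : 0 < a.b) (hBb : a.b ≤ a.B) (s : State d) (p p' : Vec d) (k : ℕ)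
    {ℓ V τ : ℝ} (hℓ : 0 ≤ ℓ) (hτ : 0 < τ) (hV : ℓ ^ 2 * V ≤ 2 * τ ^ 2) :
    drawLaw P d {ω | varProxy f a L ρ s p p' ω k ≤ V ∧ τ < ‖errorGap (objective P f) f a s p p' ω k‖}
      ≤ ENNReal.ofReal (2 * Real.exp 1 * Real.exp (-ℓ)) := by
  set l := ℓ / τ with hl
  have hl0 : 0 ≤ l := by positivity
  have hsub : {ω | varProxy f a L ρ s p p' ω k ≤ V ∧
      τ < ‖errorGap (objective P f) f a s p p' ω k‖}
      ⊆ {ω | ENNReal.ofReal (Real.exp ℓ / 2 * Real.exp (-1))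
        ≤ gapPotential (objective P f) f a L ρ l s p p' ω k} := by
    rintro ω ⟨h1, h2⟩
    rw [Set.mem_ofPred_eq, gapPotential, ← ENNReal.ofReal_mul (Real.cosh_pos _).le]
    refine ENNReal.ofReal_le_ofReal (mul_le_mul ?_ ?_ (Real.exp_pos _).le (Real.cosh_pos _).le)
    · have h3 : ℓ ≤ l * ‖errorGap (objective P f) f a s p p' ω k‖ := by
        have := mul_le_mul_of_nonneg_left h2.le hl0
        have e : l * τ = ℓ := by rw [hl]; field_simp
        rwa [e] at this
      rw [Real.cosh_eq]
      have := Real.exp_le_exp.mpr h3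
      have := Real.exp_pos (-(l * ‖errorGap (objective P f) f a s p p' ω k‖))
      linarith
    · refine Real.exp_le_exp.mpr (neg_le_neg ?_)
      have h3 : l ^ 2 * varProxy f a L ρ s p p' ω k ≤ l ^ 2 * V :=
        mul_le_mul_of_nonneg_left h1 (sq_nonneg l)
      have h4 : l ^ 2 * V ≤ 2 := by
        rw [hl, div_pow, div_mul_eq_mul_div, div_le_iff₀ (by positivity)]
        exact hV
      linarith
  refine (measure_mono hsub).trans ((meas_ge_le_lintegral_div
    (measurable_gapPotential (h.continuous_gradient hσ hL) h.measurable_uncurry_sgrad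
      l s p p' k).aemeasurable
    (by simpa using by positivity) ENNReal.ofReal_ne_top).trans ?_)
  refine (ENNReal.div_le_div_right (lintegral_gapPotential_le h hσ hL hρ hb hBb l s p p' k) _).trans
    ?_
  rw [← ENNReal.ofReal_one, ← ENNReal.ofReal_div_of_pos (by positivity)]
  refine ENNReal.ofReal_le_ofReal (le_of_eq ?_)
  rw [Real.exp_neg, Real.exp_neg]
  field_simp

/-- Two coupled escape phases, started at distance `r₀` along the direction of least curvature,
rarely stay both near their origin. -/
theorem measure_both_stuck_le (h : Assumptions P f x₁ L ρ σ Δ) (hσ : 0 ≤ σ)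
    (hBb : a.b ≤ a.B) {R κ₁ γ r₀ ℓ : ℝ} {s : State d} {p e : Vec d}
    (hc : CouplingConditions a L ρ R κ₁) (hκ₁ : 0 < κ₁)
    (hq : QuadraticModel (hess (objective P f) s.x) e γ L a.ηH) (hr₀ : 0 < r₀)
    (hD : 0 ≤ a.Dbar) (hp : ‖p - s.x‖ ≤ 2 * Real.sqrt a.Dbar)
    (hp' : ‖p + r₀ • e - s.x‖ ≤ 2 * Real.sqrt a.Dbar)
    (hR : (a.T + 3) * Real.sqrt a.Dbar ≤ R) (hℓ : 0 ≤ ℓ)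
    (hV : 16 * ℓ ^ 2 * L ^ 2 ≤ a.b * κ₁ ^ 2)
    (hT : 4 * R < r₀ * (1 + a.ηH * γ) ^ a.T) :
    drawLaw P d {ω | Stuck f a s p ω ∧ Stuck f a s (p + r₀ • e) ω}
      ≤ ENNReal.ofReal ((a.T + 1) * (2 * Real.exp 1 * Real.exp (-ℓ))) := by
  have hη := hq.η_pos
  have hγ := hq.γ_pos
  have hb : (0 : ℝ) < a.b := by exact_mod_cast hc.b_pos
  set g := 1 + a.ηH * γ with hg
  have hg0 : 0 < g := by positivity
  set p' := p + r₀ • e with hp'def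
  set V : ℕ → ℝ := fun k => 32 * L ^ 2 / a.b * (r₀ * g ^ k) ^ 2 with hVdef
  set τ : ℕ → ℝ := fun k => κ₁ * (r₀ * g ^ k) with hτdef
  have hsub : {ω | Stuck f a s p ω ∧ Stuck f a s p' ω}
      ⊆ ⋃ k ∈ Finset.range (a.T + 1), {ω | varProxy f a L ρ s p p' ω k ≤ V k ∧
        τ k < ‖errorGap (objective P f) f a s p p' ω k‖} := by
    rintro ω ⟨h1, h2⟩
    by_contra hnot
    simp only [Set.mem_iUnion, Finset.mem_range, not_exists, Set.mem_ofPred_eq, not_and,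
      not_lt] at hnot
    have hsp : ∀ k ≤ a.T, spread f a s p p' ω k ≤ R := by
      intro k hk
      have hclose : ∀ q : Vec d, Stuck f a s q ω → ‖q - s.x‖ ≤ 2 * Real.sqrt a.Dbar →
          ‖(path f a s q ω k).1 - s.x‖ ≤ R := by
        intro q hq1 hq2
        have h3 := hq1.norm_sub_le hη.le hD hk
        have h4 := norm_add_le ((path f a s q ω k).1 - q) (q - s.x)
        rw [sub_add_sub_cancel] at h4
        linarith
      exact max_le (hclose p h1 hp) (hclose p' h2 hp')
    have hgrow := gap_growth (F := objective P f) (f := f) (p := p) (ω := ω) hc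
      (fun x => by
        have := h.hasFDerivAt_gradient hσ hc.L_pos.le x
        rwa [← h.hess_objective hσ hc.L_pos.le] at this)
      (h.norm_hess_objective_sub_le hσ hc.L_pos.le) hq hr₀.le hsp
      (fun k hk hv => hnot k (by omega) hv)
    have hsT := hsp a.T le_rfl
    have h5 : ‖gap f a s p p' ω a.T‖ ≤ 2 * R := by
      have e1 : gap f a s p p' ω a.T = ((path f a s p' ω a.T).1 - s.x)
          - ((path f a s p ω a.T).1 - s.x) := by unfold gap; abel
      rw [e1]
      have h6 := norm_sub_le ((path f a s p' ω a.T).1 - s.x) ((path f a s p ω a.T).1 - s.x)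
      have h7 := (le_max_left _ _).trans hsT
      have h8 := (le_max_right _ _).trans hsT
      linarith
    linarith
  refine (measure_mono hsub).trans ((measure_biUnion_finset_le _ _).trans ?_)
  refine (Finset.sum_le_sum fun k _ => measure_errorGap_le h hσ hc.L_pos.le hc.ρ_nonneg hc.b_pos
    hBb s p p' k hℓ (by positivity : 0 < τ k) ?_).trans ?_
  · have e1 : ℓ ^ 2 * V k = 2 * (16 * ℓ ^ 2 * L ^ 2 / a.b) * (r₀ * g ^ k) ^ 2 := by
      simp only [hVdef]; ring
    have e2 : 2 * τ k ^ 2 = 2 * κ₁ ^ 2 * (r₀ * g ^ k) ^ 2 := by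
      simp only [hτdef]; ring
    rw [e1, e2]
    refine mul_le_mul_of_nonneg_right ?_ (sq_nonneg _)
    have : 16 * ℓ ^ 2 * L ^ 2 / a.b ≤ κ₁ ^ 2 := by
      rw [div_le_iff₀ hb]; linarith
    linarith
  · rw [Finset.sum_const, Finset.card_range, nsmul_eq_mul, ← ENNReal.ofReal_natCast,
      ← ENNReal.ofReal_mul (Nat.cast_nonneg _)]
    push_cast
    exact le_rfl

end CoupledErrors

/-! ### Random perturbations -/

section Perturbation

/-- The uniform distribution on the unit ball changes little under a translation. -/
theorem unifBall_le_translate {d : ℕ} (v : Vec d) (hv : ‖v‖ ≤ 1) (S : Set (Vec d)) :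
    unifBall d S ≤ unifBall d {ζ | ζ + v ∈ S} + ENNReal.ofReal (d * ‖v‖) := by
  set B := Metric.closedBall (0 : Vec d) 1 with hB
  set C := Metric.closedBall v 1 with hC
  set μ : Measure (Vec d) := volume with hμ
  have hB0 : μ B ≠ 0 := (Metric.measure_closedBall_pos volume (0 : Vec d) one_pos).ne'
  have hBt : μ B ≠ ⊤ := measure_closedBall_lt_top.ne
  have hBm : MeasurableSet B := measurableSet_closedBall
  have h1 : μ (B ∩ S ∩ C) ≤ μ (B ∩ {ζ | ζ + v ∈ S}) := by
    rw [← measure_preimage_add_right μ v (B ∩ S ∩ C)]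
    refine measure_mono fun ζ hζ => ⟨?_, hζ.1.2⟩
    have : ζ + v ∈ C := hζ.2
    rw [hC, mem_closedBall_iff_norm, add_sub_cancel_right] at this
    rw [hB, mem_closedBall_zero_iff]
    exact this
  have h2 : μ (B \ C) ≤ ENNReal.ofReal (d * ‖v‖) * μ B := by
    have hr : 0 ≤ 1 - ‖v‖ := by linarith
    have hsub : B \ C ⊆ B \ Metric.closedBall (0 : Vec d) (1 - ‖v‖) := by
      refine Set.sdiff_subset_sdiff_right fun ζ hζ => ?_
      rw [mem_closedBall_zero_iff] at hζ
      rw [hC, mem_closedBall_iff_norm]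
      linarith [norm_sub_le ζ v]
    refine (measure_mono hsub).trans ?_
    rw [measure_sdiff (Metric.closedBall_subset_closedBall (by linarith [norm_nonneg v]))
      measurableSet_closedBall.nullMeasurableSet measure_closedBall_lt_top.ne]
    have hvol : ∀ t : ℝ, 0 ≤ t → μ (Metric.closedBall (0 : Vec d) t)
        = ENNReal.ofReal (t ^ d) * μ B := by
      intro t ht
      rw [hB, Measure.addHaar_closedBall μ 0 ht, Measure.addHaar_closedBall μ 0 zero_le_one]
      simp
    rw [hvol _ hr]
    have hle : 1 - d * ‖v‖ ≤ (1 - ‖v‖) ^ d := by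
      have := one_add_mul_le_pow (a := -‖v‖) (by linarith) d
      rw [← sub_eq_add_neg] at this
      linarith
    rw [tsub_le_iff_right, ← add_mul, ← ENNReal.ofReal_add (by positivity) (by positivity)]
    refine le_mul_of_one_le_left' ?_
    rw [← ENNReal.ofReal_one]
    exact ENNReal.ofReal_le_ofReal (by linarith)
  have h3 : μ (B ∩ S) ≤ μ (B ∩ {ζ | ζ + v ∈ S}) + ENNReal.ofReal (d * ‖v‖) * μ B := by
    refine (measure_le_inter_add_sdiff μ (B ∩ S) C).trans (add_le_add h1 ?_)
    exact (measure_mono (Set.sdiff_subset_sdiff_left Set.inter_subset_left)).trans h2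
  unfold unifBall
  rw [cond_apply hBm, cond_apply hBm]
  refine (mul_le_mul_right h3 _).trans (le_of_eq ?_)
  rw [mul_add, mul_left_comm, ENNReal.inv_mul_cancel hB0 hBt, mul_one]

variable {d : ℕ} {Ξ : Type*} [MeasurableSpace Ξ] {P : Measure Ξ} [IsProbabilityMeasure P]

/-- A random point that belongs to at most one of `N` translates of a random set, up to an event of
probability `N ^ 2 * q`, hits that set with probability about `1 / N`. -/
theorem lintegral_translates_le {Ω : Type*} [MeasurableSpace Ω] {μ : Measure Ω}
    [IsProbabilityMeasure μ] {N : ℕ} (hN : 0 < N) (A : ℕ → Set Ω) (hA : ∀ i, MeasurableSet (A i))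
    {q : ENNReal} (hq : ∀ i j, i < j → j < N → μ (A i ∩ A j) ≤ q) :
    ∫⁻ ω, (N : ENNReal)⁻¹ * ∑ i ∈ Finset.range N, (A i).indicator 1 ω ∂μ
      ≤ (N : ENNReal)⁻¹ + N * N * q := by
  classical
  have hpt : ∀ ω, (N : ENNReal)⁻¹ * ∑ i ∈ Finset.range N, (A i).indicator 1 ω
      ≤ (N : ENNReal)⁻¹ + ∑ i ∈ Finset.range N, ∑ j ∈ Finset.range N,
        if i < j then (A i ∩ A j).indicator 1 ω else 0 := by
    intro ω
    by_cases hex : ∃ i j, i < j ∧ j < N ∧ ω ∈ A i ∩ A j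
    · -- If `ω` lies in two of the sets, the corresponding indicator is at least the average.
      obtain ⟨i, j, hij, hj, hω⟩ := hex
      have h1 : (N : ENNReal)⁻¹ * ∑ i ∈ Finset.range N, (A i).indicator 1 ω ≤ 1 := by
        have : ∑ i ∈ Finset.range N, (A i).indicator (1 : Ω → ENNReal) ω ≤ N := by
          refine (Finset.sum_le_card_nsmul _ _ 1 fun i _ => ?_).trans (by simp)
          exact Set.indicator_apply_le' (fun _ => le_rfl) fun _ => zero_le
        refine (mul_le_mul_right this _).trans (le_of_eq ?_)
        exact ENNReal.inv_mul_cancel (by exact_mod_cast hN.ne') (ENNReal.natCast_ne_top N)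
      refine h1.trans (le_add_left ?_)
      have h2 := Finset.single_le_sum (f := fun i => ∑ j ∈ Finset.range N,
        if i < j then (A i ∩ A j).indicator (1 : Ω → ENNReal) ω else 0) (fun _ _ => zero_le)
        (Finset.mem_range.mpr (hij.trans hj))
      have h3 := Finset.single_le_sum (f := fun j =>
        if i < j then (A i ∩ A j).indicator (1 : Ω → ENNReal) ω else 0) (fun _ _ => zero_le)
        (Finset.mem_range.mpr hj)
      refine le_trans (le_of_eq ?_) (h3.trans h2)
      simp only [if_pos hij]
      rw [Set.indicator_of_mem hω]
      rfl
    · refine le_add_right ?_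
      refine mul_le_of_le_one_right' ?_
      by_cases hone : ∃ i < N, ω ∈ A i
      · obtain ⟨i, hi, hω⟩ := hone
        rw [Finset.sum_eq_single_of_mem i (Finset.mem_range.mpr hi)]
        · exact Set.indicator_apply_le' (fun _ => le_rfl) fun _ => zero_le
        · intro j hj hji
          refine Set.indicator_of_notMem (fun hωj => hex ?_) _
          rcases lt_or_gt_of_ne hji with hlt | hlt
          · exact ⟨j, i, hlt, hi, hωj, hω⟩
          · exact ⟨i, j, hlt, Finset.mem_range.mp hj, hω, hωj⟩
      · rw [Finset.sum_eq_zero]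
        · exact zero_le
        · intro i hi
          exact Set.indicator_of_notMem (fun hω => hone ⟨i, Finset.mem_range.mp hi, hω⟩) _
  refine (lintegral_mono hpt).trans ?_
  have hm : ∀ i j, Measurable fun ω =>
      if i < j then (A i ∩ A j).indicator (1 : Ω → ENNReal) ω else 0 := by
    intro i j
    split_ifs
    · exact measurable_one.indicator ((hA i).inter (hA j))
    · exact measurable_const
  rw [lintegral_add_left measurable_const, lintegral_const, measure_univ, mul_one,
    lintegral_finsetSum _ fun i _ => Finset.measurable_sum _ fun j _ => hm i j]
  refine add_le_add_right ?_ _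
  have hb : ∀ i ∈ Finset.range N, ∫⁻ ω, ∑ j ∈ Finset.range N,
      (if i < j then (A i ∩ A j).indicator (1 : Ω → ENNReal) ω else 0) ∂μ ≤ N * q := by
    intro i _
    rw [lintegral_finsetSum _ fun j _ => hm i j]
    refine (Finset.sum_le_card_nsmul _ _ q fun j hj => ?_).trans (by simp)
    split_ifs with hij
    · rw [lintegral_indicator_one ((hA i).inter (hA j))]
      exact hq i j hij (Finset.mem_range.mp hj)
    · simp
  refine (Finset.sum_le_card_nsmul _ _ _ hb).trans ?_
  simp [mul_assoc]

/-- If the translates of a point along the direction `e` are unlikely to lie in `A` in pairs, then a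
perturbed point is unlikely to lie in `A`.  Membership in `A` depends on the samples only, so that
the perturbation of the first draw is independent of it. -/
theorem measure_perturbed_le {A : Set ((ℕ → Draw d Ξ) × Vec d)} (hA : MeasurableSet A)
    (hdep : ∀ ω ω' ζ, (∀ i, (ω i).1 = (ω' i).1) → ((ω, ζ) ∈ A ↔ (ω', ζ) ∈ A))
    {N : ℕ} (hN : 0 < N) {h : ℝ} (hh : 0 ≤ h) (hNh : N * h ≤ 1) {e : Vec d} (he : ‖e‖ = 1)
    {q : ENNReal}
    (hq : ∀ ζ : Vec d, ‖ζ‖ ≤ 1 → ∀ i j : ℕ, i < j → j < N →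
      drawLaw P d {ω | (ω, ζ + (i * h) • e) ∈ A ∧ (ω, ζ + (j * h) • e) ∈ A} ≤ q) :
    drawLaw P d {ω | (ω, (ω 0).2) ∈ A}
      ≤ (N : ENNReal)⁻¹ + N * N * q + ENNReal.ofReal (d * (N * h)) := by
  classical
  set c := ENNReal.ofReal (d * (N * h)) with hc
  let Ψ : (ℕ → Draw d Ξ) → Vec d → ENNReal := fun ω ζ =>
    (N : ENNReal)⁻¹ * ∑ i ∈ Finset.range N,
      {ω | (ω, ζ + (i * h : ℝ) • e) ∈ A}.indicator 1 ω
  have hmeasA : ∀ i : ℕ, MeasurableSet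
      {z : (ℕ → Draw d Ξ) × Vec d | (z.1, z.2 + (i * h : ℝ) • e) ∈ A} := fun i =>
    (measurable_fst.prodMk (measurable_snd.add_const _)) hA
  have hΨ : Measurable (Function.uncurry Ψ) := by
    refine Measurable.const_mul (Finset.measurable_sum _ fun i _ => ?_) _
    exact measurable_one.indicator (hmeasA i)
  let G : (ℕ → Draw d Ξ) → ENNReal := fun ω => ∫⁻ ζ, Ψ ω ζ ∂(unifBall d)
  have hG : Measurable G := hΨ.lintegral_prod_right'
  have hGdep : ∀ ω ω' : ℕ → Draw d Ξ, (∀ i, (ω i).1 = (ω' i).1) → G ω = G ω' := by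
    intro ω ω' hωω'
    refine lintegral_congr fun ζ => ?_
    simp only [Ψ]
    congr 1
    refine Finset.sum_congr rfl fun i _ => ?_
    by_cases hm : (ω, ζ + (i * h : ℝ) • e) ∈ A
    · have hm' := (hdep ω ω' _ hωω').mp hm
      rw [Set.indicator_of_mem (by exact hm), Set.indicator_of_mem (by exact hm')]
      rfl
    · have hm' := fun hm2 => hm ((hdep ω ω' _ hωω').mpr hm2)
      rw [Set.indicator_of_notMem (by exact hm), Set.indicator_of_notMem (by exact hm')]
  -- For fixed samples, averaging over the translates costs `c`.
  have hball : ∀ ω : ℕ → Draw d Ξ, unifBall d {ζ | (ω, ζ) ∈ A} ≤ G ω + c := by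
    intro ω
    have h1 : ∀ i ∈ Finset.range N, unifBall d {ζ | (ω, ζ) ∈ A}
        ≤ unifBall d {ζ | (ω, ζ + (i * h : ℝ) • e) ∈ A} + c := by
      intro i hi
      have hiN : (i : ℝ) * h ≤ N * h :=
        mul_le_mul_of_nonneg_right (by exact_mod_cast (Finset.mem_range.mp hi).le) hh
      have hn : ‖(i * h : ℝ) • e‖ = i * h := by
        rw [norm_smul, he, mul_one, Real.norm_of_nonneg (by positivity)]
      have := unifBall_le_translate ((i * h : ℝ) • e) (by rw [hn]; linarith) {ζ | (ω, ζ) ∈ A}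
      rw [hn] at this
      refine this.trans (add_le_add_right (ENNReal.ofReal_le_ofReal ?_) _)
      exact mul_le_mul_of_nonneg_left hiN (Nat.cast_nonneg d)
    have h2 := Finset.sum_le_sum h1
    rw [Finset.sum_const, Finset.card_range, nsmul_eq_mul, Finset.sum_add_distrib,
      Finset.sum_const, Finset.card_range, nsmul_eq_mul] at h2
    have hN0 : (N : ENNReal) ≠ 0 := by exact_mod_cast hN.ne'
    have hNt : (N : ENNReal) ≠ ⊤ := ENNReal.natCast_ne_top N
    have h3 := mul_le_mul_right h2 (N : ENNReal)⁻¹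
    rw [← mul_assoc, ENNReal.inv_mul_cancel hN0 hNt, one_mul, mul_add, ← mul_assoc,
      ENNReal.inv_mul_cancel hN0 hNt, one_mul] at h3
    refine h3.trans (le_of_eq ?_)
    congr 1
    simp only [G, Ψ]
    have hsec : ∀ i : ℕ, MeasurableSet {ζ | (ω, ζ + (i * h : ℝ) • e) ∈ A} := fun i =>
      (measurable_const.prodMk (measurable_id.add_const _)) hA
    have hind : ∀ (i : ℕ) (ζ : Vec d), {ω | (ω, ζ + (i * h : ℝ) • e) ∈ A}.indicator
        (1 : (ℕ → Draw d Ξ) → ENNReal) ω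
        = {ζ | (ω, ζ + (i * h : ℝ) • e) ∈ A}.indicator 1 ζ := by
      intro i ζ
      by_cases hm : (ω, ζ + (i * h : ℝ) • e) ∈ A
      · rw [Set.indicator_of_mem (by exact hm), Set.indicator_of_mem (by exact hm)]; rfl
      · rw [Set.indicator_of_notMem (by exact hm), Set.indicator_of_notMem (by exact hm)]
    simp_rw [hind]
    rw [lintegral_const_mul _ (Finset.measurable_sum _ fun i _ =>
      measurable_one.indicator (hsec i)), lintegral_finsetSum _ fun i _ =>
      measurable_one.indicator (hsec i)]
    congr 1
    exact Finset.sum_congr rfl fun i _ => (lintegral_indicator_one (hsec i)).symm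
  set ν := (Measure.infinitePi fun _ : ℕ => P).prod (unifBall d) with hν
  have hupd : Measurable fun z : (ℕ → Draw d Ξ) × Draw d Ξ => Function.update z.1 0 z.2 := by
    refine measurable_pi_lambda _ fun i => ?_
    by_cases hi : i = 0
    · subst hi; simpa using measurable_snd
    · simpa [Function.update_of_ne hi] using measurable_fst.eval
  have hA0 : MeasurableSet {ω : ℕ → Draw d Ξ | (ω, (ω 0).2) ∈ A} :=
    (measurable_id.prodMk (measurable_pi_apply (X := fun _ => Draw d Ξ) 0).snd) hA
  rw [← lintegral_indicator_one hA0]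
  have hstep : ∀ ω : ℕ → Draw d Ξ, ∫⁻ z, {ω | (ω, (ω 0).2) ∈ A}.indicator 1
      (Function.update ω 0 z) ∂ν ≤ ∫⁻ z, G (Function.update ω 0 z) ∂ν + c := by
    intro ω
    refine (lintegral_prod_le _).trans ?_
    have hdep0 : ∀ (w : ℕ → Ξ) (ζ ζ' : Vec d) (i : ℕ),
        (Function.update ω 0 (w, ζ) i).1 = (Function.update ω 0 (w, ζ') i).1 := by
      intro w ζ ζ' i
      by_cases hi : i = 0
      · subst hi; simp
      · simp [Function.update_of_ne hi]
    have hin : ∀ w : ℕ → Ξ, ∫⁻ ζ, {ω | (ω, (ω 0).2) ∈ A}.indicator 1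
        (Function.update ω 0 (w, ζ)) ∂(unifBall d)
        ≤ G (Function.update ω 0 (w, 0)) + c := by
      intro w
      refine le_trans (le_of_eq ?_) (hball (Function.update ω 0 (w, 0)))
      have hsec : MeasurableSet {ζ | (Function.update ω 0 (w, (0 : Vec d)), ζ) ∈ A} :=
        measurable_prodMk_left hA
      rw [← lintegral_indicator_one hsec]
      refine lintegral_congr fun ζ => ?_
      have hiff : (Function.update ω 0 (w, ζ), (Function.update ω 0 (w, ζ) 0).2) ∈ A ↔
          (Function.update ω 0 (w, (0 : Vec d)), ζ) ∈ A := by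
        simp only [Function.update_self]
        exact hdep _ _ _ (hdep0 w ζ 0)
      by_cases hm : (Function.update ω 0 (w, (0 : Vec d)), ζ) ∈ A
      · rw [Set.indicator_of_mem (by exact hiff.mpr hm), Set.indicator_of_mem (by exact hm)]; rfl
      · rw [Set.indicator_of_notMem (by exact fun h2 => hm (hiff.mp h2)),
          Set.indicator_of_notMem (by exact hm)]
    refine (lintegral_mono hin).trans ?_
    rw [lintegral_add_right _ measurable_const, lintegral_const, measure_univ, mul_one]
    refine add_le_add_left (le_of_eq ?_) _
    have hGz : Measurable fun z : Draw d Ξ => G (Function.update ω 0 z) :=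
      hG.comp (hupd.comp measurable_prodMk_left)
    rw [hν, lintegral_prod _ hGz.aemeasurable]
    refine lintegral_congr fun w => ?_
    have : ∀ ζ, G (Function.update ω 0 (w, ζ)) = G (Function.update ω 0 (w, 0)) :=
      fun ζ => hGdep _ _ (hdep0 w ζ 0)
    simp [this]
  refine (lintegral_infinitePi_le_update ν 0 _).trans ((lintegral_mono hstep).trans ?_)
  rw [lintegral_add_right _ measurable_const, lintegral_const, measure_univ, mul_one]
  refine add_le_add_left ?_ _
  have hGμ : ∫⁻ ω, ∫⁻ z, G (Function.update ω 0 z) ∂ν ∂(Measure.infinitePi fun _ : ℕ => ν)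
      = ∫⁻ ω, G ω ∂(drawLaw P d) := by
    rw [← lintegral_prod (fun z : (ℕ → Draw d Ξ) × Draw d Ξ => G (Function.update z.1 0 z.2))
      (hG.comp hupd).aemeasurable]
    conv_rhs => rw [drawLaw, ← map_update_infinitePi ν 0]
    rw [lintegral_map hG hupd]
  rw [hGμ]
  have hprob : IsProbabilityMeasure (drawLaw P d) := by unfold drawLaw; infer_instance
  simp only [G]
  rw [lintegral_lintegral_swap hΨ.aemeasurable]
  refine (lintegral_mono_ae (g := fun _ => (N : ENNReal)⁻¹ + N * N * q) ?_).trans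
    (by rw [lintegral_const, measure_univ, mul_one])
  filter_upwards [ae_norm_le_one_unifBall d] with ζ hζ
  exact lintegral_translates_le hN (fun i => {ω | (ω, ζ + (i * h : ℝ) • e) ∈ A})
    (fun i => (measurable_id.prodMk measurable_const) hA) (fun i j hij hj => hq ζ hζ i j hij hj)

end Perturbation

/-! ### Escape from points of negative curvature -/

section Escape

variable {d : ℕ} {Ξ : Type*} [MeasurableSpace Ξ] {P : Measure Ξ} [IsProbabilityMeasure P]
  {f : Vec d → Ξ → ℝ} {a : Params} {x₁ : Vec d} {L ρ σ Δ : ℝ}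

/-- The numerical conditions under which an escape phase that starts at a point of curvature below
`-εH` is broken, up to a small probability: coupled phases started at distance at least `h * r`
separate beyond `2 * R`. -/
structure EscapeConditions (a : Params) (L ρ εH R κ₁ ℓ h : ℝ) (N : ℕ) : Prop where
  coupling : CouplingConditions a L ρ R κ₁
  κ₁_pos : 0 < κ₁
  εH_nonneg : 0 ≤ εH
  ηH_pos : 0 < a.ηH
  step_le : a.ηH * L ≤ 1 / 10
  b_le_B : a.b ≤ a.B
  Dbar_nonneg : 0 ≤ a.Dbar
  r_pos : 0 < a.r
  r_le : a.r ≤ Real.sqrt a.Dbar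
  radius : (a.T + 3) * Real.sqrt a.Dbar ≤ R
  ℓ_nonneg : 0 ≤ ℓ
  batch : 16 * ℓ ^ 2 * L ^ 2 ≤ a.b * κ₁ ^ 2
  N_pos : 0 < N
  h_pos : 0 < h
  grid : N * h ≤ 1
  growth : 4 * R < h * a.r * (1 + a.ηH * εH) ^ a.T

/-- The probability that an escape phase from a point of negative curvature is not broken: the
parts stand for the hits of one of `N` points of a grid of mesh `h`, the coupling failures, and
the change of the perturbation when moved along the grid. -/
def stuckBound (d T N : ℕ) (ℓ h : ℝ) : ENNReal :=
  (N : ENNReal)⁻¹ + N * N * ENNReal.ofReal ((T + 1) * (2 * Real.exp 1 * Real.exp (-ℓ)))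
    + ENNReal.ofReal (d * (N * h))

theorem measure_stuck_le (hA : Assumptions P f x₁ L ρ σ Δ) (hσ : 0 ≤ σ) {εH R κ₁ ℓ h : ℝ} {N : ℕ}
    (hc : EscapeConditions a L ρ εH R κ₁ ℓ h N) {s : State d}
    (hs : NegCurv (objective P f) εH s.x) :
    drawLaw P d {ω | Stuck f a s (s.x + a.r • (ω 0).2) ω} ≤ stuckBound d a.T N ℓ h := by
  have hL := hc.coupling.L_pos.le
  obtain ⟨γ, e, hγ, he, heig, hlow⟩ := hs.exists_eigenvector
    (hA.hess_objective_isSymmetric hσ hL s.x)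
  have hq : QuadraticModel (hess (objective P f) s.x) e γ L a.ηH :=
    ⟨hA.hess_objective_isSymmetric hσ hL s.x,
      norm_hess_le hL (hA.norm_gradient_sub_le hσ hL) s.x, hlow, he, heig,
      hc.εH_nonneg.trans_lt hγ, hc.ηH_pos, hc.step_le⟩
  have hr := hc.r_pos
  have hh := hc.h_pos
  refine measure_perturbed_le (A := {z : (ℕ → Draw d Ξ) × Vec d |
      Stuck f a s (s.x + a.r • z.2) z.1})
    (measurableSet_stuck hA.measurable_uncurry_sgrad measurable_const
      ((measurable_snd.const_smul a.r).const_add s.x) measurable_fst)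
    (fun ω ω' ζ hωω' => ?_) hc.N_pos hh.le hc.grid he (fun ζ hζ i j hij hj => ?_)
  · have : ∀ k, movement f a s (s.x + a.r • ζ) ω k = movement f a s (s.x + a.r • ζ) ω' k :=
      fun k => Finset.sum_congr rfl fun i _ => by rw [path_congr fun i _ => hωω' i]
    simp [Stuck, this]
  · have hij' : (1 : ℝ) ≤ (j : ℝ) - i := by
      have : (i : ℝ) + 1 ≤ j := by exact_mod_cast hij
      linarith
    set r₀ := a.r * (((j : ℝ) - i) * h) with hr₀
    have hr₀h : h * a.r ≤ r₀ := by
      rw [hr₀]; nlinarith [mul_pos hr hh]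
    have hclose : ∀ m : ℕ, m < N → ‖s.x + a.r • (ζ + (m * h : ℝ) • e) - s.x‖
        ≤ 2 * Real.sqrt a.Dbar := by
      intro m hm
      have h1 : (m : ℝ) * h ≤ N * h :=
        mul_le_mul_of_nonneg_right (by exact_mod_cast hm.le) hh.le
      have h2 : ‖ζ + (m * h : ℝ) • e‖ ≤ 2 := by
        refine (norm_add_le _ _).trans ?_
        rw [norm_smul, he, mul_one, Real.norm_of_nonneg (by positivity)]
        linarith [hc.grid]
      rw [add_sub_cancel_left, norm_smul, Real.norm_of_nonneg hr.le]
      have := hc.r_le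
      nlinarith [Real.sqrt_nonneg a.Dbar]
    have hp' : s.x + a.r • (ζ + (j * h : ℝ) • e)
        = s.x + a.r • (ζ + (i * h : ℝ) • e) + r₀ • e := by
      rw [hr₀]; module
    have hcl := hclose j hj
    simp only [Set.mem_ofPred_eq]
    rw [hp'] at hcl ⊢
    refine measure_both_stuck_le hA hσ hc.b_le_B hc.coupling hc.κ₁_pos hq
      ((mul_pos hh hr).trans_le hr₀h) hc.Dbar_nonneg (hclose i (hij.trans hj)) hcl hc.radius
      hc.ℓ_nonneg hc.batch (hc.growth.trans_le ?_)
    have hη := hc.ηH_pos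
    have hεH := hc.εH_nonneg
    refine mul_le_mul hr₀h (pow_le_pow_left₀ (by positivity) ?_ _) (by positivity)
      ((mul_pos hh hr).le.trans hr₀h)
    have := mul_le_mul_of_nonneg_left hγ.le hη.le
    linarith

/-- The probability that the configuration at time `n` begins an unbroken escape phase from a
point of negative curvature. -/
theorem measure_run_stuck_le (hA : Assumptions P f x₁ L ρ σ Δ) (hσ : 0 ≤ σ) {εH R κ₁ ℓ h : ℝ}
    {N : ℕ} (hc : EscapeConditions a L ρ εH R κ₁ ℓ h N) (n : ℕ) :
    drawLaw P d {ω | NegCurv (objective P f) εH (run f a x₁ ω n).x ∧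
        Stuck f a (run f a x₁ ω n) ((run f a x₁ ω n).x + a.r • (ω (n + 1)).2)
          (fun i => ω (n + 1 + i))} ≤ stuckBound d a.T N ℓ h := by
  have hL := hc.coupling.L_pos.le
  set A : Set (ℕ → Draw d Ξ) := {ω | NegCurv (objective P f) εH (run f a x₁ ω n).x ∧
        Stuck f a (run f a x₁ ω n) ((run f a x₁ ω n).x + a.r • (ω (n + 1)).2)
          (fun i => ω (n + 1 + i))} with hAdef
  have hrun := measurable_run (a := a) (x₁ := x₁) hA.measurable_uncurry_sgrad n
  have hcont : Continuous (hess (objective P f)) := by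
    refine (LipschitzWith.of_dist_le_mul (K := Real.toNNReal ρ) fun x y => ?_).continuous
    rw [dist_eq_norm, dist_eq_norm, Real.coe_toNNReal _ hc.coupling.ρ_nonneg]
    exact hA.norm_hess_objective_sub_le hσ hL x y
  have hmeas : MeasurableSet A := by
    refine MeasurableSet.inter ?_ ?_
    · exact (measurable_state_x.comp hrun) (isOpen_negCurv εH hcont).measurableSet
    · exact measurableSet_stuck hA.measurable_uncurry_sgrad hrun
        ((measurable_state_x.comp hrun).add
          ((measurable_pi_apply (X := fun _ => Draw d Ξ) (n + 1)).snd.const_smul a.r))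
        (measurable_pi_lambda _ fun i => measurable_pi_apply (n + 1 + i))
  have hprob : IsProbabilityMeasure (drawLaw P d) := by unfold drawLaw; infer_instance
  rw [← lintegral_indicator_one hmeas]
  refine (lintegral_infinitePi_le_splice _ (n + 1) _).trans ?_
  refine (lintegral_mono (g := fun _ => stuckBound d a.T N ℓ h) fun ω => ?_).trans
    (by rw [lintegral_const, measure_univ, mul_one])
  have hrs : ∀ ω' : ℕ → Draw d Ξ, run f a x₁ (splice (n + 1) ω ω') n = run f a x₁ ω n :=
    fun ω' => run_congr fun i hi => by simp [splice, Nat.lt_succ_of_le hi]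
  set s := run f a x₁ ω n with hs
  by_cases hneg : NegCurv (objective P f) εH s.x
  · have hset : MeasurableSet {ω' : ℕ → Draw d Ξ | Stuck f a s (s.x + a.r • (ω' 0).2) ω'} :=
      measurableSet_stuck hA.measurable_uncurry_sgrad measurable_const
        (((measurable_pi_apply (X := fun _ => Draw d Ξ) 0).snd.const_smul a.r).const_add s.x)
        measurable_id
    refine le_trans (le_of_eq ?_) (measure_stuck_le hA hσ hc hneg)
    rw [← lintegral_indicator_one hset]
    refine lintegral_congr fun ω' => ?_
    have hiff : splice (n + 1) ω ω' ∈ A ↔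
        ω' ∈ {ω' : ℕ → Draw d Ξ | Stuck f a s (s.x + a.r • (ω' 0).2) ω'} := by
      have e1 : (fun i => splice (n + 1) ω ω' (n + 1 + i)) = ω' := by
        funext i
        rw [splice, if_neg (by omega), Nat.add_sub_cancel_left]
      have e2 : splice (n + 1) ω ω' (n + 1) = ω' 0 := by simp [splice]
      simp only [hAdef, Set.mem_ofPred_eq, hrs, e1, e2, hneg, true_and]
    by_cases hm : ω' ∈ {ω' : ℕ → Draw d Ξ | Stuck f a s (s.x + a.r • (ω' 0).2) ω'}
    · rw [Set.indicator_of_mem hm, Set.indicator_of_mem (hiff.mpr hm)]; rfl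
    · rw [Set.indicator_of_notMem hm, Set.indicator_of_notMem (fun h2 => hm (hiff.mp h2))]
  · refine le_trans (le_of_eq ?_) zero_le
    rw [lintegral_eq_zero_of_ae_eq_zero (Eventually.of_forall fun ω' => ?_)]
    refine Set.indicator_of_notMem (fun hm => hneg ?_) _
    have := hm.1
    rwa [hrs] at this

end Escape

/-! ### The success probability -/

section Success

variable {d : ℕ} {Ξ : Type*} [MeasurableSpace Ξ] {P : Measure Ξ} [IsProbabilityMeasure P]
  {f : Vec d → Ξ → ℝ} {a : Params} {x₁ : Vec d} {L ρ σ Δ : ℝ}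

theorem ae_forall_norm_le_one :
    ∀ᵐ ω ∂(drawLaw P d), ∀ n, ‖(ω n).2‖ ≤ 1 := by
  rw [ae_all_iff]
  intro n
  have h1 : MeasurePreserving (fun ω : ℕ → Draw d Ξ => ω n) (drawLaw P d)
      ((Measure.infinitePi fun _ : ℕ => P).prod (unifBall d)) :=
    measurePreserving_eval_infinitePi _ n
  have h2 : MeasurePreserving (fun z : Draw d Ξ => z.2)
      ((Measure.infinitePi fun _ : ℕ => P).prod (unifBall d)) (unifBall d) :=
    measurePreserving_snd
  exact (h2.comp h1).quasiMeasurePreserving.ae (ae_norm_le_one_unifBall d)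

/-- The union bound over the first `M` iterations. -/
theorem measure_not_succeeds_le (hA : Assumptions P f x₁ L ρ σ Δ) (hσ : 0 < σ) (hL : 0 < L)
    {α ε εH R κ₁ ℓ h K : ℝ} {M N : ℕ} (hα : 0 < α) (hb : 0 < a.b) (hB : a.B = a.b ^ 2)
    (hq : a.q = a.b) (hDbar : a.Dbar = σ ^ 2 / (4 * (a.b : ℝ) ^ 2 * L ^ 2))
    (hT : a.T + 1 ≤ a.b) (hmov : MovementConditions a)
    (hdec : DecreaseConditions a L (σ / a.b * ℓ) α)
    (hesc : EscapeConditions a L ρ εH R κ₁ ℓ h N)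
    (hE : σ / a.b * ℓ ≤ ε / 2) (hM : Δ / α + a.T + 1 < M)
    (hK : 3 * (a.b : ℝ) * M + a.b ^ 2 ≤ K) :
    drawLaw P d {ω | ¬ Succeeds (objective P f) f a x₁ (a.θ + ε / 2) εH K ω}
      ≤ (M + 1) * (ENNReal.ofReal (2 * Real.exp 2 * Real.exp (-ℓ)) + stuckBound d a.T N ℓ h) := by
  set X : ℕ → Set (ℕ → Draw d Ξ) := fun n => {ω | (run f a x₁ ω n).phase ≠ .halted ∧
      σ / a.b * ℓ < ‖(run f a x₁ ω n).g - gradient (objective P f) (run f a x₁ ω n).x‖}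
  set Y : ℕ → Set (ℕ → Draw d Ξ) := fun n =>
    {ω | NegCurv (objective P f) εH (run f a x₁ ω n).x ∧
        Stuck f a (run f a x₁ ω n) ((run f a x₁ ω n).x + a.r • (ω (n + 1)).2)
          (fun i => ω (n + 1 + i))}
  have hsub : {ω | ¬ Succeeds (objective P f) f a x₁ (a.θ + ε / 2) εH K ω}
      ⊆ {ω | ¬ ∀ n, ‖(ω n).2‖ ≤ 1} ∪ ⋃ n ∈ Finset.range (M + 1), (X n ∪ Y n) := by
    intro ω hω
    by_contra hnot
    simp only [Set.mem_union, Set.mem_ofPred_eq, not_or, not_not, Set.mem_iUnion,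
      Finset.mem_range, not_exists] at hnot
    obtain ⟨hball, hXY⟩ := hnot
    have hgood : ∀ n ≤ M, (run f a x₁ ω n).phase ≠ .halted →
        ‖(run f a x₁ ω n).g - gradient (objective P f) (run f a x₁ ω n).x‖ ≤ σ / a.b * ℓ :=
      fun n hn hp => not_lt.mp fun hlt => (hXY n (by omega)).1 ⟨hp, hlt⟩
    have hhalt := run_halts (hA.hasGradientAt hσ.le hL.le) (hA.norm_gradient_sub_le hσ.le hL.le)
      hα hdec hball hgood (fun x => by
        have := ciInf_le hA.bddBelow x
        linarith [hA.gap]) hM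
    refine hω ⟨M, hhalt, ?_, ?_⟩
    · refine le_trans ?_ hK
      exact_mod_cast run_cost_le (f := f) (x₁ := x₁) hdec.Dbar_nonneg hb hq hB ω M
    · cases runShape (f := f) (x₁ := x₁) hdec.Dbar_nonneg ω M with
      | descent hp => rw [hhalt] at hp; simp at hp
      | escape n₀ hp => rw [hhalt] at hp; simp at hp
      | halted n₀ hp hn hk hh =>
        rw [hh.anchor_eq]
        constructor
        · have h1 := hgood n₀ (by omega) (by rw [hh.phase_start]; simp)
          have h2 := norm_sub_norm_le (gradient (objective P f) (run f a x₁ ω n₀).x)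
            (run f a x₁ ω n₀).g
          rw [norm_sub_rev] at h1
          linarith [hh.start_small]
        · refine neg_le_lambdaMin hesc.εH_nonneg fun hneg => (hXY n₀ (by omega)).2 ⟨hneg, ?_⟩
          intro k hk'
          exact hh.small k (by rw [hk]; exact hk')
  refine (measure_mono hsub).trans ((measure_union_le _ _).trans ?_)
  have h0 : drawLaw P d {ω | ¬ ∀ n, ‖(ω n).2‖ ≤ 1} = 0 :=
    ae_iff.mp (ae_forall_norm_le_one (P := P) (d := d))
  rw [h0, zero_add]
  refine (measure_biUnion_finset_le _ _).trans ?_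
  refine (Finset.sum_le_card_nsmul _ _ _ fun n _ => (measure_union_le _ _).trans
    (add_le_add (measure_error_le hA hσ hL hb hB rfl hq hDbar hT hmov ℓ n)
      (measure_run_stuck_le hA hσ.le hesc n))).trans ?_
  rw [Finset.card_range, nsmul_eq_mul]
  push_cast
  exact le_rfl

end Success

/-! ### The choice of the parameters -/

section Schedule

/-- The relations between the batch size, the step size and the length of an escape phase, for a
confidence level `exp (-ℓ)`; here `Λ` is the logarithmic factor. -/
structure Schedule (L ρ σ ε εH Λ ℓ ηH : ℝ) (b T : ℕ) : Prop where
  L_pos : 0 < L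
  ρ_pos : 0 < ρ
  σ_pos : 0 < σ
  ε_pos : 0 < ε
  εH_pos : 0 < εH
  εH_le : εH ≤ L
  one_le : 1 ≤ Λ
  L_sq_le : L ^ 2 ≤ Λ * (σ * ρ)
  ℓ_eq : ℓ = 1000 * Λ
  ηH_eq : ηH = 1 / (10 * ℓ * L)
  b_ge : 3000 * ℓ ^ 5 * (σ / ε + σ * ρ / εH ^ 2) ≤ b
  b_le : b ≤ 3001 * ℓ ^ 5 * (σ / ε + σ * ρ / εH ^ 2)
  T_ge : 20 * ℓ ^ 2 * (L / εH) ≤ T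
  T_le : T ≤ 21 * ℓ ^ 2 * (L / εH)

namespace Schedule

variable {L ρ σ ε εH Λ ℓ ηH : ℝ} {b T : ℕ}

theorem exists_schedule (hL : 0 < L) (hρ : 0 < ρ) (hσ : 0 < σ) (hε : 0 < ε) (hεH : 0 < εH)
    (hεL : εH ≤ L) (hΛ : 1 ≤ Λ) (hLΛ : L ^ 2 ≤ Λ * (σ * ρ)) :
    ∃ b T : ℕ, Schedule L ρ σ ε εH Λ (1000 * Λ) (1 / (10 * (1000 * Λ) * L)) b T := by
  have h1 : 1 ≤ L / εH := by rwa [one_le_div hεH]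
  have h2 : 1 ≤ (1000 * Λ) ^ 2 := one_le_pow₀ (by linarith)
  have h3 : 1 ≤ (1000 * Λ) ^ 2 * (L / εH) := one_le_mul_of_one_le_of_one_le h2 h1
  have h4 : 1 ≤ Λ * (σ * ρ / εH ^ 2) := by
    rw [mul_div_assoc', one_le_div (by positivity)]
    exact (pow_le_pow_left₀ hεH.le hεL 2).trans hLΛ
  have h5 : Λ ≤ (1000 * Λ) ^ 5 :=
    (by linarith : Λ ≤ 1000 * Λ).trans (le_self_pow₀ (by linarith) (by norm_num))
  have h6 : 1 ≤ (1000 * Λ) ^ 5 * (σ / ε + σ * ρ / εH ^ 2) := by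
    have e1 : 0 ≤ σ / ε := by positivity
    have e2 : 0 ≤ σ * ρ / εH ^ 2 := by positivity
    calc 1 ≤ Λ * (σ * ρ / εH ^ 2) := h4
      _ ≤ (1000 * Λ) ^ 5 * (σ / ε + σ * ρ / εH ^ 2) :=
        mul_le_mul h5 (by linarith) e2 (by positivity)
  have ceil : ∀ c y : ℝ, 0 ≤ c → 1 ≤ y → (⌈c * y⌉₊ : ℝ) ≤ (c + 1) * y := by
    intro c y hc hy
    have := (Nat.ceil_lt_add_one (mul_nonneg hc (zero_le_one.trans hy))).le
    linarith
  refine ⟨⌈3000 * ((1000 * Λ) ^ 5 * (σ / ε + σ * ρ / εH ^ 2))⌉₊,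
    ⌈20 * ((1000 * Λ) ^ 2 * (L / εH))⌉₊,
    hL, hρ, hσ, hε, hεH, hεL, hΛ, hLΛ, rfl, rfl, ?_, ?_, ?_, ?_⟩
  · rw [mul_assoc]; exact Nat.le_ceil _
  · have := ceil 3000 _ (by norm_num) h6
    linarith
  · rw [mul_assoc]; exact Nat.le_ceil _
  · have := ceil 20 _ (by norm_num) h3
    linarith

section Bounds

variable (h : Schedule L ρ σ ε εH Λ ℓ ηH b T)
include h

theorem ℓ_ge : 1000 ≤ ℓ := by
  have := h.ℓ_eq; have := h.one_le; linarith

theorem ratio_ge : 1 ≤ L / εH := by rw [one_le_div h.εH_pos]; exact h.εH_le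

theorem b_pos : (0 : ℝ) < b := by
  have := h.ℓ_ge; have := h.σ_pos; have := h.ρ_pos; have := h.ε_pos; have := h.εH_pos
  exact lt_of_lt_of_le (by positivity) h.b_ge

theorem ηH_pos : 0 < ηH := by
  have := h.ℓ_ge; have := h.L_pos
  rw [h.ηH_eq]; positivity

/-- The batch is large on the scale of the gradient. -/
theorem noise_le : σ / b * (3000 * ℓ ^ 5) ≤ ε := by
  have hb := h.b_pos; have := h.ℓ_ge; have := h.σ_pos; have := h.ρ_pos; have := h.ε_pos
  have := h.εH_pos
  rw [div_mul_eq_mul_div, div_le_iff₀ hb]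
  have h1 : 3000 * ℓ ^ 5 * (σ / ε) ≤ b := by
    refine le_trans (mul_le_mul_of_nonneg_left ?_ (by positivity)) h.b_ge
    have : 0 ≤ σ * ρ / εH ^ 2 := by positivity
    linarith
  have h2 : 3000 * ℓ ^ 5 * (σ / ε) = σ * (3000 * ℓ ^ 5) / ε := by ring
  rw [h2, div_le_iff₀ h.ε_pos] at h1
  linarith

/-- The batch is large on the scale of the curvature. -/
theorem noise_curv_le : ρ * (σ / b) * (3000 * ℓ ^ 5) ≤ εH ^ 2 := by
  have hb := h.b_pos; have := h.ℓ_ge; have := h.σ_pos; have := h.ρ_pos; have := h.ε_pos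
  have := h.εH_pos
  have h1 : 3000 * ℓ ^ 5 * (σ * ρ / εH ^ 2) ≤ b := by
    refine le_trans (mul_le_mul_of_nonneg_left ?_ (by positivity)) h.b_ge
    have : 0 ≤ σ / ε := by positivity
    linarith
  have h2 : 3000 * ℓ ^ 5 * (σ * ρ / εH ^ 2) = σ * ρ * (3000 * ℓ ^ 5) / εH ^ 2 := by ring
  rw [h2, div_le_iff₀ (by positivity)] at h1
  have h3 : ρ * (σ / b) * (3000 * ℓ ^ 5) = σ * ρ * (3000 * ℓ ^ 5) / b := by ring
  rw [h3, div_le_iff₀ hb]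
  linarith

/-- Here the assumption `L ^ 2 ≤ Λ * (σ * ρ)` enters. -/
theorem b_ge_ratio : 3000000 * ℓ ^ 4 * (L / εH) ^ 2 ≤ b := by
  have hb := h.b_pos; have hℓ := h.ℓ_ge; have := h.σ_pos; have := h.ρ_pos; have := h.ε_pos
  have hεH := h.εH_pos
  refine le_trans ?_ h.b_ge
  have h0 : 0 ≤ σ / ε := by positivity
  have h1 : (L / εH) ^ 2 ≤ Λ * (σ * ρ / εH ^ 2) := by
    rw [div_pow, mul_div_assoc']
    exact div_le_div_of_nonneg_right h.L_sq_le (by positivity)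
  have h2 : 3000 * ℓ ^ 5 = 3000000 * ℓ ^ 4 * Λ := by
    have : Λ = ℓ / 1000 := by rw [h.ℓ_eq]; ring
    rw [this]; ring
  rw [h2, mul_assoc (3000000 * ℓ ^ 4) Λ]
  refine mul_le_mul_of_nonneg_left (h1.trans ?_) (by positivity)
  exact mul_le_mul_of_nonneg_left (by linarith) (by linarith [h.one_le])

theorem T_add_three_le : (T : ℝ) + 3 ≤ 24 * ℓ ^ 2 * (L / εH) := by
  have h1 := h.T_le
  have h2 := h.ℓ_ge
  have h3 := one_le_mul_of_one_le_of_one_le (one_le_pow₀ (n := 2) (by linarith : 1 ≤ ℓ)) h.ratio_ge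
  linarith

theorem T_add_three_le_b : (T : ℝ) + 3 ≤ b := by
  have h2 := h.ℓ_ge
  have h3 := h.ratio_ge
  refine h.T_add_three_le.trans (le_trans ?_ h.b_ge_ratio)
  have h4 : ℓ ^ 2 ≤ ℓ ^ 4 := pow_le_pow_right₀ (by linarith) (by norm_num)
  have h5 : L / εH ≤ (L / εH) ^ 2 := le_self_pow₀ h3 (by norm_num)
  have h6 : ℓ ^ 2 * (L / εH) ≤ ℓ ^ 4 * (L / εH) ^ 2 :=
    mul_le_mul h4 h5 (by linarith) (by positivity)
  have h7 : 0 ≤ ℓ ^ 2 * (L / εH) := by positivity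
  linarith

theorem sqrt_Dbar (r θ : ℝ) :
    Real.sqrt (params b T ηH r θ L σ).Dbar = σ / b / (2 * L) := by
  have := h.L_pos; have := h.σ_pos; have := h.b_pos
  have e : (params b T ηH r θ L σ).Dbar = (σ / b / (2 * L)) ^ 2 := by
    simp only [params]; field_simp; ring
  rw [e, Real.sqrt_sq (by positivity)]

theorem Dbar_div (r θ : ℝ) : (params b T ηH r θ L σ).Dbar / (12 * (params b T ηH r θ L σ).ηH)
    = 5 / 24 * ((σ / b) ^ 2 * ℓ / L) := by
  have := h.L_pos; have := h.σ_pos; have := h.b_pos; have := h.ℓ_ge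
  have : ℓ ≠ 0 := by positivity
  simp only [params, h.ηH_eq]; field_simp; norm_num

theorem movementConditions {r θ : ℝ} (hr : 0 ≤ r) (hr' : r ≤ σ / (2 * b * L)) (hθ : 0 ≤ θ) :
    MovementConditions (params b T ηH r θ L σ) := by
  have := h.L_pos; have := h.σ_pos; have := h.b_pos
  have e : (params b T ηH r θ L σ).Dbar = (σ / (2 * b * L)) ^ 2 := by
    simp only [params]; field_simp; ring
  refine ⟨by rw [e]; positivity, hr, ?_, ?_, ?_, hθ⟩
  · simp only [params]; positivity
  · rw [e]; exact pow_le_pow_left₀ hr hr' 2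
  · rw [e]; exact le_rfl

/-- The bounds `hr₁` and `hr₂` are the second and the third part of `rMax`, with `g` for its
logarithm. -/
theorem decreaseConditions {r θ g : ℝ} (hr : 0 ≤ r) (hg : 0 ≤ g) (hgℓ : g ≤ ℓ)
    (hr₁ : r ≤ g * ηH * σ ^ 2 / (2 * (b : ℝ) ^ 2 * ε))
    (hr₂ : r ≤ Real.sqrt (2 * g * ηH * σ ^ 2 / ((b : ℝ) ^ 2 * L)))
    (hθ : ε / 2 ≤ θ) (hθ' : θ ≤ ε) :
    DecreaseConditions (params b T ηH r θ L σ) L (σ / b * ℓ)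
      (min (σ / b * ε / (8 * L)) (5 / 24 * ((σ / b) ^ 2 * ℓ / L))) := by
  have hL := h.L_pos; have hσ := h.σ_pos; have hb := h.b_pos; have hℓ := h.ℓ_ge; have hε := h.ε_pos
  have hη := h.ηH_pos
  have hℓ0 : 0 < ℓ := by linarith
  have hDd := h.Dbar_div r θ
  set τ := σ / b with hτ
  have hτ0 : 0 < τ := by positivity
  have hE : τ * ℓ * 3000 ≤ ε := by
    refine le_trans ?_ h.noise_le
    have h5 : ℓ ≤ ℓ ^ 5 := le_self_pow₀ (by linarith) (by norm_num)
    have := mul_le_mul_of_nonneg_left h5 hτ0.le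
    linarith
  have hτℓ : τ ≤ τ * ℓ := le_mul_of_one_le_right hτ0.le (by linarith)
  refine ⟨?_, ?_, hη, hr, by simp only [params]; linarith, ?_, hL.le, ?_, ?_, ?_, ?_⟩
  · simp only [params]; positivity
  · simp only [params]; positivity
  · simp only [params, h.ηH_eq]
    rw [mul_one_div, div_le_iff₀ (by positivity)]
    nlinarith
  · refine (min_le_left _ _).trans ?_
    have e : (params b T ηH r θ L σ).η = τ / (2 * L) := by
      simp only [params, hτ]; field_simp
    have e2 : τ * ε / (8 * L) = τ / (2 * L) * (ε / 4) := by ring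
    rw [e, e2]
    refine mul_le_mul_of_nonneg_left ?_ (by positivity)
    have e3 : L / 2 * (τ / (2 * L)) = τ / 4 := by field_simp; norm_num
    rw [e3]
    simp only [params]
    linarith
  · rw [hDd]
    simp only [params]
    have hr1 : r * ε ≤ g * ηH * τ ^ 2 / 2 := by
      have := mul_le_mul_of_nonneg_right hr₁ hε.le
      refine this.trans (le_of_eq ?_)
      rw [hτ]; field_simp
    have hr2 : r ^ 2 * L ≤ 2 * (g * ηH * τ ^ 2) := by
      have := pow_le_pow_left₀ hr hr₂ 2
      rw [Real.sq_sqrt (by positivity)] at this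
      refine (mul_le_mul_of_nonneg_right this hL.le).trans (le_of_eq ?_)
      rw [hτ]; field_simp
    have h1 : (θ + τ * ℓ) * r ≤ 3 / 2 * (r * ε) := by nlinarith
    have h2 : g * ηH * τ ^ 2 ≤ 1 / 10 * (τ ^ 2 * ℓ / L) := by
      have e : 1 / 10 * (τ ^ 2 * ℓ / L) = ℓ * (ℓ * ηH * τ ^ 2) := by
        rw [h.ηH_eq]; field_simp
      rw [e]
      have h3 : g * (ηH * τ ^ 2) ≤ ℓ * (ηH * τ ^ 2) :=
        mul_le_mul_of_nonneg_right hgℓ (by positivity)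
      have h4 : 0 ≤ ℓ * ηH * τ ^ 2 := by positivity
      nlinarith
    have h3 : 0 ≤ τ ^ 2 * ℓ / L := by positivity
    nlinarith
  · rw [hDd]
    simp only [params, h.ηH_eq]
    have e : 1 / (10 * ℓ * L) * (τ * ℓ) ^ 2 = 1 / 10 * (τ ^ 2 * ℓ / L) := by field_simp
    rw [e]
    have h3 : 0 ≤ τ ^ 2 * ℓ / L := by positivity
    linarith
  · rw [hDd]; exact min_le_right _ _

/-- The radius of the region that an unbroken escape phase explores is small on the scale on which
the Hessian changes by `εH`. -/
theorem radius_le : ρ * ((T + 3) * (σ / b / (2 * L))) * (250 * ℓ ^ 3) ≤ εH := by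
  have hL := h.L_pos; have hσ := h.σ_pos; have hb := h.b_pos; have hℓ := h.ℓ_ge; have hρ := h.ρ_pos
  have hεH := h.εH_pos
  set τ := σ / b with hτ
  have hτ0 : 0 < τ := by positivity
  have h1 := h.T_add_three_le
  have h2 := h.noise_curv_le
  have h3 : (T + 3) * (τ / (2 * L)) ≤ 12 * ℓ ^ 2 * τ / εH := by
    refine (mul_le_mul_of_nonneg_right h1 (by positivity)).trans (le_of_eq ?_)
    field_simp; norm_num
  have h4 : ρ * ((T + 3) * (τ / (2 * L))) * (250 * ℓ ^ 3)
      ≤ ρ * (12 * ℓ ^ 2 * τ / εH) * (250 * ℓ ^ 3) :=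
    mul_le_mul_of_nonneg_right (mul_le_mul_of_nonneg_left h3 hρ.le) (by positivity)
  refine h4.trans ?_
  have e : ρ * (12 * ℓ ^ 2 * τ / εH) * (250 * ℓ ^ 3) = ρ * τ * (3000 * ℓ ^ 5) / εH := by ring
  rw [e, div_le_iff₀ hεH]
  linarith

theorem couplingConditions (r θ : ℝ) : CouplingConditions (params b T ηH r θ L σ) L ρ
    ((T + 3) * (σ / b / (2 * L))) (εH / (12 * ℓ)) := by
  have hL := h.L_pos; have hσ := h.σ_pos; have hb := h.b_pos; have hℓ := h.ℓ_ge; have hρ := h.ρ_pos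
  have hεH := h.εH_pos
  have hr := h.radius_le
  have hℓ0 : 0 < ℓ := by linarith
  have hℓ3 : (1 : ℝ) ≤ ℓ ^ 3 := one_le_pow₀ (by linarith)
  have hℓ31 : ℓ ≤ ℓ ^ 3 := le_self_pow₀ (by linarith) (by norm_num)
  set R := (T + 3) * (σ / b / (2 * L)) with hR
  have hR0 : 0 ≤ R := by positivity
  have hρR : 0 ≤ ρ * R := by positivity
  have hTL := h.T_le
  refine ⟨hρ.le, hL, by positivity, hR0, by exact_mod_cast hb, ?_, ?_, ?_⟩
  · have h1 : (1 : ℝ) ≤ T := by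
      have h3 := one_le_mul_of_one_le_of_one_le
        (one_le_pow₀ (n := 2) (by linarith : 1 ≤ ℓ)) h.ratio_ge
      linarith [h.T_ge]
    exact_mod_cast h1
  · have h1 : T * ηH ≤ 21 / 10 * (ℓ / εH) := by
      refine (mul_le_mul_of_nonneg_right hTL h.ηH_pos.le).trans (le_of_eq ?_)
      rw [h.ηH_eq]; field_simp
    have h2 : ρ * R * 250 * ℓ ≤ εH := by
      refine le_trans ?_ hr
      have := mul_le_mul_of_nonneg_left hℓ31 (by positivity : 0 ≤ ρ * R * 250)
      linarith
    have h3 : 2 * (ρ * R) + εH / (12 * ℓ) ≤ εH / ℓ * (1 / 10) := by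
      have e : εH / ℓ * (1 / 10) = εH / (12 * ℓ) + εH / (60 * ℓ) := by field_simp; norm_num
      have : 2 * (ρ * R) ≤ εH / (60 * ℓ) := by
        rw [le_div_iff₀ (by positivity)]; linarith
      linarith
    change T * (ηH * (2 * (ρ * R) + εH / (12 * ℓ))) ≤ 1 / 2
    rw [← mul_assoc]
    refine (mul_le_mul h1 h3 (by positivity) (by positivity)).trans (le_of_lt ?_)
    have e : 21 / 10 * (ℓ / εH) * (εH / ℓ * (1 / 10)) = 21 / 100 := by field_simp; norm_num
    rw [e]; norm_num
  · change 16 * T * (ρ * R) ^ 2 ≤ L ^ 2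
    have h2 : ρ * R * (250 * ℓ) ≤ εH := by
      refine le_trans ?_ hr
      have := mul_le_mul_of_nonneg_left hℓ31 (by positivity : 0 ≤ ρ * R * 250)
      linarith
    have h3 := pow_le_pow_left₀ (by positivity) h2 2
    have h4 : 16 * T * (ρ * R) ^ 2 ≤ 16 * (21 * ℓ ^ 2 * (L / εH)) * (ρ * R) ^ 2 := by gcongr
    have h5 : 16 * (21 * ℓ ^ 2 * (L / εH)) * (ρ * R) ^ 2
        = 336 / 62500 * ((ρ * R * (250 * ℓ)) ^ 2 * (L / εH)) := by ring
    have h6 : (ρ * R * (250 * ℓ)) ^ 2 * (L / εH) ≤ εH ^ 2 * (L / εH) :=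
      mul_le_mul_of_nonneg_right h3 (by positivity)
    have h7 : εH ^ 2 * (L / εH) = εH * L := by field_simp
    have h8 : εH * L ≤ L ^ 2 := by rw [sq]; exact mul_le_mul_of_nonneg_right h.εH_le hL.le
    have : 0 ≤ L ^ 2 := sq_nonneg L
    linarith

theorem batch_ge : 16 * ℓ ^ 2 * L ^ 2 ≤ b * (εH / (12 * ℓ)) ^ 2 := by
  have hb := h.b_pos; have hℓ := h.ℓ_ge; have hεH := h.εH_pos; have hL := h.L_pos
  have hℓ0 : 0 < ℓ := by linarith
  have h1 := mul_le_mul_of_nonneg_right h.b_ge_ratio (sq_nonneg (εH / (12 * ℓ)))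
  refine le_trans ?_ h1
  have e : 3000000 * ℓ ^ 4 * (L / εH) ^ 2 * (εH / (12 * ℓ)) ^ 2
      = 3000000 / 144 * (ℓ ^ 2 * L ^ 2) := by field_simp; norm_num
  rw [e]
  have : 0 ≤ ℓ ^ 2 * L ^ 2 := by positivity
  linarith

theorem exp_le_growth : Real.exp ℓ ≤ (1 + ηH * εH) ^ T := by
  have hℓ := h.ℓ_ge; have hεH := h.εH_pos; have hL := h.L_pos; have hη := h.ηH_pos
  have hℓ0 : 0 < ℓ := by linarith
  have hx : ηH * εH ≤ 1 := by
    rw [h.ηH_eq, div_mul_eq_mul_div, one_mul, div_le_one (by positivity)]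
    nlinarith [h.εH_le]
  have hx0 : 0 < ηH * εH := by positivity
  have h1 : Real.exp (ηH * εH / 2) ≤ 1 + ηH * εH := by
    have := Real.abs_exp_sub_one_sub_id_le (x := ηH * εH / 2) (by rw [abs_le]; constructor <;> linarith)
    have := (abs_le.mp this).2
    nlinarith
  refine le_trans ?_ (pow_le_pow_left₀ (Real.exp_pos _).le h1 T)
  rw [← Real.exp_nat_mul]
  refine Real.exp_le_exp.mpr ?_
  have h2 := mul_le_mul_of_nonneg_right h.T_ge (by positivity : 0 ≤ ηH * εH / 2)
  refine le_trans (le_of_eq ?_) h2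
  rw [h.ηH_eq]; field_simp; norm_num

end Bounds

end Schedule

end Schedule

/-! ### The number of iterations and the failure probability -/

namespace Schedule

variable {L ρ σ Δ ε εH Λ ℓ ηH δ : ℝ} {b T : ℕ}

theorem inv_noise_le (h : Schedule L ρ σ ε εH Λ ℓ ηH b T) :
    (b : ℝ) / σ ≤ 3001 * ℓ ^ 5 * (1 / ε + ρ / εH ^ 2) := by
  have hσ := h.σ_pos
  rw [div_le_iff₀ hσ]
  refine h.b_le.trans (le_of_eq ?_)
  ring

/-- The number of iterations that the total decrease `Δ` allows. -/
theorem descent_time_le (h : Schedule L ρ σ ε εH Λ ℓ ηH b T) (hΔ : 0 < Δ) :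
    Δ / min (σ / b * ε / (8 * L)) (5 / 24 * ((σ / b) ^ 2 * ℓ / L))
      ≤ 50000000 * ℓ ^ 9 * (L * Δ * (1 / ε + ρ / εH ^ 2) ^ 2) := by
  have hL := h.L_pos; have hσ := h.σ_pos; have hb := h.b_pos; have hℓ := h.ℓ_ge; have hρ := h.ρ_pos
  have hεH := h.εH_pos; have hε := h.ε_pos
  have hℓ0 : 0 < ℓ := by linarith
  have hy := h.inv_noise_le
  set w := 1 / ε + ρ / εH ^ 2 with hw
  have hw1 : 1 / ε ≤ w := by
    have : 0 ≤ ρ / εH ^ 2 := by positivity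
    linarith
  have hw0 : 0 < w := lt_of_lt_of_le (by positivity) hw1
  have h1 : Δ / (σ / b * ε / (8 * L)) ≤ 8 * 3001 * ℓ ^ 9 * (L * Δ * w ^ 2) := by
    have e : Δ / (σ / b * ε / (8 * L)) = 8 * (L * Δ) * (b / σ * (1 / ε)) := by field_simp
    have h2 : b / σ * (1 / ε) ≤ 3001 * ℓ ^ 5 * w * w :=
      mul_le_mul hy hw1 (by positivity) (by positivity)
    have h3 : ℓ ^ 5 ≤ ℓ ^ 9 := pow_le_pow_right₀ (by linarith) (by norm_num)
    rw [e]
    calc 8 * (L * Δ) * (b / σ * (1 / ε)) ≤ 8 * (L * Δ) * (3001 * ℓ ^ 5 * w * w) := by gcongr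
      _ = 8 * 3001 * ℓ ^ 5 * (L * Δ * w ^ 2) := by ring
      _ ≤ _ := by gcongr
  have h2 : Δ / (5 / 24 * ((σ / b) ^ 2 * ℓ / L))
      ≤ 24 / 5 * 3001 ^ 2 * ℓ ^ 9 * (L * Δ * w ^ 2) := by
    have e : Δ / (5 / 24 * ((σ / b) ^ 2 * ℓ / L)) = 24 / 5 * (L * Δ) / ℓ * (b / σ) ^ 2 := by
      field_simp
    rw [e]
    calc 24 / 5 * (L * Δ) / ℓ * (b / σ) ^ 2
        ≤ 24 / 5 * (L * Δ) / ℓ * (3001 * ℓ ^ 5 * w) ^ 2 := by gcongr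
      _ = 24 / 5 * 3001 ^ 2 * ℓ ^ 9 * (L * Δ * w ^ 2) := by field_simp
  have h3 : 0 ≤ ℓ ^ 9 * (L * Δ * w ^ 2) := by positivity
  rcases min_choice (σ / b * ε / (8 * L)) (5 / 24 * ((σ / b) ^ 2 * ℓ / L)) with hm | hm <;>
    rw [hm] <;> linarith

/-- The number of stochastic gradients evaluated in the first `M` iterations. -/
theorem cost_le (h : Schedule L ρ σ ε εH Λ ℓ ηH b T) (hΔ : 0 < Δ) (hσε : σ * ε ≤ L * Δ) {M : ℝ}
    (hM : M ≤ Δ / min (σ / b * ε / (8 * L)) (5 / 24 * ((σ / b) ^ 2 * ℓ / L)) + T + 3) :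
    3 * (b : ℝ) * M + b ^ 2 ≤ 10 ^ 55 * Λ ^ 14 * gradOrder L ρ σ Δ ε εH := by
  have hL := h.L_pos; have hσ := h.σ_pos; have hb := h.b_pos; have hℓ := h.ℓ_ge; have hρ := h.ρ_pos
  have hεH := h.εH_pos; have hε := h.ε_pos
  have hℓ0 : 0 < ℓ := by linarith
  have hd := h.descent_time_le hΔ
  have hTb := h.T_add_three_le_b
  have hbw : (b : ℝ) ≤ 3001 * ℓ ^ 5 * (σ * (1 / ε + ρ / εH ^ 2)) := by
    have := h.inv_noise_le
    rw [div_le_iff₀ hσ] at this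
    linarith
  set u := 1 / ε with hu
  set v := ρ / εH ^ 2 with hv
  have hu0 : 0 < u := by positivity
  have hv0 : 0 < v := by positivity
  set w := u + v with hw
  have hw0 : 0 < w := by positivity
  have hσw : σ ≤ L * Δ * w := by
    have h1 : σ ≤ L * Δ * u := by
      rw [hu, mul_one_div, le_div_iff₀ hε]; exact hσε
    have h2 : 0 ≤ L * Δ * v := by positivity
    rw [hw, mul_add]; linarith
  have h1 : M ≤ 50000000 * ℓ ^ 9 * (L * Δ * w ^ 2) + b := by linarith
  have h2 : 3 * (b : ℝ) * M + b ^ 2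
      ≤ 3 * b * (50000000 * ℓ ^ 9 * (L * Δ * w ^ 2)) + 4 * b ^ 2 := by
    have := mul_le_mul_of_nonneg_left h1 (by positivity : 0 ≤ 3 * (b : ℝ))
    linarith
  have h3 : 3 * (b : ℝ) * (50000000 * ℓ ^ 9 * (L * Δ * w ^ 2))
      ≤ 450150000000 * ℓ ^ 14 * (σ * L * Δ * w ^ 3) := by
    calc 3 * (b : ℝ) * (50000000 * ℓ ^ 9 * (L * Δ * w ^ 2))
        ≤ 3 * (3001 * ℓ ^ 5 * (σ * w)) * (50000000 * ℓ ^ 9 * (L * Δ * w ^ 2)) := by gcongr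
      _ = _ := by ring
  have h4 : 4 * (b : ℝ) ^ 2 ≤ 36024004 * ℓ ^ 14 * (σ * L * Δ * w ^ 3) := by
    calc 4 * (b : ℝ) ^ 2 ≤ 4 * (3001 * ℓ ^ 5 * (σ * w)) ^ 2 := by gcongr
      _ = 36024004 * ℓ ^ 10 * (σ * w ^ 2 * σ) := by ring
      _ ≤ 36024004 * ℓ ^ 14 * (σ * w ^ 2 * (L * Δ * w)) := by
        gcongr
        · linarith
        · norm_num
      _ = _ := by ring
  have h5 : w ^ 3 ≤ 4 * (u ^ 3 + v ^ 3) := by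
    have : 0 ≤ (u + v) * (u - v) ^ 2 := by positivity
    rw [hw]; nlinarith
  have h6 : gradOrder L ρ σ Δ ε εH = σ * L * Δ * (u ^ 3 + v ^ 3) := by
    unfold gradOrder
    rw [hu, hv]; field_simp
  have h7 : ℓ ^ 14 * (σ * L * Δ * w ^ 3) ≤ 10 ^ 42 * Λ ^ 14 * (4 * gradOrder L ρ σ Δ ε εH) := by
    have e : ℓ ^ 14 = 10 ^ 42 * Λ ^ 14 := by rw [h.ℓ_eq]; ring
    have hΛ := h.one_le
    rw [e, h6]
    refine mul_le_mul_of_nonneg_left ?_ (by positivity)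
    have := mul_le_mul_of_nonneg_left h5 (by positivity : 0 ≤ σ * L * Δ)
    linarith
  have hΛ := h.one_le
  have h8 : 0 ≤ Λ ^ 14 * gradOrder L ρ σ Δ ε εH := by rw [h6]; positivity
  have h9 : 3 * (b : ℝ) * M + b ^ 2 ≤ 10 ^ 12 * (ℓ ^ 14 * (σ * L * Δ * w ^ 3)) := by
    have : 0 ≤ ℓ ^ 14 * (σ * L * Δ * w ^ 3) := by positivity
    linarith
  have h10 := mul_le_mul_of_nonneg_left h7 (by norm_num : (0 : ℝ) ≤ 10 ^ 12)
  linarith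

theorem ℓ_le_pow (h : Schedule L ρ σ ε εH Λ ℓ ηH b T) : ℓ ≤ Real.exp Λ ^ 11 := by
  have h1 : Λ ≤ Real.exp Λ := by linarith [Real.add_one_le_exp Λ]
  have h2 : (2 : ℝ) ≤ Real.exp Λ := by linarith [Real.add_one_le_exp Λ, h.one_le]
  have h3 : (2 : ℝ) ^ 10 ≤ Real.exp Λ ^ 10 := pow_le_pow_left₀ (by norm_num) h2 10
  rw [h.ℓ_eq, pow_succ]
  exact mul_le_mul (by linarith) h1 (by linarith [h.one_le]) (by positivity)

theorem exp_ℓ (h : Schedule L ρ σ ε εH Λ ℓ ηH b T) : Real.exp ℓ = Real.exp Λ ^ 1000 := by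
  rw [← Real.exp_nat_mul, h.ℓ_eq]; norm_num

theorem T_le_pow (h : Schedule L ρ σ ε εH Λ ℓ ηH b T) (hX : L / εH ≤ Real.exp Λ) :
    (T : ℝ) + 3 ≤ Real.exp Λ ^ 28 := by
  have h2 : (2 : ℝ) ≤ Real.exp Λ := by linarith [Real.add_one_le_exp Λ, h.one_le]
  have hℓ := h.ℓ_le_pow
  have hℓ0 := h.ℓ_ge
  have h1 := h.ratio_ge
  set X := Real.exp Λ
  have h3 : (2 : ℝ) ^ 5 ≤ X ^ 5 := pow_le_pow_left₀ (by norm_num) h2 5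
  calc (T : ℝ) + 3 ≤ 24 * ℓ ^ 2 * (L / εH) := h.T_add_three_le
    _ ≤ X ^ 5 * (X ^ 11) ^ 2 * X := by
      gcongr
      linarith
    _ = X ^ 28 := by ring

theorem iterations_le_pow (h : Schedule L ρ σ ε εH Λ ℓ ηH b T) (hΔ : 0 < Δ)
    (hX₁ : L / εH ≤ Real.exp Λ) (hX₂ : 1 + ρ * ε / εH ^ 2 ≤ Real.exp Λ)
    (hX₃ : L * Δ / ε ^ 2 ≤ Real.exp Λ) {M : ℝ}
    (hM : M ≤ Δ / min (σ / b * ε / (8 * L)) (5 / 24 * ((σ / b) ^ 2 * ℓ / L)) + T + 3) :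
    M + 1 ≤ Real.exp Λ ^ 130 := by
  have h2 : (2 : ℝ) ≤ Real.exp Λ := by linarith [Real.add_one_le_exp Λ, h.one_le]
  have hℓ := h.ℓ_le_pow
  have hℓ0 := h.ℓ_ge
  have hT := h.T_le_pow hX₁
  have hd := h.descent_time_le hΔ
  have hε := h.ε_pos; have hL := h.L_pos; have hεH := h.εH_pos; have hρ := h.ρ_pos
  have e : L * Δ * (1 / ε + ρ / εH ^ 2) ^ 2 = L * Δ / ε ^ 2 * (1 + ρ * ε / εH ^ 2) ^ 2 := by
    field_simp
  rw [e] at hd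
  set X := Real.exp Λ
  have h3 : (2 : ℝ) ^ 26 ≤ X ^ 26 := pow_le_pow_left₀ (by norm_num) h2 26
  have h4 : 50000000 * ℓ ^ 9 * (L * Δ / ε ^ 2 * (1 + ρ * ε / εH ^ 2) ^ 2) ≤ X ^ 128 := by
    calc 50000000 * ℓ ^ 9 * (L * Δ / ε ^ 2 * (1 + ρ * ε / εH ^ 2) ^ 2)
        ≤ X ^ 26 * (X ^ 11) ^ 9 * (X * X ^ 2) := by
          gcongr
          linarith
      _ = X ^ 128 := by ring
  have h5 : X ^ 28 ≤ X ^ 128 := pow_le_pow_right₀ (by linarith) (by norm_num)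
  have h6 : 1 ≤ X ^ 128 := one_le_pow₀ (by linarith)
  have h7 : (2 : ℝ) ^ 2 * X ^ 128 ≤ X ^ 2 * X ^ 128 := by gcongr
  have h8 : X ^ 2 * X ^ 128 = X ^ 130 := by ring
  linarith

theorem stuckBound_eq (d N : ℕ) (hN : 0 < N) {t : ℝ} (ht : 0 ≤ t) :
    stuckBound d T N ℓ t = ENNReal.ofReal ((N : ℝ)⁻¹
      + N * N * ((T + 1) * (2 * Real.exp 1 * Real.exp (-ℓ))) + d * (N * t)) := by
  have hN' : (0 : ℝ) < N := by exact_mod_cast hN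
  rw [stuckBound, ENNReal.ofReal_add (by positivity) (by positivity),
    ENNReal.ofReal_add (by positivity) (by positivity), ENNReal.ofReal_inv_of_pos hN',
    ENNReal.ofReal_mul (p := (N : ℝ) * N) (by positivity),
    ENNReal.ofReal_mul (p := (N : ℝ)) (by positivity), ENNReal.ofReal_natCast]

/-- A grid that is fine enough for the failure probability `δ`, but not too fine for the coupling
argument. -/
theorem exists_grid (h : Schedule L ρ σ ε εH Λ ℓ ηH b T) {d M : ℕ} (hd : 0 < d) (hδ : 0 < δ)
    (hδ' : δ < 1) (hXd : (d : ℝ) ≤ Real.exp Λ) (hXδ : 1 ≤ δ * Real.exp Λ)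
    (hXT : (T : ℝ) + 3 ≤ Real.exp Λ ^ 28) (hXM : (M : ℝ) + 1 ≤ Real.exp Λ ^ 130) :
    ∃ (N : ℕ) (t : ℝ), 0 < N ∧ 0 < t ∧ N * t ≤ 1 ∧ 1 ≤ t * Real.exp Λ ^ 300 ∧
      ((M : ENNReal) + 1) *
        (ENNReal.ofReal (2 * Real.exp 2 * Real.exp (-ℓ)) + stuckBound d T N ℓ t)
        ≤ ENNReal.ofReal δ := by
  have h2 : (2 : ℝ) ≤ Real.exp Λ := by linarith [Real.add_one_le_exp Λ, h.one_le]
  have hexp : Real.exp (-ℓ) * Real.exp Λ ^ 1000 = 1 := by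
    rw [← h.exp_ℓ, ← Real.exp_add]; simp
  set X := Real.exp Λ
  have hX0 : 0 < X := by linarith
  have hd' : (1 : ℝ) ≤ d := by exact_mod_cast hd
  -- each of the four failure modes gets the share `q` in every iteration
  set q := δ / (4 * (M + 1)) with hq
  have hM0 : (0 : ℝ) ≤ M := Nat.cast_nonneg M
  have hq0 : 0 < q := by positivity
  have hq1 : q ≤ 1 := by rw [hq, div_le_one (by positivity)]; linarith
  have hqX : 1 ≤ q * X ^ 133 := by
    rw [hq, div_mul_eq_mul_div, one_le_div (by positivity)]
    calc 4 * ((M : ℝ) + 1) ≤ X ^ 2 * X ^ 130 := by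
          refine mul_le_mul ?_ hXM (by positivity) (by positivity)
          nlinarith
      _ ≤ (δ * X) * (X ^ 2 * X ^ 130) := le_mul_of_one_le_left (by positivity) hXδ
      _ = δ * X ^ 133 := by ring
  have hsmall : ∀ Y : ℝ, Y ≤ X ^ 800 → Y * Real.exp (-ℓ) ≤ q := by
    intro Y hY
    refine le_of_mul_le_mul_right (le_trans ?_ hqX) (by positivity : 0 < X ^ 133)
    calc Y * Real.exp (-ℓ) * X ^ 133 ≤ X ^ 800 * Real.exp (-ℓ) * X ^ 133 := by gcongr
      _ = Real.exp (-ℓ) * X ^ 933 := by ring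
      _ ≤ Real.exp (-ℓ) * X ^ 1000 := by
        gcongr
        · linarith
        · norm_num
      _ = 1 := hexp
  have he : Real.exp 1 ≤ 3 := by linarith [Real.exp_one_lt_d9]
  have he2 : Real.exp 2 ≤ 9 := by
    have : Real.exp 2 = Real.exp 1 * Real.exp 1 := by rw [← Real.exp_add]; norm_num
    rw [this]; nlinarith [Real.exp_pos 1]
  set N := ⌈1 / q⌉₊ with hN
  have hN1 : 1 / q ≤ N := Nat.le_ceil _
  have hN0 : 0 < N := Nat.ceil_pos.mpr (by positivity)
  have hN0' : (0 : ℝ) < N := by exact_mod_cast hN0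
  have hNX : (N : ℝ) ≤ X ^ 134 := by
    have h3 : (N : ℝ) ≤ 1 / q + 1 := (Nat.ceil_lt_add_one (by positivity)).le
    have h4 : 1 / q ≤ X ^ 133 := by rw [div_le_iff₀ hq0]; linarith
    have h5 : 1 ≤ X ^ 133 := one_le_pow₀ (by linarith)
    have h6 : 2 * X ^ 133 ≤ X * X ^ 133 := by gcongr
    have h7 : X * X ^ 133 = X ^ 134 := by ring
    linarith
  set t := q / (d * N) with ht
  have ht0 : 0 < t := by positivity
  have hdN : d * (N * t) = q := by rw [ht]; field_simp
  refine ⟨N, t, hN0, ht0, ?_, ?_, ?_⟩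
  · have : N * t = q / d := by rw [ht]; field_simp
    rw [this, div_le_one (by positivity)]
    linarith
  · rw [ht, div_mul_eq_mul_div, one_le_div (by positivity)]
    calc (d : ℝ) * N ≤ X * X ^ 134 := mul_le_mul hXd hNX hN0'.le hX0.le
      _ ≤ (q * X ^ 133) * (X * X ^ 134) := le_mul_of_one_le_left (by positivity) hqX
      _ = q * X ^ 268 := by ring
      _ ≤ q * X ^ 300 := by
        gcongr
        · linarith
        · norm_num
  · rw [stuckBound_eq d N hN0 ht0.le, ← ENNReal.ofReal_add (by positivity) (by positivity)]
    have h3 : 2 * Real.exp 2 * Real.exp (-ℓ) ≤ q := by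
      refine hsmall _ ?_
      calc 2 * Real.exp 2 ≤ 2 ^ 5 := by linarith
        _ ≤ X ^ 5 := pow_le_pow_left₀ (by norm_num) h2 5
        _ ≤ X ^ 800 := pow_le_pow_right₀ (by linarith) (by norm_num)
    have h4 : (N : ℝ)⁻¹ ≤ q := by
      rw [inv_le_comm₀ hN0' hq0, ← one_div]; exact hN1
    have h5 : N * N * ((T + 1) * (2 * Real.exp 1 * Real.exp (-ℓ))) ≤ q := by
      have e : N * N * ((T + 1) * (2 * Real.exp 1 * Real.exp (-ℓ)))
          = N * N * ((T + 1) * (2 * Real.exp 1)) * Real.exp (-ℓ) := by ring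
      rw [e]
      refine hsmall _ ?_
      calc N * N * ((T + 1) * (2 * Real.exp 1))
          ≤ X ^ 134 * X ^ 134 * (X ^ 28 * X ^ 3) := by
            have h6 : (2 : ℝ) ^ 3 ≤ X ^ 3 := pow_le_pow_left₀ (by norm_num) h2 3
            gcongr
            · linarith
            · linarith
        _ = X ^ 299 := by ring
        _ ≤ X ^ 800 := pow_le_pow_right₀ (by linarith) (by norm_num)
    have e : (M : ENNReal) + 1 = ENNReal.ofReal (M + 1) := by
      rw [ENNReal.ofReal_add hM0 zero_le_one, ENNReal.ofReal_natCast, ENNReal.ofReal_one]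
    rw [e, ← ENNReal.ofReal_mul (by positivity)]
    refine ENNReal.ofReal_le_ofReal ?_
    have h6 : (M + 1) * (4 * q) = δ := by rw [hq]; field_simp
    rw [← h6]
    refine mul_le_mul_of_nonneg_left ?_ (by positivity)
    linarith

/-- The admissible perturbations are not much smaller than the length of one step. -/
theorem radius_ge (h : Schedule L ρ σ ε εH Λ ℓ ηH b T) (hδ : 1 ≤ Real.log (4 / δ))
    (hX : 1 + ρ * ε / εH ^ 2 ≤ Real.exp Λ) :
    σ / b / (2 * L) ≤ rMax b ηH L σ ε δ * Real.exp Λ ^ 82 := by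
  have h2 : (2 : ℝ) ≤ Real.exp Λ := by linarith [Real.add_one_le_exp Λ, h.one_le]
  have hℓX := h.ℓ_le_pow
  have hL := h.L_pos; have hσ := h.σ_pos; have hb := h.b_pos; have hℓ := h.ℓ_ge; have hρ := h.ρ_pos
  have hεH := h.εH_pos; have hε := h.ε_pos
  have hℓ0 : 0 < ℓ := by linarith
  have hy := h.inv_noise_le
  set X := Real.exp Λ
  set g := Real.log (4 / δ)
  have hD : 30010 * ℓ ^ 6 * X ≤ X ^ 82 := by
    have h3 : (2 : ℝ) ^ 15 ≤ X ^ 15 := pow_le_pow_left₀ (by norm_num) h2 15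
    calc 30010 * ℓ ^ 6 * X ≤ X ^ 15 * (X ^ 11) ^ 6 * X := by
          gcongr
          linarith
      _ = X ^ 82 := by ring
  have hX82 : 0 < X ^ 82 := by positivity
  have hℓD : ℓ ≤ X ^ 82 := by
    refine le_trans ?_ hD
    have h3 : ℓ ≤ ℓ ^ 6 := le_self_pow₀ (by linarith) (by norm_num)
    nlinarith
  rw [← div_le_iff₀ hX82]
  refine le_min ?_ (le_min ?_ ?_)
  · have e : σ / (2 * b * L) = σ / b / (2 * L) := by field_simp
    rw [e]
    exact div_le_self (by positivity) (by linarith)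
  · have e : g * ηH * σ ^ 2 / (2 * (b : ℝ) ^ 2 * ε)
        = σ / b / (2 * L) * (g * (σ / b / (10 * ℓ * ε))) := by
      rw [h.ηH_eq]; field_simp
    rw [e, div_eq_mul_inv]
    refine mul_le_mul_of_nonneg_left ?_ (by positivity)
    refine le_trans ?_ (le_mul_of_one_le_left (by positivity) hδ)
    rw [inv_le_comm₀ hX82 (by positivity)]
    refine le_trans ?_ hD
    have e2 : (σ / b / (10 * ℓ * ε))⁻¹ = 10 * ℓ * ε * (b / σ) := by field_simp
    rw [e2]
    calc 10 * ℓ * ε * (b / σ) ≤ 10 * ℓ * ε * (3001 * ℓ ^ 5 * (1 / ε + ρ / εH ^ 2)) := by gcongr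
      _ = 30010 * ℓ ^ 6 * (1 + ρ * ε / εH ^ 2) := by field_simp; norm_num
      _ ≤ _ := by gcongr
  · refine Real.le_sqrt_of_sq_le ?_
    have e : 2 * g * ηH * σ ^ 2 / ((b : ℝ) ^ 2 * L)
        = (σ / b / (2 * L)) ^ 2 * (4 / 5 * g / ℓ) := by
      rw [h.ηH_eq]; field_simp; norm_num
    rw [e, div_pow, div_eq_mul_inv]
    refine mul_le_mul_of_nonneg_left ?_ (by positivity)
    rw [inv_le_comm₀ (by positivity) (by positivity), inv_div, div_le_iff₀ (by positivity)]
    have h4 : ℓ ≤ (X ^ 82) ^ 2 * (4 / 5) := by nlinarith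
    nlinarith [mul_le_mul_of_nonneg_left hδ (by positivity : 0 ≤ (X ^ 82) ^ 2 * (4 / 5))]

theorem escapeConditions (h : Schedule L ρ σ ε εH Λ ℓ ηH b T) {ν r θ t : ℝ} {N : ℕ}
    (hr : 0 < r) (hr' : r ≤ σ / (2 * b * L)) (hN : 0 < N) (ht : 0 < t) (hNt : N * t ≤ 1)
    (hXν : 1 ≤ ν * Real.exp Λ)
    (hXt : 1 ≤ t * Real.exp Λ ^ 300) (hXT : (T : ℝ) + 3 ≤ Real.exp Λ ^ 28)
    (hδ : 1 ≤ Real.log (4 / δ)) (hX : 1 + ρ * ε / εH ^ 2 ≤ Real.exp Λ)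
    (hνr : ν * rMax b ηH L σ ε δ ≤ r) :
    EscapeConditions (params b T ηH r θ L σ) L ρ εH ((T + 3) * (σ / b / (2 * L)))
      (εH / (12 * ℓ)) ℓ t N := by
  have h2 : (2 : ℝ) ≤ Real.exp Λ := by linarith [Real.add_one_le_exp Λ, h.one_le]
  have hL := h.L_pos; have hσ := h.σ_pos; have hb := h.b_pos; have hℓ := h.ℓ_ge
  have hεH := h.εH_pos
  have hℓ0 : 0 < ℓ := by linarith
  have hD := h.sqrt_Dbar r θ
  have hrad := h.radius_ge hδ hX
  have hgr := h.exp_le_growth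
  have hexp := h.exp_ℓ
  set X := Real.exp Λ
  have hX0 : 0 < X := by linarith
  refine ⟨h.couplingConditions r θ, by positivity, hεH.le, h.ηH_pos, ?_, ?_, ?_, hr, ?_, ?_,
    hℓ0.le, h.batch_ge, hN, ht, hNt, ?_⟩
  · change ηH * L ≤ 1 / 10
    rw [h.ηH_eq, div_mul_eq_mul_div, div_le_iff₀ (by positivity)]
    nlinarith
  · exact Nat.le_self_pow two_ne_zero b
  · simp only [params]; positivity
  · rw [hD]
    refine hr'.trans (le_of_eq ?_)
    field_simp
  · rw [hD]; exact le_rfl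
  · change 4 * ((T + 3) * (σ / b / (2 * L))) < t * r * (1 + ηH * εH) ^ T
    set y := σ / b / (2 * L)
    have hy : 0 < y := by positivity
    have hrX : y ≤ r * X ^ 83 := by
      have hrm : 0 ≤ rMax b ηH L σ ε δ := by
        by_contra hneg
        have := mul_neg_of_neg_of_pos (not_le.mp hneg) (by positivity : 0 < X ^ 82)
        linarith
      calc y ≤ rMax b ηH L σ ε δ * X ^ 82 := hrad
        _ ≤ (ν * X) * (rMax b ηH L σ ε δ * X ^ 82) :=
          le_mul_of_one_le_left (by positivity) hXν
        _ = (ν * rMax b ηH L σ ε δ) * X ^ 83 := by ring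
        _ ≤ r * X ^ 83 := by gcongr
    have h4 : 4 ≤ X ^ 2 := by nlinarith
    calc 4 * ((T + 3) * y) ≤ X ^ 2 * (X ^ 28 * (r * X ^ 83)) := by gcongr
      _ = r * X ^ 113 := by ring
      _ ≤ (t * X ^ 300) * (r * X ^ 113) := le_mul_of_one_le_left (by positivity) hXt
      _ = t * r * X ^ 413 := by ring
      _ < t * r * X ^ 1000 := by
        refine mul_lt_mul_of_pos_left ?_ (by positivity)
        exact pow_lt_pow_right₀ (by linarith) (by norm_num)
      _ ≤ t * r * (1 + ηH * εH) ^ T := by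
        rw [hexp] at hgr
        gcongr

end Schedule

/-! ### The logarithmic factor -/

section LogFactor

variable {d : ℕ} {L ρ Δ ε εH δ ν : ℝ}

theorem one_le_logFactor (hd : 0 < d) (hL : 0 < L) (hρ : 0 < ρ) (hΔ : 0 < Δ) (hε : 0 < ε)
    (hεH : 0 < εH) (hδ : 0 < δ) (hδ' : δ < 1) (hν : 0 < ν) (hν' : ν ≤ 1) :
    1 ≤ logFactor d L ρ Δ ε εH δ ν := by
  have hd' : (1 : ℝ) ≤ d := by exact_mod_cast hd
  have h0 : 1 ≤ d / (δ * ν) := by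
    rw [one_le_div (by positivity)]; nlinarith
  have h1 : 1 ≤ 1 + L / εH := by have : 0 < L / εH := by positivity
                                 linarith
  have h2 : 1 ≤ 1 + ρ * ε / εH ^ 2 := by have : 0 < ρ * ε / εH ^ 2 := by positivity
                                         linarith
  have h3 : 1 ≤ 1 + L * Δ / ε ^ 2 := by have : 0 < L * Δ / ε ^ 2 := by positivity
                                        linarith
  have := Real.log_nonneg (one_le_mul_of_one_le_of_one_le (one_le_mul_of_one_le_of_one_le
    (one_le_mul_of_one_le_of_one_le h0 h1) h2) h3)
  unfold logFactor
  linarith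

/-- The exponential of the logarithmic factor dominates each of the quantities under the
logarithm. -/
theorem le_exp_logFactor (hd : 0 < d) (hL : 0 < L) (hρ : 0 < ρ) (hΔ : 0 < Δ) (hε : 0 < ε)
    (hεH : 0 < εH) (hδ : 0 < δ) (hδ' : δ < 1) (hν : 0 < ν) (hν' : ν ≤ 1) :
    (d : ℝ) ≤ Real.exp (logFactor d L ρ Δ ε εH δ ν) ∧
    1 ≤ δ * Real.exp (logFactor d L ρ Δ ε εH δ ν) ∧
    1 ≤ ν * Real.exp (logFactor d L ρ Δ ε εH δ ν) ∧
    L / εH ≤ Real.exp (logFactor d L ρ Δ ε εH δ ν) ∧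
    1 + ρ * ε / εH ^ 2 ≤ Real.exp (logFactor d L ρ Δ ε εH δ ν) ∧
    L * Δ / ε ^ 2 ≤ Real.exp (logFactor d L ρ Δ ε εH δ ν) := by
  have hd' : (1 : ℝ) ≤ d := by exact_mod_cast hd
  have p1 : 0 < L / εH := by positivity
  have p2 : 0 < ρ * ε / εH ^ 2 := by positivity
  have p3 : 0 < L * Δ / ε ^ 2 := by positivity
  set u₀ := d / (δ * ν) with hu₀
  set u₁ := 1 + L / εH with hu₁
  set u₂ := 1 + ρ * ε / εH ^ 2 with hu₂
  set u₃ := 1 + L * Δ / ε ^ 2 with hu₃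
  have h0 : 1 ≤ u₀ := by rw [hu₀, one_le_div (by positivity)]; nlinarith
  have h1 : 1 ≤ u₁ := by linarith
  have h2 : 1 ≤ u₂ := by linarith
  have h3 : 1 ≤ u₃ := by linarith
  have hX : u₀ * u₁ * u₂ * u₃ ≤ Real.exp (logFactor d L ρ Δ ε εH δ ν) := by
    unfold logFactor
    rw [← hu₀, ← hu₁, ← hu₂, ← hu₃, Real.exp_add, Real.exp_log (by positivity)]
    exact le_mul_of_one_le_left (by positivity) (Real.one_le_exp zero_le_one)
  have h01 : 1 ≤ u₀ * u₁ := one_le_mul_of_one_le_of_one_le h0 h1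
  have h012 : 1 ≤ u₀ * u₁ * u₂ := one_le_mul_of_one_le_of_one_le h01 h2
  have g012 : u₀ * u₁ * u₂ ≤ u₀ * u₁ * u₂ * u₃ := le_mul_of_one_le_right (by linarith) h3
  have g01 : u₀ * u₁ ≤ u₀ * u₁ * u₂ := le_mul_of_one_le_right (by linarith) h2
  have g0 : u₀ ≤ u₀ * u₁ := le_mul_of_one_le_right (by linarith) h1
  have g1 : u₁ ≤ u₀ * u₁ := le_mul_of_one_le_left (by linarith) h0
  have g2 : u₂ ≤ u₀ * u₁ * u₂ := le_mul_of_one_le_left (by linarith) h01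
  have g3 : u₃ ≤ u₀ * u₁ * u₂ * u₃ := le_mul_of_one_le_left (by linarith) h012
  set X := Real.exp (logFactor d L ρ Δ ε εH δ ν)
  have hu₀X : (d : ℝ) / (δ * ν) ≤ X := by linarith
  rw [div_le_iff₀ (by positivity)] at hu₀X
  have hX0 : 0 < X := by linarith
  refine ⟨?_, ?_, ?_, by linarith, by linarith, by linarith⟩
  · nlinarith [mul_le_mul_of_nonneg_left (mul_le_one₀ hδ'.le hν.le hν') hX0.le]
  · nlinarith [mul_le_mul_of_nonneg_left hν' (by positivity : 0 ≤ X * δ)]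
  · nlinarith [mul_le_mul_of_nonneg_left hδ'.le (by positivity : 0 ≤ X * ν)]

theorem gradOrder_sqrt {σ : ℝ} (hε : 0 < ε) :
    gradOrder L ρ σ Δ ε (Real.sqrt ε)
      = (σ * L * Δ + σ * ρ ^ 3 * L * Δ) * (1 / ε ^ 3) := by
  have : Real.sqrt ε ^ 6 = ε ^ 3 := by
    have : Real.sqrt ε ^ 6 = (Real.sqrt ε ^ 2) ^ 3 := by ring
    rw [this, Real.sq_sqrt hε.le]
  unfold gradOrder
  rw [this]
  ring

theorem logFactor_sqrt_isBigO (hd : 0 < d) (hL : 0 < L) (hρ : 0 < ρ) (hΔ : 0 < Δ) (hδ : 0 < δ)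
    (hδ' : δ < 1) (hν : 0 < ν) (hν' : ν ≤ 1) :
    (fun ε : ℝ => logFactor d L ρ Δ ε (Real.sqrt ε) δ ν)
      =O[𝓝[>] 0] fun ε : ℝ => Real.log (1 / ε) := by
  have hd' : (1 : ℝ) ≤ d := by exact_mod_cast hd
  set A := d / (δ * ν) * (1 + L) * (1 + ρ) * (1 + L * Δ) with hA
  have hA0 : 0 < A := by positivity
  refine Asymptotics.IsBigO.of_bound (1 + |Real.log A| + 3) ?_
  have hmem : Set.Ioo (0 : ℝ) (Real.exp (-1)) ∈ 𝓝[>] (0 : ℝ) :=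
    Ioo_mem_nhdsGT (Real.exp_pos _)
  filter_upwards [hmem] with ε hε
  have hε0 : 0 < ε := hε.1
  have hε1 : ε ≤ 1 := hε.2.le.trans (Real.exp_le_one_iff.mpr (by norm_num))
  have hs0 : 0 < Real.sqrt ε := Real.sqrt_pos.mpr hε0
  have hlog : 1 ≤ Real.log (1 / ε) := by
    rw [one_div, Real.log_inv]
    have := Real.log_le_log hε0 hε.2.le
    rw [Real.log_exp] at this
    linarith
  have h1 := one_le_logFactor hd hL hρ hΔ hε0 hs0 hδ hδ' hν hν'
  rw [Real.norm_of_nonneg (by linarith), Real.norm_of_nonneg (by linarith)]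
  have hsq : Real.sqrt ε ^ 2 = ε := Real.sq_sqrt hε0.le
  have hle : ε ≤ Real.sqrt ε := by
    refine Real.le_sqrt_of_sq_le ?_
    nlinarith
  have hinv : 1 ≤ 1 / ε := by rw [one_le_div hε0]; exact hε1
  have e1 : 1 + L / Real.sqrt ε ≤ (1 + L) * (1 / ε) := by
    have : L / Real.sqrt ε ≤ L / ε := div_le_div_of_nonneg_left hL.le hε0 hle
    have e : L * (1 / ε) = L / ε := by ring
    linarith
  have e2 : 1 + ρ * ε / Real.sqrt ε ^ 2 = 1 + ρ := by rw [hsq]; field_simp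
  have e3 : 1 + L * Δ / ε ^ 2 ≤ (1 + L * Δ) * (1 / ε ^ 2) := by
    have : 1 ≤ 1 / ε ^ 2 := by
      rw [one_le_div (by positivity)]; exact pow_le_one₀ hε0.le hε1
    have e : L * Δ * (1 / ε ^ 2) = L * Δ / ε ^ 2 := by ring
    linarith
  have hprod : d / (δ * ν) * (1 + L / Real.sqrt ε) * (1 + ρ * ε / Real.sqrt ε ^ 2)
      * (1 + L * Δ / ε ^ 2) ≤ A * (1 / ε) ^ 3 := by
    rw [e2]
    calc d / (δ * ν) * (1 + L / Real.sqrt ε) * (1 + ρ) * (1 + L * Δ / ε ^ 2)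
        ≤ d / (δ * ν) * ((1 + L) * (1 / ε)) * (1 + ρ) * ((1 + L * Δ) * (1 / ε ^ 2)) := by gcongr
      _ = A * (1 / ε) ^ 3 := by rw [hA]; ring
  have hlog2 := Real.log_le_log (by positivity) hprod
  rw [Real.log_mul hA0.ne' (by positivity), Real.log_pow] at hlog2
  unfold logFactor
  push_cast at hlog2
  have h4 := le_abs_self (Real.log A)
  have h5 : |Real.log A| * 1 ≤ |Real.log A| * Real.log (1 / ε) :=
    mul_le_mul_of_nonneg_left hlog (abs_nonneg _)
  linarith

end LogFactor

end Lena

end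

theorem theorem1 :
    ∃ (C : ℝ) (p : ℕ), 0 < C ∧
      (∀ (d : ℕ) (L ρ σ Δ ε εH δ ν : ℝ), 0 < d → 0 < L → 0 < ρ → 0 < σ → 0 < Δ → 0 < ε →
        0 < εH → 0 < δ → δ < 1 → 0 < ν → ν ≤ 1 →
        -- `ε` and `εH` are small enough
        εH ≤ L → σ * ε ≤ L * Δ → σ * εH ^ 2 ≤ ρ * L * Δ →
        L ^ 2 ≤ Lena.logFactor d L ρ Δ ε εH δ ν * (σ * ρ) →
        ∃ (b T : ℕ) (ηH : ℝ),
          (Lena.batchOrder ρ σ ε εH ≤ (b : ℝ) ^ 2 ∧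
            (b : ℝ) ^ 2 ≤ C * Lena.logFactor d L ρ Δ ε εH δ ν ^ p * Lena.batchOrder ρ σ ε εH) ∧
          (1 / (C * Lena.logFactor d L ρ Δ ε εH δ ν ^ p * L) ≤ ηH ∧ ηH ≤ 1 / L) ∧
          (1 / (ηH * εH) ≤ (T : ℝ) ∧
            (T : ℝ) ≤ C * Lena.logFactor d L ρ Δ ε εH δ ν ^ p / (ηH * εH)) ∧
          ∀ (Ξ : Type*) [MeasurableSpace Ξ] (P : Measure Ξ) [IsProbabilityMeasure P]
            (f : Lena.Vec d → Ξ → ℝ) (x₁ : Lena.Vec d),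
            Lena.Assumptions P f x₁ L ρ σ Δ →
            ∀ r θ : ℝ, ν * Lena.rMax b ηH L σ ε δ ≤ r → r ≤ Lena.rMax b ηH L σ ε δ →
              ε / 2 ≤ θ → θ ≤ ε →
              Lena.drawLaw P d
                {ω | ¬ Lena.Succeeds (Lena.objective P f) f (Lena.params b T ηH r θ L σ) x₁
                  (θ + ε / 2) εH
                  (C * Lena.logFactor d L ρ Δ ε εH δ ν ^ p * Lena.gradOrder L ρ σ Δ ε εH) ω}
                ≤ ENNReal.ofReal δ) ∧
      (∀ (d : ℕ) (L ρ σ Δ δ ν : ℝ), 0 < d → 0 < L → 0 < ρ → 0 < σ → 0 < Δ → 0 < δ → δ < 1 →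
        0 < ν → ν ≤ 1 →
        (fun ε : ℝ => C * Lena.logFactor d L ρ Δ ε (Real.sqrt ε) δ ν ^ p *
            Lena.gradOrder L ρ σ Δ ε (Real.sqrt ε))
          =O[𝓝[>] 0] fun ε : ℝ => Real.log (1 / ε) ^ p * (1 / ε ^ 3)) := by
  -- The cost is of order `ℓ ^ 14` with `ℓ = 1000 * Λ`.
  refine ⟨10 ^ 55, 14, by norm_num, ?_, ?_⟩
  · intro d L ρ σ Δ ε εH δ ν hd hL hρ hσ hΔ hε hεH hδ hδ' hν hν' hεL hσε _ hLΛ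
    have hΛ := Lena.one_le_logFactor hd hL hρ hΔ hε hεH hδ hδ' hν hν'
    obtain ⟨hXd, hXδ, hXν, hX₁, hX₂, hX₃⟩ :=
      Lena.le_exp_logFactor hd hL hρ hΔ hε hεH hδ hδ' hν hν'
    set Λ := Lena.logFactor d L ρ Δ ε εH δ ν with hΛdef
    obtain ⟨b, T, h⟩ := Lena.Schedule.exists_schedule hL hρ hσ hε hεH hεL hΛ hLΛ
    set ℓ := 1000 * Λ with hℓ
    set ηH := 1 / (10 * ℓ * L) with hηH
    have hℓ0 : 0 < ℓ := by positivity
    have hηH0 : 0 < ηH := h.ηH_pos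
    have hb := h.b_pos
    have hΛ14 : Λ ≤ Λ ^ 14 := le_self_pow₀ hΛ (by norm_num)
    have hΛ10 : Λ ^ 10 ≤ Λ ^ 14 := pow_le_pow_right₀ hΛ (by norm_num)
    refine ⟨b, T, ηH, ⟨?_, ?_⟩, ⟨?_, ?_⟩, ⟨?_, ?_⟩, ?_⟩
    · have h1 : σ / ε + σ * ρ / εH ^ 2 ≤ b := by
        refine le_trans (le_mul_of_one_le_left (by positivity) ?_) h.b_ge
        have : 1 ≤ ℓ ^ 5 := one_le_pow₀ (by linarith [h.ℓ_ge])
        linarith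
      refine le_trans ?_ (pow_le_pow_left₀ (by positivity) h1 2)
      have e : Lena.batchOrder ρ σ ε εH = (σ / ε) ^ 2 + (σ * ρ / εH ^ 2) ^ 2 := by
        unfold Lena.batchOrder; ring
      have : 0 ≤ σ / ε * (σ * ρ / εH ^ 2) := by positivity
      rw [e]
      nlinarith
    · have e : Lena.batchOrder ρ σ ε εH = (σ / ε) ^ 2 + (σ * ρ / εH ^ 2) ^ 2 := by
        unfold Lena.batchOrder; ring
      have h1 := pow_le_pow_left₀ hb.le h.b_le 2
      have h2 : (σ / ε + σ * ρ / εH ^ 2) ^ 2 ≤ 2 * Lena.batchOrder ρ σ ε εH := by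
        rw [e]; nlinarith [sq_nonneg (σ / ε - σ * ρ / εH ^ 2)]
      have h0 : 0 ≤ Lena.batchOrder ρ σ ε εH := by rw [e]; positivity
      calc (b : ℝ) ^ 2 ≤ (3001 * ℓ ^ 5 * (σ / ε + σ * ρ / εH ^ 2)) ^ 2 := h1
        _ = 3001 ^ 2 * 10 ^ 30 * Λ ^ 10 * (σ / ε + σ * ρ / εH ^ 2) ^ 2 := by rw [hℓ]; ring
        _ ≤ 3001 ^ 2 * 10 ^ 30 * Λ ^ 14 * (2 * Lena.batchOrder ρ σ ε εH) := by gcongr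
        _ = (3001 ^ 2 * 10 ^ 30 * 2) * Λ ^ 14 * Lena.batchOrder ρ σ ε εH := by ring
        _ ≤ 10 ^ 55 * Λ ^ 14 * Lena.batchOrder ρ σ ε εH := by
          gcongr
          norm_num
    · rw [hηH]
      refine one_div_le_one_div_of_le (by positivity) (mul_le_mul_of_nonneg_right ?_ hL.le)
      rw [hℓ]
      linarith
    · rw [hηH]
      refine one_div_le_one_div_of_le hL (le_mul_of_one_le_left hL.le ?_)
      linarith [h.ℓ_ge]
    · refine le_trans (le_of_eq ?_) (le_trans (?_ : 10 * ℓ * (L / εH) ≤ _) h.T_ge)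
      · rw [hηH]; field_simp
      · have h1 : ℓ ≤ ℓ ^ 2 := le_self_pow₀ (by linarith [h.ℓ_ge]) (by norm_num)
        have h2 : ℓ * (L / εH) ≤ ℓ ^ 2 * (L / εH) :=
          mul_le_mul_of_nonneg_right h1 (by positivity)
        have h3 : 0 ≤ ℓ * (L / εH) := by positivity
        linarith
    · refine h.T_le.trans ?_
      have e : 21 * ℓ ^ 2 * (L / εH) = 2100 * Λ / (ηH * εH) := by
        rw [hηH, hℓ]; field_simp; norm_num
      rw [e]
      refine div_le_div_of_nonneg_right ?_ (by positivity)
      linarith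
    · intro Ξ _ P _ f x₁ hA r θ hr hr' hθ hθ'
      have h4 : 1 ≤ Real.log (4 / δ) := by
        rw [Real.le_log_iff_exp_le (by positivity), le_div_iff₀ hδ]
        nlinarith [Real.exp_one_lt_d9, Real.exp_pos 1]
      have h4' : Real.log (4 / δ) ≤ ℓ := by
        refine (Real.log_le_iff_le_exp (by positivity)).mpr ?_
        rw [div_le_iff₀ hδ, h.exp_ℓ]
        have h2 : (2 : ℝ) ≤ Real.exp Λ := by linarith [Real.add_one_le_exp Λ]
        calc (4 : ℝ) ≤ Real.exp Λ ^ 2 := by nlinarith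
          _ ≤ Real.exp Λ ^ 2 * (δ * Real.exp Λ) := le_mul_of_one_le_right (by positivity) hXδ
          _ = Real.exp Λ ^ 3 * δ := by ring
          _ ≤ Real.exp Λ ^ 1000 * δ := by
            gcongr
            · linarith
            · norm_num
      set α := min (σ / b * ε / (8 * L)) (5 / 24 * ((σ / b) ^ 2 * ℓ / L)) with hα
      have hα0 : 0 < α := lt_min (by positivity) (by positivity)
      set M := ⌈Δ / α + T + 2⌉₊ with hM
      have hM1 : Δ / α + T + 2 ≤ M := Nat.le_ceil _
      have hM2 : (M : ℝ) ≤ Δ / α + T + 3 := by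
        have := (Nat.ceil_lt_add_one (by positivity : 0 ≤ Δ / α + T + 2)).le
        linarith
      have hXT := h.T_le_pow hX₁
      obtain ⟨N, t, hN, ht, hNt, hXt, hprob⟩ := h.exists_grid hd hδ hδ' hXd hXδ hXT
        (h.iterations_le_pow hΔ hX₁ hX₂ hX₃ hM2)
      have hrpos : 0 < r := by
        refine lt_of_lt_of_le (mul_pos hν ?_) hr
        have hg := h.radius_ge h4 hX₂
        by_contra hneg
        have h5 := mul_nonpos_of_nonpos_of_nonneg (not_lt.mp hneg)
          (by positivity : 0 ≤ Real.exp Λ ^ 82)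
        have : 0 < σ / b / (2 * L) := by positivity
        linarith
      have hr₀ : r ≤ σ / (2 * b * L) := hr'.trans (min_le_left _ _)
      have hr₁ := hr'.trans ((min_le_right _ _).trans (min_le_left _ _))
      have hr₂ := hr'.trans ((min_le_right _ _).trans (min_le_right _ _))
      have hE : σ / b * ℓ ≤ ε / 2 := by
        have h5 := h.noise_le
        have h6 : ℓ ≤ ℓ ^ 5 := le_self_pow₀ (by linarith [h.ℓ_ge]) (by norm_num)
        have h7 := mul_le_mul_of_nonneg_left h6 (by positivity : 0 ≤ σ / b)
        linarith
      refine (Lena.measure_not_succeeds_le (a := Lena.params b T ηH r θ L σ) hA hσ hL hα0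
        (by exact_mod_cast hb) rfl rfl rfl ?_
        (h.movementConditions hrpos.le hr₀ (by linarith))
        (h.decreaseConditions hrpos.le (by linarith) h4' hr₁ hr₂ hθ hθ')
        (h.escapeConditions hrpos hr₀ hN ht hNt hXν hXt hXT h4 hX₂ hr) hE
        (M := M) ?_ (h.cost_le hΔ hσε hM2)).trans hprob
      · have h5 := h.T_add_three_le_b
        have h6 : ((T + 1 : ℕ) : ℝ) ≤ b := by push_cast; linarith
        exact_mod_cast h6
      · change Δ / α + T + 1 < M
        linarith
  · intro d L ρ σ Δ δ ν hd hL hρ hσ hΔ hδ hδ' hν hν'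
    have h1 := (((Lena.logFactor_sqrt_isBigO hd hL hρ hΔ hδ hδ' hν hν').pow 14).const_mul_left
      ((10 : ℝ) ^ 55)).mul (Asymptotics.isBigO_const_mul_self (σ * L * Δ + σ * ρ ^ 3 * L * Δ)
        (fun ε : ℝ => 1 / ε ^ 3) (𝓝[>] 0))
    refine Asymptotics.IsBigO.congr' h1 ?_ EventuallyEq.rfl
    filter_upwards [self_mem_nhdsWithin] with ε hε
    rw [Lena.gradOrder_sqrt hε]
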